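/- Let $\tau=\frac{1+\sqrt5}{2}$, let $x\mapsto x'$ be the algebraic conjugation of $\mathbb Q(\tau)$ (so $\tau'=1-\tau$), and identify $\mathbb R^4$ with Hamilton's quaternions, with Euclidean norm $|\cdot|$. Let $L\subset\mathbb R^4$ be the root lattice $A_4$ in the form of the $\mathbb Z$-span of $(1,0,0,0)$, $\frac12(-1,1,1,1)$, $(0,-1,0,0)$, $\frac12(0,1,\tau-1,-\tau)$. Let $\mathbb I$ be the icosian ring, the $\mathbb Z[\tau]$-span of $(1,0,0,0)$, $(0,1,0,0)$, $\frac12(1,1,1,1)$, $\frac12(1-\tau,\tau,0,1)$, and let $\tilde x=(x_0',x_1',x_3',x_2')$ be the twist map on $\mathbb I$. For a linear isometry $R$ of $\mathbb R^4$ put $L(R)=L\cap RL$; $R$ is a coincidence isometry of $L$ if $\varSigma(R)=[L:L(R)]$ is finite, and a coincidence rotation if moreover $\det R=1$. An icosian $q$ is primitive if $cq\in\mathbb I$ with $c\in\mathbb Q(\tau)$ implies $c\in\mathbb Z[\tau]$, and admissible if $|q\tilde q|\in\mathbb N$. For primitive admissible $q$ let $R(q)x=\frac{1}{|q\tilde q|}\,q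 x\tilde q$. Greatest common divisors and least common multiples are taken in $\mathbb Z[\tau]$, where they are defined up to units. Then: 1. $L=\{x\in\mathbb I\mid x=\tilde x\}=\{x+\tilde x\mid x\in\mathbb I\}$. 2. The coincidence rotations of $L$ are exactly the maps $R(q)$ with $q\in\mathbb I$ primitive and admissible. 3. For every primitive admissible $q$ there is $\alpha_q\in\mathbb Z[\tau]$ with $$\alpha_q^2=\frac{|\tilde q|^2}{\gcd(|q|^2,|\tilde q|^2)},\qquad (\alpha_q')^2=\frac{|q|^2}{\gcd(|q|^2,|\tilde q|^2)}$$ for a suitable choice of the gcd (the same in both formulas). A value of $\alpha_q$ below means any $\alpha_q\in\mathbb Z[\tau]$ satisfying the first formula for some choice of the gcd. 4. For every primitive admissible $q$, the positive integer $\varSigma(R(q))$ is a least common multiple of $|q|^2$ and $|\tilde q|^2$ in $\mathbb Z[\tau]$; equivalently, up to units of $\mathbb Z[\tau]$, $\varSigma(R(q))=\mathrm{lcm}(|q|^2,|\tilde q|^2)=|q\tilde q|^2/\gcd(|q|^2,|\tilde q|^2)$. Moreover $\varSigma(R(q))=|q\tilde q|\cdot|\alpha_q\alpha_q'|$ for every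 value of $\alpha_q$. 5. The coincidence spectrum $\{\varSigma(R)\mid R \text{ a coincidence isometry of } L\}$ is the set of all positive integers, and so is the set of indices of the coincidence rotations of $L$. 6. For every primitive admissible $q$ and every value of $\alpha_q$, with $q_\alpha=\alpha_q q$ and $\tilde q_\alpha=\widetilde{q_\alpha}=\alpha_q'\tilde q$, $$L\cap R(q)L=L\cap\frac{q_\alpha L\tilde q_\alpha}{|q_\alpha\tilde q_\alpha|}=\{q_\alpha x+\tilde x\tilde q_\alpha\mid x\in\mathbb I\}=(q_\alpha\mathbb I+\mathbb I\tilde q_\alpha)\cap L .$$ -/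

import Mathlib

open scoped Quaternion

noncomputable section

namespace A4

/-! ### The field `ℚ(τ) = ℚ(√5)`, the ring `ℤ[τ]`, and quaternions -/

/-- The real quadratic field `ℚ(τ)` with `τ² = 1 + τ`; `star` is its algebraic conjugation
`x ↦ x'`, that is `τ' = 1 - τ`. -/
abbrev Qtau : Type := QuadraticAlgebra ℚ 1 1

/-- The golden mean `τ` as an element of `ℚ(τ)`. -/
def tau : Qtau := QuadraticAlgebra.omega

/-- The number `1/2` as an element of `ℚ(τ)`. -/
def half : Qtau := ⟨1 / 2, 0⟩

/-- The ring `ℤ[τ]`. -/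
def ZTau : Subring Qtau := Subring.closure {tau}

/-- The embedding `ℚ(τ) → ℝ` sending `τ` to `(1 + √5) / 2`. -/
def realEmb : Qtau →ₐ[ℚ] ℝ :=
  QuadraticAlgebra.lift ⟨Real.goldenRatio, by
    rw [← sq, Real.goldenRatio_sq]; simp [add_comm]⟩

/-- The quaternion `(a, b, c, d) = a + b i + c j + d k`. -/
def quat {R : Type*} [Zero R] [One R] [Neg R] (a b c d : R) : ℍ[R] := ⟨a, b, c, d⟩

/-- The coordinatewise embedding of the quaternions over `ℚ(τ)` into Hamilton's quaternions `ℍ(ℝ)`,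
the latter being Euclidean 4-space. -/
def emb (x : ℍ[Qtau]) : ℍ[ℝ] :=
  quat (realEmb x.re) (realEmb x.imI) (realEmb x.imJ) (realEmb x.imK)

/-- `x ↦ x̃ = (x₀', x₁', x₃', x₂')` on quaternions over `ℚ(τ)`. -/
def twistFun (x : ℍ[Qtau]) : ℍ[Qtau] :=
  quat (star x.re) (star x.imI) (star x.imK) (star x.imJ)

/-! ### The icosian ring -/

/-- The icosian `(1,0,0,0)`. -/
def e0 : ℍ[Qtau] := quat 1 0 0 0

/-- The icosian `(0,1,0,0)`. -/
def e1 : ℍ[Qtau] := quat 0 1 0 0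

/-- The icosian `½(1,1,1,1)`. -/
def e2 : ℍ[Qtau] := quat half half half half

/-- The icosian `½(1-τ,τ,0,1)`. -/
def e3 : ℍ[Qtau] := quat (half * (1 - tau)) (half * tau) 0 half

/-- The icosian ring `𝕀`, the `ℤ[τ]`-span of
`(1,0,0,0)`, `(0,1,0,0)`, `½(1,1,1,1)`, `½(1-τ,τ,0,1)`. -/
def icosians : Submodule ZTau ℍ[Qtau] := Submodule.span ZTau {e0, e1, e2, e3}

theorem tau_mem : tau ∈ ZTau := Subring.subset_closure rfl

theorem star_tau : star tau = 1 - tau := by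
  ext <;> simp [tau, QuadraticAlgebra.re_one, QuadraticAlgebra.im_one]

theorem star_mem {a : Qtau} (ha : a ∈ ZTau) : star a ∈ ZTau := by
  induction ha using Subring.closure_induction with
  | mem x hx =>
    obtain rfl : x = tau := hx
    rw [star_tau]
    exact ZTau.sub_mem ZTau.one_mem tau_mem
  | zero => simp [ZTau.zero_mem]
  | one => simp [ZTau.one_mem]
  | add x y _ _ hx hy => simpa using ZTau.add_mem hx hy
  | neg x _ hx => simpa using ZTau.neg_mem hx
  | mul x y _ _ hx hy => simpa using ZTau.mul_mem hx hy

theorem mem_icosians {x : ℍ[Qtau]} :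
    x ∈ icosians ↔ ∃ a b c d : ZTau, x = a • e0 + b • e1 + c • e2 + d • e3 := by
  simp only [icosians, Submodule.mem_span_insert, Submodule.mem_span_singleton]
  constructor
  · rintro ⟨a, _, ⟨b, _, ⟨c, _, ⟨d, rfl⟩, rfl⟩, rfl⟩, rfl⟩
    exact ⟨a, b, c, d, by abel⟩
  · rintro ⟨a, b, c, d, rfl⟩
    exact ⟨a, _, ⟨b, _, ⟨c, _, ⟨d, rfl⟩, rfl⟩, rfl⟩, by abel⟩

theorem comb_eq (a b c d : ZTau) : a • e0 + b • e1 + c • e2 + d • e3 =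
    quat (a + c * half + d * (half * (1 - tau))) (b + c * half + d * (half * tau))
      (c * half) (c * half + d * half) := by
  have h0 : a • e0 = quat (a : Qtau) 0 0 0 := by
    change quat (a * 1 : Qtau) (a * 0) (a * 0) (a * 0) = _
    simp only [mul_one, mul_zero]
  have h1 : b • e1 = quat 0 (b : Qtau) 0 0 := by
    change quat (b * 0 : Qtau) (b * 1) (b * 0) (b * 0) = _
    simp only [mul_one, mul_zero]
  rw [h0, h1]
  change quat (a + 0 + c * half + d * (half * (1 - tau)) : Qtau)
    (0 + b + c * half + d * (half * tau)) (0 + 0 + c * half + d * 0)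
    (0 + 0 + c * half + d * half) = _
  simp only [add_zero, zero_add, mul_zero]

theorem half_add_half : half + half = 1 := by
  ext <;> norm_num [half, QuadraticAlgebra.re_one, QuadraticAlgebra.im_one]

theorem star_half : star half = half := by
  ext <;> simp [half]

theorem tau_mul_tau : tau * tau = 1 + tau := by
  ext <;> simp [tau, QuadraticAlgebra.re_one, QuadraticAlgebra.im_one]

theorem normSq_mem {x : ℍ[Qtau]} (hx : x ∈ icosians) : Quaternion.normSq x ∈ ZTau := by
  obtain ⟨a, b, c, d, rfl⟩ := mem_icosians.1 hx
  have key : Quaternion.normSq (a • e0 + b • e1 + c • e2 + d • e3) =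
      ((a * a + b * b + c * c + d * d + a * c + b * c + c * d
        + (1 - ⟨tau, tau_mem⟩) * (a * d) + ⟨tau, tau_mem⟩ * (b * d) : ZTau) : Qtau) := by
    rw [comb_eq, Quaternion.normSq_def']
    simp only [quat]
    push_cast
    have h1 := half_add_half
    have h2 := tau_mul_tau
    generalize (a : Qtau) = a, (b : Qtau) = b, (c : Qtau) = c, (d : Qtau) = d
    generalize half = h at *
    generalize tau = t at *
    grind
  rw [key]
  exact Subtype.prop _

theorem twistFun_mem {x : ℍ[Qtau]} (hx : x ∈ icosians) : twistFun x ∈ icosians := by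
  obtain ⟨a, b, c, d, rfl⟩ := mem_icosians.1 hx
  refine mem_icosians.2 ⟨⟨_, star_mem a.2⟩, ⟨_, star_mem b.2⟩,
    ⟨_, ZTau.add_mem (star_mem c.2) (star_mem d.2)⟩, ⟨_, ZTau.neg_mem (star_mem d.2)⟩, ?_⟩
  rw [comb_eq, comb_eq]
  ext1 <;>
    simp only [twistFun, quat, star_add, star_mul, star_half, star_sub, star_one, star_tau] <;> ring

/-- The twist map `x ↦ x̃` on the icosian ring. -/
def twist (x : icosians) : icosians := ⟨twistFun x, twistFun_mem x.2⟩

/-- The (reduced) norm `|q|² ∈ ℤ[τ]` of an icosian `q`. -/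
def nrd (q : icosians) : ZTau := ⟨Quaternion.normSq (q : ℍ[Qtau]), normSq_mem q.2⟩

/-- `|q q̃|`, the Euclidean length of the quaternion `q q̃`. -/
def twistNorm (q : icosians) : ℝ := ‖emb (q * twist q)‖

/-- An icosian `q` is primitive if `c q ∈ 𝕀` with `c ∈ ℚ(τ)` only holds for `c ∈ ℤ[τ]`. -/
def IsPrimitive (q : icosians) : Prop :=
  ∀ c : Qtau, c • (q : ℍ[Qtau]) ∈ icosians → c ∈ ZTau

/-- An icosian `q` is admissible if `|q q̃|` is a natural number. -/
def IsAdmissible (q : icosians) : Prop := ∃ n : ℕ, twistNorm q = n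

/-- The map `R(q) : x ↦ q x q̃ / |q q̃|` of Euclidean 4-space. -/
def rot (q : icosians) : ℍ[ℝ] →ₗ[ℝ] ℍ[ℝ] where
  toFun x := (twistNorm q)⁻¹ • (emb q * x * emb (twist q))
  map_add' x y := by simp only [mul_add, add_mul, smul_add]
  map_smul' r x := by
    simp only [mul_smul_comm, smul_mul_assoc, RingHom.id_apply, smul_comm r]

/-! ### Coincidence isometries -/

/-- `Γ(R) = Γ ∩ RΓ`. -/
def coincidenceLattice (Γ : AddSubgroup ℍ[ℝ]) (R : ℍ[ℝ] →ₗ[ℝ] ℍ[ℝ]) : AddSubgroup ℍ[ℝ] :=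
  Γ ⊓ Γ.map R.toAddMonoidHom

/-- The coincidence index `Σ(R) = [Γ : Γ(R)]` (with value `0` if this is infinite). -/
def coincidenceIndex (Γ : AddSubgroup ℍ[ℝ]) (R : ℍ[ℝ] →ₗ[ℝ] ℍ[ℝ]) : ℕ :=
  (coincidenceLattice Γ R).relIndex Γ

/-- `R` is a coincidence isometry of `Γ`: a linear isometry such that `Γ ∩ RΓ` has finite index
in `Γ`. -/
def IsCoincidenceIsometry (Γ : AddSubgroup ℍ[ℝ]) (R : ℍ[ℝ] →ₗ[ℝ] ℍ[ℝ]) : Prop :=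
  (∀ x, ‖R x‖ = ‖x‖) ∧ (coincidenceLattice Γ R).IsFiniteRelIndex Γ

/-- `R` is a coincidence rotation of `Γ`: an orientation preserving coincidence isometry. -/
def IsCoincidenceRotation (Γ : AddSubgroup ℍ[ℝ]) (R : ℍ[ℝ] →ₗ[ℝ] ℍ[ℝ]) : Prop :=
  IsCoincidenceIsometry Γ R ∧ LinearMap.det R = 1

/-- The coincidence spectrum of `Γ`, the set of indices of all coincidence isometries. -/
def coincidenceSpectrum (Γ : AddSubgroup ℍ[ℝ]) : Set ℕ :=
  {n | ∃ R, IsCoincidenceIsometry Γ R ∧ coincidenceIndex Γ R = n}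

/-- The set of indices of all coincidence rotations of `Γ`. -/
def rotationSpectrum (Γ : AddSubgroup ℍ[ℝ]) : Set ℕ :=
  {n | ∃ R, IsCoincidenceRotation Γ R ∧ coincidenceIndex Γ R = n}

open Real in
/-- The root lattice `A₄` in `ℝ⁴` (scaled so that its roots have length 1): the `ℤ`-span of
`(1,0,0,0)`, `½(-1,1,1,1)`, `(0,-1,0,0)`, `½(0,1,τ-1,-τ)`. -/
def rootLattice : AddSubgroup ℍ[ℝ] :=
  AddSubgroup.closure
    {quat 1 0 0 0, quat (-1 / 2) (1 / 2) (1 / 2) (1 / 2), quat 0 (-1) 0 0,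
      quat 0 (1 / 2) ((goldenRatio - 1) / 2) (-goldenRatio / 2)}

/-! ### Greatest common divisors, least common multiples, extensions -/

/-- `g` is a greatest common divisor of `a` and `b`. -/
def IsGCD {R : Type*} [CommRing R] (a b g : R) : Prop :=
  (g ∣ a ∧ g ∣ b) ∧ ∀ d, d ∣ a → d ∣ b → d ∣ g

/-- `m` is a least common multiple of `a` and `b`. -/
def IsLCM {R : Type*} [CommRing R] (a b m : R) : Prop :=
  (a ∣ m ∧ b ∣ m) ∧ ∀ c, a ∣ c → b ∣ c → m ∣ c

/-- `α ∈ ℤ[τ]` is a value of `α_q = √(|q̃|² / gcd(|q|², |q̃|²))`, which is defined up to units. -/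
def IsExtensionFactor (q : icosians) (α : ZTau) : Prop :=
  ∃ g : ZTau, IsGCD (nrd q) (nrd (twist q)) g ∧ α ^ 2 * g = nrd (twist q)

end A4

end

open scoped Quaternion
noncomputable section
namespace A4

-- Write L for the lattice, R for R(q), m = |qq̃|. The index is computed over ℤ[τ], in the icosian
-- ring, and then descended to ℤ.
--
-- The norm of a primitive admissible q has the form dβ² with d a positive integer and β, β'
-- coprime, because its field norm m² is a square (`exists_nrd_eq`). With ββ' = ±k this gives m =
-- dk, gcd(|q|², |q̃|²) = d, lcm = dk², and α_q is β' up to a unit. It remains to show Σ(R) = dk².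
--
-- Inverting R sends z to q̄z(q̃)‾/m, so z ∈ 𝕀 lies in R𝕀 exactly when q̄z(q̃)‾ ∈ m𝕀. Primitivity
-- means tr(qt) = 1 for some t ∈ 𝕀, that is qt + t̄q̄ = 1; together with the coprimality of β, β'
-- this identifies 𝕀 ∩ R𝕀 with β'q𝕀 + 𝕀βq̃ (`NormPair.mem_sum_iff`, `NormData.sum_eq`).
--
-- The index of such a sum is found by squeezing (`NormPair.index_eq_idealIndex`). Replacing q or q̃
-- by its conjugate gives four sums, and the product of their indices is n⁴, where n is the index of
-- the ideal (dβ²β'²) = (dk²) in ℤ[τ]. Each single index is at least n: in a Smith basis of the sum,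
-- the product of the elementary divisors must be divisible by both norms dβ² and dβ'². This uses
-- the Casimir identity `casimir`, by which 1 lies in the two-sided ideal generated by a primitive
-- icosian. Hence every index equals n = (dk²)².
--
-- For the descent, ℤ[τ]L = L + τL has index 5 in 𝕀, extension of scalars squares indices, and L ∩
-- RL extends to ℤ[τ]L ∩ Rℤ[τ]L. Comparing the two chains of groups gives 5Σ² = (dk²)²c with c ∣ 25;
-- as √5 is irrational, c = 5 and Σ = dk² (`NormData.relIndex_inf_map`).
--
-- Conversely, a coincidence isometry agrees on a basis with a product of reflections in twist-fixed
-- vectors over ℚ(τ), and the reflection in v is x ↦ -vx̄v/|v|². Such products are x ↦ c·axã or x ↦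
-- c·ax̄ã with c fixed by conjugation; the determinant excludes the second form, and scaling a to a
-- primitive icosian (times τ if the sign is wrong) gives R(q).
--
-- For the spectrum, primitive icosians of norm n are built one prime at a time as qur, with r a
-- primitive icosian of norm p and u of norm 1 avoiding the two submodules where qur would become
-- imprimitive. Such a q has Σ(R(q)) = lcm(n, n) = n.

local instance : Fact (∀ r : ℚ, r ^ 2 ≠ 1 + 1 * r) := ⟨fun r hr => by
  have h : (2 * r - 1) ^ 2 = 5 := by linear_combination 4 * hr
  have h5 : IsSquare ((5 : ℕ) : ℚ) := ⟨2 * r - 1, by rw [← sq, h]; norm_num⟩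
  rw [Rat.isSquare_natCast_iff] at h5
  exact (by decide : Nat.Prime 5).prime.not_isSquare h5⟩

theorem mem_ZTau_iff {c : Qtau} : c ∈ ZTau ↔ ∃ m n : ℤ, c = ⟨m, n⟩ := by
  constructor
  · intro h
    induction h using Subring.closure_induction with
    | mem x hx =>
      obtain rfl : x = tau := hx
      exact ⟨0, 1, by ext <;> simp [tau]⟩
    | zero => exact ⟨0, 0, by ext <;> simp⟩
    | one => exact ⟨1, 0, by ext <;> simp [QuadraticAlgebra.re_one, QuadraticAlgebra.im_one]⟩
    | add x y _ _ hx hy =>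
      obtain ⟨m, n, rfl⟩ := hx
      obtain ⟨m', n', rfl⟩ := hy
      exact ⟨m + m', n + n', by ext <;> simp⟩
    | neg x _ hx =>
      obtain ⟨m, n, rfl⟩ := hx
      exact ⟨-m, -n, by ext <;> simp⟩
    | mul x y _ _ hx hy =>
      obtain ⟨m, n, rfl⟩ := hx
      obtain ⟨m', n', rfl⟩ := hy
      exact ⟨m * m' + n * n', m * n' + n * m' + n * n', by ext <;> simp⟩
  · rintro ⟨m, n, rfl⟩
    have : (⟨m, n⟩ : Qtau) = m + n * tau := by ext <;> simp [tau]
    rw [this]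
    exact ZTau.add_mem (intCast_mem ZTau m) (ZTau.mul_mem (intCast_mem ZTau n) tau_mem)

/-! ### Quaternion coordinates, the trace form, and the icosians as a self-dual order -/

section quat

variable {R : Type*} [Zero R] [One R] [Neg R] (a b c d : R)

@[simp] theorem quat_re : (quat a b c d).re = a := rfl

@[simp] theorem quat_imI : (quat a b c d).imI = b := rfl

@[simp] theorem quat_imJ : (quat a b c d).imJ = c := rfl

@[simp] theorem quat_imK : (quat a b c d).imK = d := rfl

end quat

/-- The reduced trace `x + x̄` on quaternions over `ℚ(τ)`. -/
def trd (x : ℍ[Qtau]) : Qtau := 2 * x.re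

theorem add_star_eq_trd (x : ℍ[Qtau]) : x + star x = (trd x : ℍ[Qtau]) :=
  Quaternion.self_add_star' x

/-- The `ℤ[τ]`-basis of the icosian ring. -/
def icosianVec : Fin 4 → ℍ[Qtau] := ![e0, e1, e2, e3]

/-- The basis of the icosian ring dual to `icosianVec` with respect to the trace form. -/
def dualVec : Fin 4 → ℍ[Qtau] :=
  ![quat half 0 (half * tau) (half * (1 - tau)), quat 0 (-half) (half * (1 - tau)) (half * tau),
    quat 0 0 (-1) 0, quat 0 0 1 (-1)]

theorem half_eq : half = 1 / 2 := by
  rw [eq_div_iff two_ne_zero, mul_two, half_add_half]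

theorem sum_trd_smul (x : ℍ[Qtau]) : ∑ i, trd (x * dualVec i) • icosianVec i = x := by
  have ht := tau_mul_tau
  rw [Fin.sum_univ_four]
  apply Quaternion.ext <;> simp [trd, icosianVec, dualVec, e0, e1, e2, e3, half_eq] <;>
    generalize tau = t at * <;> grind

/-- The Casimir element of the trace form: over a splitting field this is the matrix identity Σ
EᵢⱼXEⱼᵢ = tr X. When tr(gt) = 1 it exhibits 1 as Σ eᵢ(gt)fᵢ, a member of 𝕀g𝕀; primitivity enters the
index bounds in this form. -/
theorem casimir (x : ℍ[Qtau]) :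
    ∑ i, icosianVec i * x * dualVec i = (trd x : ℍ[Qtau]) := by
  have ht := tau_mul_tau
  rw [Fin.sum_univ_four]
  apply Quaternion.ext <;> simp [trd, icosianVec, dualVec, e0, e1, e2, e3, half_eq] <;>
    generalize tau = t at * <;> grind

theorem icosianVec_mem (i : Fin 4) : icosianVec i ∈ icosians := by
  apply Submodule.subset_span
  fin_cases i <;> simp [icosianVec]

theorem trd_icosianVec_dualVec (i j : Fin 4) :
    trd (icosianVec i * dualVec j) = if i = j then 1 else 0 := by
  have ht := tau_mul_tau
  fin_cases i <;> fin_cases j <;>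
    simp [trd, icosianVec, dualVec, e0, e1, e2, e3, half_eq] <;>
    generalize tau = t at * <;> grind

local instance : IsScalarTower Qtau ℍ[Qtau] ℍ[Qtau] :=
  ⟨fun c x y => by apply Quaternion.ext <;> simp <;> ring⟩

local instance : SMulCommClass Qtau ℍ[Qtau] ℍ[Qtau] :=
  ⟨fun c x y => by apply Quaternion.ext <;> simp <;> ring⟩

local instance : IsScalarTower ZTau ℍ[Qtau] ℍ[Qtau] :=
  ⟨fun c x y => smul_mul_assoc (c : Qtau) x y⟩

local instance : SMulCommClass ZTau ℍ[Qtau] ℍ[Qtau] :=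
  ⟨fun c x y => (mul_smul_comm (c : Qtau) x y).symm⟩

theorem trd_add (x y : ℍ[Qtau]) : trd (x + y) = trd x + trd y := by simp [trd, mul_add]

theorem trd_neg (x : ℍ[Qtau]) : trd (-x) = -trd x := by simp [trd]

theorem trd_smul (c : Qtau) (x : ℍ[Qtau]) : trd (c • x) = c * trd x := by
  simp [trd]; ring

theorem trd_sum {ι : Type*} (s : Finset ι) (f : ι → ℍ[Qtau]) :
    trd (∑ i ∈ s, f i) = ∑ i ∈ s, trd (f i) :=
  map_sum (⟨⟨trd, by simp [trd]⟩, trd_add⟩ : ℍ[Qtau] →+ Qtau) f s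

theorem trd_mul_comm (x y : ℍ[Qtau]) : trd (x * y) = trd (y * x) := by
  simp [trd]; ring

theorem trd_star (x : ℍ[Qtau]) : trd (star x) = trd x := by simp [trd]

theorem zsmul_def (c : ZTau) (x : ℍ[Qtau]) : c • x = (c : Qtau) • x := rfl

theorem smul_mem_icosians {c : Qtau} (hc : c ∈ ZTau) {x : ℍ[Qtau]} (hx : x ∈ icosians) :
    c • x ∈ icosians :=
  icosians.smul_mem (⟨c, hc⟩ : ZTau) hx

theorem mem_icosians_of_trd {x : ℍ[Qtau]} (h : ∀ i, trd (x * dualVec i) ∈ ZTau) :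
    x ∈ icosians := by
  rw [← sum_trd_smul x]
  exact icosians.sum_mem fun i _ => smul_mem_icosians (h i) (icosianVec_mem i)

/-- The trace form is unimodular on 𝕀. Hence membership in 𝕀 can be tested by traces against the
dual basis. -/
theorem dualVec_mem (i : Fin 4) : dualVec i ∈ icosians := by
  have ht := tau_mul_tau
  have hO : ∀ m n : ℤ, (m + n * tau : Qtau) ∈ ZTau := fun m n =>
    ZTau.add_mem (intCast_mem ZTau m) (ZTau.mul_mem (intCast_mem ZTau n) tau_mem)
  apply mem_icosians_of_trd
  intro j
  have key : ∀ (x : ℍ[Qtau]) (m n : ℤ), 2 * x.re = m + n * tau → trd x ∈ ZTau := fun x m n h => by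
    rw [trd, h]; exact hO m n
  fin_cases i <;> fin_cases j
  -- The integers in the sixteen cases are the entries tr(fᵢfⱼ) = m + nτ of the matrix of the trace
  -- form in the dual basis.
  · refine key _ (-1) 0 ?_; simp [dualVec, half_eq]; grind
  · refine key _ 1 0 ?_; simp [dualVec, half_eq]; grind
  · refine key _ 0 1 ?_; simp [dualVec, half_eq]
  · refine key _ 1 (-2) ?_; simp [dualVec, half_eq]; grind
  · refine key _ 1 0 ?_; simp [dualVec, half_eq]; grind
  · refine key _ (-2) 0 ?_; simp [dualVec, half_eq]; grind
  · refine key _ 1 (-1) ?_; simp [dualVec, half_eq]; grind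
  · refine key _ (-1) 2 ?_; simp [dualVec, half_eq]; grind
  · refine key _ 0 1 ?_; simp [dualVec, half_eq]
  · refine key _ 1 (-1) ?_; simp [dualVec, half_eq]; grind
  · refine key _ (-2) 0 ?_; simp [dualVec, half_eq]
  · refine key _ 2 0 ?_; simp [dualVec, half_eq]
  · refine key _ 1 (-2) ?_; simp [dualVec, half_eq]; grind
  · refine key _ (-1) 2 ?_; simp [dualVec, half_eq]; grind
  · refine key _ 2 0 ?_; simp [dualVec, half_eq]
  · refine key _ (-4) 0 ?_; simp [dualVec, half_eq]; grind

set_option maxHeartbeats 1000000 in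
theorem icosianVec_mul_mem (i j : Fin 4) : icosianVec i * icosianVec j ∈ icosians := by
  have ht := tau_mul_tau
  have key : ∀ a b c d : Qtau, a ∈ ZTau → b ∈ ZTau → c ∈ ZTau → d ∈ ZTau →
      a • e0 + b • e1 + c • e2 + d • e3 ∈ icosians := fun a b c d ha hb hc hd =>
    mem_icosians.2 ⟨⟨a, ha⟩, ⟨b, hb⟩, ⟨c, hc⟩, ⟨d, hd⟩, rfl⟩
  have h0 := ZTau.zero_mem
  have h1 := ZTau.one_mem
  have hm := ZTau.neg_mem h1
  have htm := tau_mem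
  have hnt := ZTau.neg_mem tau_mem
  have hst := ZTau.sub_mem h1 tau_mem
  have hts := ZTau.sub_mem tau_mem h1
  have h2 : (2 : Qtau) ∈ ZTau := ofNat_mem ZTau 2
  have hm2 := ZTau.neg_mem h2
  fin_cases i <;> fin_cases j
  -- The sixteen cases form the multiplication table: `key` receives the coordinates of eᵢeⱼ.
  · convert key 1 0 0 0 h1 h0 h0 h0 using 1
    apply Quaternion.ext <;> simp [icosianVec, e0, e1, e2, e3, half_eq]
  · convert key 0 1 0 0 h0 h1 h0 h0 using 1
    apply Quaternion.ext <;> simp [icosianVec, e0, e1, e2, e3, half_eq]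
  · convert key 0 0 1 0 h0 h0 h1 h0 using 1
    apply Quaternion.ext <;> simp [icosianVec, e0, e1, e2, e3, half_eq]
  · convert key 0 0 0 1 h0 h0 h0 h1 using 1
    apply Quaternion.ext <;> simp [icosianVec, e0, e1, e2, e3, half_eq]
  · convert key 0 1 0 0 h0 h1 h0 h0 using 1
    apply Quaternion.ext <;> simp [icosianVec, e0, e1, e2, e3, half_eq]
  · convert key (-1) 0 0 0 hm h0 h0 h0 using 1
    apply Quaternion.ext <;> simp [icosianVec, e0, e1, e2, e3, half_eq]
  · convert key (tau - 1) (1 - tau) (-1) 2 hts hst hm h2 using 1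
    apply Quaternion.ext <;> simp [icosianVec, e0, e1, e2, e3, half_eq] <;>
      generalize tau = t at * <;> grind
  · convert key 0 (1 - tau) (-1) 1 h0 hst hm h1 using 1
    apply Quaternion.ext <;> simp [icosianVec, e0, e1, e2, e3, half_eq] <;>
      generalize tau = t at * <;> grind
  · convert key 0 0 1 0 h0 h0 h1 h0 using 1
    apply Quaternion.ext <;> simp [icosianVec, e0, e1, e2, e3, half_eq]
  · convert key (-tau) tau 1 (-2) hnt htm h1 hm2 using 1
    apply Quaternion.ext <;> simp [icosianVec, e0, e1, e2, e3, half_eq] <;>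
      generalize tau = t at * <;> grind
  · convert key (-1) 0 1 0 hm h0 h1 h0 using 1
    apply Quaternion.ext <;> simp [icosianVec, e0, e1, e2, e3, half_eq] <;>
      generalize tau = t at * <;> grind
  · convert key (-1) 1 0 (1 - tau) hm h1 h0 hst using 1
    apply Quaternion.ext <;> simp [icosianVec, e0, e1, e2, e3, half_eq] <;>
      generalize tau = t at * <;> grind
  · convert key 0 0 0 1 h0 h0 h0 h1 using 1
    apply Quaternion.ext <;> simp [icosianVec, e0, e1, e2, e3, half_eq]
  · convert key (-tau) 0 1 (-1) hnt h0 h1 hm using 1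
    apply Quaternion.ext <;> simp [icosianVec, e0, e1, e2, e3, half_eq] <;>
      generalize tau = t at * <;> grind
  · convert key 0 (-1) (1 - tau) tau h0 hm hst htm using 1
    apply Quaternion.ext <;> simp [icosianVec, e0, e1, e2, e3, half_eq] <;>
      generalize tau = t at * <;> grind
  · convert key (-1) 0 0 (1 - tau) hm h0 h0 hst using 1
    apply Quaternion.ext <;> simp [icosianVec, e0, e1, e2, e3, half_eq] <;>
      generalize tau = t at * <;> grind

theorem span_icosianVec : icosians = Submodule.span ZTau (Set.range icosianVec) := by
  rw [icosians]
  congr 1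
  ext x
  simp [icosianVec]
  tauto

theorem mul_mem_icosians {x y : ℍ[Qtau]} (hx : x ∈ icosians) (hy : y ∈ icosians) :
    x * y ∈ icosians := by
  rw [span_icosianVec] at hx hy
  induction hx, hy using Submodule.span_induction₂ with
  | mem_mem x y hx hy =>
    obtain ⟨i, rfl⟩ := hx
    obtain ⟨j, rfl⟩ := hy
    exact icosianVec_mul_mem i j
  | zero_left => simp
  | zero_right => simp
  | add_left x y z _ _ _ h h' => rw [add_mul]; exact icosians.add_mem h h'
  | add_right x y z _ _ _ h h' => rw [mul_add]; exact icosians.add_mem h h'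
  | smul_left r x y _ _ h => rw [zsmul_def, smul_mul_assoc]; exact smul_mem_icosians r.2 h
  | smul_right r x y _ _ h => rw [zsmul_def, mul_smul_comm]; exact smul_mem_icosians r.2 h

theorem one_mem_icosians : (1 : ℍ[Qtau]) ∈ icosians := by
  have : (1 : ℍ[Qtau]) = icosianVec 0 := by
    apply Quaternion.ext <;> simp [icosianVec, e0]
  rw [this]
  exact icosianVec_mem 0

theorem coe_mem_icosians {c : Qtau} (hc : c ∈ ZTau) : (c : ℍ[Qtau]) ∈ icosians := by
  have := smul_mem_icosians hc one_mem_icosians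
  rwa [← Quaternion.coe_mul_eq_smul, mul_one] at this

theorem trd_mem_of_mem {x : ℍ[Qtau]} (hx : x ∈ icosians) : trd x ∈ ZTau := by
  obtain ⟨a, b, c, d, rfl⟩ := mem_icosians.1 hx
  have : trd (a • e0 + b • e1 + c • e2 + d • e3) = 2 * a + c + d * (1 - tau) := by
    rw [comb_eq]
    simp only [trd, quat_re, half_eq]
    ring
  rw [this]
  exact ZTau.add_mem (ZTau.add_mem (ZTau.mul_mem (ofNat_mem ZTau 2) a.2) c.2)
    (ZTau.mul_mem d.2 (ZTau.sub_mem ZTau.one_mem tau_mem))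

theorem star_mem_icosians {x : ℍ[Qtau]} (hx : x ∈ icosians) : star x ∈ icosians := by
  have : star x = (trd x : ℍ[Qtau]) - x := by rw [← add_star_eq_trd]; abel
  rw [this]
  exact icosians.sub_mem (coe_mem_icosians (trd_mem_of_mem hx)) hx

theorem mem_icosians_iff_trd {x : ℍ[Qtau]} :
    x ∈ icosians ↔ ∀ i, trd (x * dualVec i) ∈ ZTau :=
  ⟨fun h i => trd_mem_of_mem (mul_mem_icosians h (dualVec_mem i)), mem_icosians_of_trd⟩

/-- The coordinates of icosians with respect to `icosianVec`. -/
def icosianBasis : Module.Basis (Fin 4) ZTau icosians :=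
  .ofEquivFun
    { toFun := fun x i => ⟨trd (x * dualVec i), mem_icosians_iff_trd.1 x.2 i⟩
      map_add' := fun x y => by
        ext1 i
        exact Subtype.ext (by simp [add_mul, trd_add])
      map_smul' := fun c x => by
        ext1 i
        exact Subtype.ext (by
          change trd (((c : Qtau) • (x : ℍ[Qtau])) * dualVec i) = c * trd (x * dualVec i)
          rw [smul_mul_assoc, trd_smul])
      invFun := fun f => ⟨∑ i, f i • icosianVec i,
        icosians.sum_mem fun i _ => icosians.smul_mem _ (icosianVec_mem i)⟩
      left_inv := fun x => Subtype.ext (sum_trd_smul x)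
      right_inv := fun f => by
        ext1 i
        apply Subtype.ext
        simp only [Finset.sum_mul, trd_sum, zsmul_def, smul_mul_assoc, trd_smul,
          trd_icosianVec_dualVec, mul_ite, mul_one, mul_zero, Finset.sum_ite_eq',
          Finset.mem_univ, if_true] }

/-! ### The twist map -/

theorem twistFun_add (x y : ℍ[Qtau]) : twistFun (x + y) = twistFun x + twistFun y := by
  apply Quaternion.ext <;> simp [twistFun]

theorem twistFun_mul (x y : ℍ[Qtau]) : twistFun (x * y) = twistFun y * twistFun x := by
  apply Quaternion.ext <;> simp [twistFun] <;> ring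

theorem twistFun_twistFun (x : ℍ[Qtau]) : twistFun (twistFun x) = x := by
  apply Quaternion.ext <;> simp [twistFun]

theorem twistFun_smul (c : Qtau) (x : ℍ[Qtau]) :
    twistFun (c • x) = star c • twistFun x := by
  apply Quaternion.ext <;> simp [twistFun]

theorem twistFun_star (x : ℍ[Qtau]) : twistFun (star x) = star (twistFun x) := by
  apply Quaternion.ext <;> simp [twistFun]

theorem normSq_twistFun (x : ℍ[Qtau]) :
    Quaternion.normSq (twistFun x) = star (Quaternion.normSq x) := by
  simp [Quaternion.normSq_def', twistFun]
  ring

theorem twistFun_neg (x : ℍ[Qtau]) : twistFun (-x) = -twistFun x := by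
  apply Quaternion.ext <;> simp [twistFun]

theorem twistFun_sub (x y : ℍ[Qtau]) : twistFun (x - y) = twistFun x - twistFun y := by
  rw [sub_eq_add_neg, twistFun_add, twistFun_neg, ← sub_eq_add_neg]

/-! ### Arithmetic of `ℤ[τ]` -/

theorem norm_eq (c : Qtau) :
    QuadraticAlgebra.norm c = c.re ^ 2 + c.re * c.im - c.im ^ 2 := by
  rw [QuadraticAlgebra.norm_def]; ring

/-- ℤ[τ] is norm-Euclidean: rounding both coordinates leaves a remainder a + bτ with |a|, |b| ≤ 1/2,
and then |a² + ab - b²| < 1. -/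
theorem exists_norm_sub_lt_one (z : Qtau) :
    ∃ y ∈ ZTau, |QuadraticAlgebra.norm (z - y)| < 1 := by
  refine ⟨⟨round z.re, round z.im⟩, mem_ZTau_iff.2 ⟨_, _, rfl⟩, ?_⟩
  have h1 := abs_le.1 (abs_sub_round z.re)
  have h2 := abs_le.1 (abs_sub_round z.im)
  rw [norm_eq, QuadraticAlgebra.re_sub, QuadraticAlgebra.im_sub]
  dsimp only
  generalize z.re - (round z.re : ℚ) = a at *
  generalize z.im - (round z.im : ℚ) = b at *
  rw [abs_lt]
  constructor <;> nlinarith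

theorem exists_natAbs_norm {c : Qtau} (hc : c ∈ ZTau) :
    ∃ k : ℕ, |QuadraticAlgebra.norm c| = k := by
  obtain ⟨m, n, rfl⟩ := mem_ZTau_iff.1 hc
  refine ⟨(m ^ 2 + m * n - n ^ 2).natAbs, ?_⟩
  rw [norm_eq, Nat.cast_natAbs]
  push_cast
  rfl

/-- A nonzero element of least absolute norm generates the ideal, by Euclidean division. -/
instance : IsPrincipalIdealRing ZTau := by
  refine ⟨fun J => ?_⟩
  by_cases hJ : J = ⊥
  · subst hJ; infer_instance
  choose f hf using fun c : ZTau => exists_natAbs_norm c.2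
  have hex : ∃ n, ∃ g ∈ J, g ≠ 0 ∧ f g = n := by
    obtain ⟨g, hg, hg0⟩ := Submodule.exists_mem_ne_zero_of_ne_bot hJ
    exact ⟨_, g, hg, hg0, rfl⟩
  classical
  obtain ⟨g, hg, hg0, hfg⟩ := Nat.find_spec hex
  have hmin : ∀ x ∈ J, x ≠ 0 → f g ≤ f x := fun x hx hx0 => by
    rw [hfg]; exact Nat.find_min' hex ⟨x, hx, hx0, rfl⟩
  refine ⟨g, le_antisymm (fun x hx => ?_) ((Ideal.span_singleton_le_iff_mem J).2 hg)⟩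
  have hg0' : (g : Qtau) ≠ 0 := fun h => hg0 (Subtype.ext h)
  obtain ⟨y, hy, hlt⟩ := exists_norm_sub_lt_one ((x : Qtau) / g)
  have hr : x - ⟨y, hy⟩ * g ∈ J := J.sub_mem hx (J.mul_mem_left _ hg)
  by_cases h0 : x - ⟨y, hy⟩ * g = 0
  · rw [sub_eq_zero] at h0
    rw [h0]
    exact Ideal.mul_mem_left _ _ (Ideal.mem_span_singleton_self g)
  · exfalso
    have h1 := hmin _ hr h0
    have h2 : ((x - ⟨y, hy⟩ * g : ZTau) : Qtau) = ((x : Qtau) / g - y) * g := by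
      push_cast
      rw [sub_mul, div_mul_cancel₀ _ hg0']
    have h3 := hf (x - ⟨y, hy⟩ * g)
    rw [h2, map_mul, abs_mul, hf g] at h3
    have h4 : (0 : ℚ) < f g := by
      rw [← hf g, abs_pos, Ne, QuadraticAlgebra.norm_eq_zero_iff_eq_zero]
      exact hg0'
    have h5 : (f g : ℚ) ≤ f (x - ⟨y, hy⟩ * g) := by exact_mod_cast h1
    nlinarith

/-- Algebraic conjugation on `ℤ[τ]`. -/
def conjZ : ZTau →+* ZTau where
  toFun a := ⟨star (a : Qtau), star_mem a.2⟩
  map_one' := Subtype.ext (star_one Qtau)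
  map_mul' a b := Subtype.ext (by simp)
  map_zero' := Subtype.ext (star_zero Qtau)
  map_add' a b := Subtype.ext (by simp)

@[simp] theorem coe_conjZ (a : ZTau) : (conjZ a : Qtau) = star (a : Qtau) := rfl

@[simp] theorem conjZ_conjZ (a : ZTau) : conjZ (conjZ a) = a := Subtype.ext (star_star _)

/-- The conclusion says that z = a + bτ equals (x + yτ)². As in Hilbert 90, zz' = k² gives (z + k)²
= z(z + z' + 2k) = sz. Dividing z + k by its content g leaves (A + Bτ)² = ez with A, B coprime and e
= s/g², and the coprimality conditions force e ∣ 5. -/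
theorem exists_sq_of_coprime {a b k : ℤ} (hab : IsCoprime a b) (hk : a ^ 2 + a * b - b ^ 2 = k ^ 2)
    (hpos : 0 < 2 * a + b) : ∃ x y : ℤ, a = x ^ 2 + y ^ 2 ∧ b = 2 * x * y + y ^ 2 := by
  -- Only k² matters; k ≥ 0 makes s positive and z + k nonzero.
  wlog hk0 : 0 ≤ k generalizing k
  · exact this (k := -k) (by rw [hk]; ring) (by omega)
  obtain ⟨s, hs⟩ : ∃ s, s = 2 * a + b + 2 * k := ⟨_, rfl⟩
  have hg : Int.gcd (a + k) b ≠ 0 := fun h => by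
    obtain ⟨h1, h2⟩ := Int.gcd_eq_zero_iff.1 h
    omega
  obtain ⟨A, hA⟩ := Int.gcd_dvd_left (a + k) b
  obtain ⟨B, hB⟩ := Int.gcd_dvd_right (a + k) b
  have hAB : IsCoprime A B := by
    rw [Int.isCoprime_iff_gcd_eq_one]
    have h1 : Int.gcd (Int.gcd (a + k) b * A) (Int.gcd (a + k) b * B) = Int.gcd (a + k) b := by
      rw [← hA, ← hB]
    rw [Int.gcd_mul_left, Int.natAbs_natCast] at h1
    exact Nat.eq_of_mul_eq_mul_left (Nat.pos_of_ne_zero hg) (by rw [h1, mul_one])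
  generalize Int.gcd (a + k) b = g at *
  have hg0 : (g : ℤ) ≠ 0 := by exact_mod_cast hg
  have hg2 : (g : ℤ) ^ 2 ≠ 0 := pow_ne_zero _ hg0
  have e1 : (g : ℤ) ^ 2 * (A ^ 2 + B ^ 2) = s * a := by
    have : (g : ℤ) ^ 2 * (A ^ 2 + B ^ 2) = (g * A) ^ 2 + (g * B) ^ 2 := by ring
    rw [this, ← hA, ← hB, hs]; linear_combination -hk
  have e2 : (g : ℤ) ^ 2 * (2 * A * B + B ^ 2) = s * b := by
    have : (g : ℤ) ^ 2 * (2 * A * B + B ^ 2) = 2 * (g * A) * (g * B) + (g * B) ^ 2 := by ring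
    rw [this, ← hA, ← hB, hs]; ring
  obtain ⟨e, he⟩ : (g : ℤ) ^ 2 ∣ s := by
    obtain ⟨u, v, huv⟩ := hab
    exact ⟨u * (A ^ 2 + B ^ 2) + v * (2 * A * B + B ^ 2), by
      linear_combination (-s) * huv - u * e1 - v * e2⟩
  have hX : A ^ 2 + B ^ 2 = e * a := mul_left_cancel₀ hg2 (by rw [e1, he]; ring)
  have hY : 2 * A * B + B ^ 2 = e * b := mul_left_cancel₀ hg2 (by rw [e2, he]; ring)
  have he0 : 0 < e := by
    have : 0 < (g : ℤ) ^ 2 := by positivity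
    nlinarith
  have heB : IsCoprime e B := by
    have : IsCoprime (A ^ 2 + B ^ 2) B := by
      obtain ⟨u, v, h⟩ := hAB.pow_left (m := 2)
      exact ⟨u, v - u * B, by linear_combination h⟩
    exact this.of_isCoprime_of_dvd_left ⟨a, hX⟩
  have heA : IsCoprime e A := by
    have : IsCoprime (A ^ 2 + B ^ 2) A := by
      obtain ⟨u, v, h⟩ := hAB.symm.pow_left (m := 2)
      exact ⟨u, v - u * A, by linear_combination h⟩
    exact this.of_isCoprime_of_dvd_left ⟨a, hX⟩
  -- eb = B(2A + B) and e is coprime to B. Modulo 2A + B one has 5A² ≡ A² + B² = ea, which yields e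
  -- ∣ 5.
  have hd : e ∣ 2 * A + B := heB.dvd_of_dvd_mul_right ⟨b, by rw [← hY]; ring⟩
  have h5 : e ∣ 5 := by
    refine (heA.pow_right (n := 2)).dvd_of_dvd_mul_right ?_
    have : 5 * A ^ 2 = (2 * A + B) * (2 * A - B) + e * a := by rw [← hX]; ring
    rw [this]
    exact dvd_add (hd.mul_right _) (dvd_mul_right _ _)
  have h6 : e = 1 ∨ e = 5 := by
    have := Int.le_of_dvd (by norm_num) h5
    interval_cases e <;> omega
  rcases h6 with rfl | rfl
  · exact ⟨A, B, by linarith, by linarith⟩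
  -- For e = 5 the root is (A + Bτ)/√5, with √5 = 2τ - 1; the witnesses are its coordinates.
  · obtain ⟨c, hc⟩ := hd
    obtain rfl : B = 5 * c - 2 * A := by linarith
    exact ⟨2 * c - A, c, by nlinarith, by nlinarith⟩

/-- For β = x + yτ the two numbers are ββ' and (β - β')², so this is the coprimality of β and β'
expressed in ℤ. The prime 5 needs care: if 5 divides the norm then √5 divides β, and 5 divides both
coordinates of β². -/
theorem isCoprime_conj_of_coprime {x y : ℤ} (h : IsCoprime (x ^ 2 + y ^ 2) (2 * x * y + y ^ 2)) :
    IsCoprime (x ^ 2 + x * y - y ^ 2) (5 * y ^ 2) := by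
  have hxy : IsCoprime x y := by
    obtain ⟨u, v, h⟩ := h
    exact ⟨u * x, u * y + v * (2 * x + y), by linear_combination h⟩
  have h5 : ¬(5 : ℤ) ∣ x ^ 2 + x * y - y ^ 2 := by
    intro h1
    have h2 : (5 : ℤ) ∣ (2 * x + y) ^ 2 := by
      have : (2 * x + y) ^ 2 = 4 * (x ^ 2 + x * y - y ^ 2) + 5 * y ^ 2 := by ring
      rw [this]
      exact dvd_add (h1.mul_left _) (dvd_mul_right _ _)
    have hp : Prime (5 : ℤ) := by norm_num
    obtain ⟨c, hc⟩ := hp.dvd_of_dvd_pow h2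
    obtain rfl : y = 5 * c - 2 * x := by linarith
    obtain ⟨u, v, h⟩ := h
    have : (5 : ℤ) ∣ 1 := by
      rw [← h]
      refine dvd_add (Dvd.dvd.mul_left ?_ _) (Dvd.dvd.mul_left ?_ _)
      · exact ⟨x ^ 2 - 4 * c * x + 5 * c ^ 2, by ring⟩
      · exact ⟨5 * c ^ 2 - 2 * c * x, by ring⟩
    norm_num at this
  have h6 : IsCoprime (x ^ 2 + x * y - y ^ 2) 5 := by
    have hp : Prime (5 : ℤ) := by norm_num
    exact (hp.coprime_iff_not_dvd.2 h5).symm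
  refine h6.mul_right (IsCoprime.pow_right ?_)
  obtain ⟨u, v, h⟩ := hxy.pow_left (m := 2)
  exact ⟨u, v - u * (x - y), by linear_combination h⟩

/-! ### The embedding into Hamilton's quaternions -/

/-- The embedding `emb` as a ring homomorphism. -/
def embHom : ℍ[Qtau] →+* ℍ[ℝ] where
  toFun := emb
  map_one' := by apply Quaternion.ext <;> simp [emb]
  map_mul' x y := by apply Quaternion.ext <;> simp [emb]
  map_zero' := by apply Quaternion.ext <;> simp [emb]
  map_add' x y := by apply Quaternion.ext <;> simp [emb]

theorem emb_mul (x y : ℍ[Qtau]) : emb (x * y) = emb x * emb y := map_mul embHom x y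

theorem emb_add (x y : ℍ[Qtau]) : emb (x + y) = emb x + emb y := map_add embHom x y

theorem emb_zero : emb 0 = 0 := map_zero embHom

theorem emb_sub (x y : ℍ[Qtau]) : emb (x - y) = emb x - emb y := map_sub embHom x y

theorem emb_smul (c : Qtau) (x : ℍ[Qtau]) : emb (c • x) = realEmb c • emb x := by
  apply Quaternion.ext <;> simp [emb]

theorem emb_star (x : ℍ[Qtau]) : emb (star x) = star (emb x) := by
  apply Quaternion.ext <;> simp [emb]

theorem realEmb_injective : Function.Injective realEmb := realEmb.toRingHom.injective

theorem emb_injective : Function.Injective emb := by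
  intro x y h
  have h' := Quaternion.ext_iff.1 h
  simp only [emb, quat_re, quat_imI, quat_imJ, quat_imK] at h'
  exact QuaternionAlgebra.ext (realEmb_injective h'.1) (realEmb_injective h'.2.1)
    (realEmb_injective h'.2.2.1) (realEmb_injective h'.2.2.2)

theorem normSq_emb (x : ℍ[Qtau]) :
    Quaternion.normSq (emb x) = realEmb (Quaternion.normSq x) := by
  simp [Quaternion.normSq_def', emb]

theorem norm_emb_sq (x : ℍ[Qtau]) : ‖emb x‖ ^ 2 = realEmb (Quaternion.normSq x) := by
  rw [← normSq_emb, Quaternion.normSq_eq_norm_mul_self, sq]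

theorem normSq_eq_zero_iff {x : ℍ[Qtau]} : Quaternion.normSq x = 0 ↔ x = 0 := by
  constructor
  · intro h
    have h1 := norm_emb_sq x
    rw [h, map_zero, sq_eq_zero_iff, norm_eq_zero, ← emb_zero] at h1
    exact emb_injective h1
  · rintro rfl; simp

theorem two_re_add_im_sq_nonneg (x : Qtau) : 0 ≤ 2 * (x ^ 2).re + (x ^ 2).im := by
  simp only [sq, QuadraticAlgebra.re_mul, QuadraticAlgebra.im_mul]
  nlinarith [sq_nonneg (x.re + x.im), sq_nonneg x.re, sq_nonneg x.im]

theorem two_re_add_im_sq_eq_zero {x : Qtau} (h : 2 * (x ^ 2).re + (x ^ 2).im = 0) : x = 0 := by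
  simp only [sq, QuadraticAlgebra.re_mul, QuadraticAlgebra.im_mul] at h
  have h1 : x.im = 0 := by nlinarith [sq_nonneg (x.re + x.im), sq_nonneg x.re, sq_nonneg x.im]
  have h2 : x.re = 0 := by nlinarith [sq_nonneg (x.re + x.im), sq_nonneg x.re, sq_nonneg x.im]
  exact QuadraticAlgebra.ext h2 h1

/-- The rational trace of a + bτ is 2a + b, and the trace of a square y² is y² + y'². This fixes the
sign when the square root of the norm is taken. -/
theorem trace_normSq_pos {x : ℍ[Qtau]} (hx : x ≠ 0) :
    0 < 2 * (Quaternion.normSq x).re + (Quaternion.normSq x).im := by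
  have h0 := two_re_add_im_sq_nonneg x.re
  have h1 := two_re_add_im_sq_nonneg x.imI
  have h2 := two_re_add_im_sq_nonneg x.imJ
  have h3 := two_re_add_im_sq_nonneg x.imK
  have e : 2 * (Quaternion.normSq x).re + (Quaternion.normSq x).im =
      (2 * (x.re ^ 2).re + (x.re ^ 2).im) + (2 * (x.imI ^ 2).re + (x.imI ^ 2).im) +
      (2 * (x.imJ ^ 2).re + (x.imJ ^ 2).im) + (2 * (x.imK ^ 2).re + (x.imK ^ 2).im) := by
    rw [Quaternion.normSq_def']
    simp only [QuadraticAlgebra.re_add, QuadraticAlgebra.im_add]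
    ring
  rw [e]
  by_contra! hle
  apply hx
  exact QuaternionAlgebra.ext (two_re_add_im_sq_eq_zero (by linarith))
    (two_re_add_im_sq_eq_zero (by linarith)) (two_re_add_im_sq_eq_zero (by linarith))
    (two_re_add_im_sq_eq_zero (by linarith))

/-! ### Primitive icosians -/

theorem IsPrimitive.ne_zero {q : icosians} (hq : IsPrimitive q) : (q : ℍ[Qtau]) ≠ 0 := by
  intro h
  have := hq (1 / 2) (by rw [h, smul_zero]; exact icosians.zero_mem)
  obtain ⟨m, n, hmn⟩ := mem_ZTau_iff.1 this
  have h1 : (2 : Qtau) * ⟨m, n⟩ = 1 := by rw [← hmn]; norm_num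
  have h2 := congrArg QuadraticAlgebra.re h1
  simp only [QuadraticAlgebra.re_mul, QuadraticAlgebra.re_one, QuadraticAlgebra.re_ofNat,
    QuadraticAlgebra.im_ofNat, mul_zero, zero_mul, add_zero] at h2
  have h3 : (2 : ℚ) * m = 1 := h2
  have : (2 : ℤ) * m = 1 := by exact_mod_cast h3
  omega

theorem IsPrimitive.normSq_ne_zero {q : icosians} (hq : IsPrimitive q) :
    Quaternion.normSq (q : ℍ[Qtau]) ≠ 0 := fun h => hq.ne_zero (normSq_eq_zero_iff.1 h)

/-- An icosian is primitive if and only if its reduced traces against `𝕀` represent `1`. -/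
theorem isPrimitive_iff_exists_trd {q : icosians} :
    IsPrimitive q ↔ ∃ t ∈ icosians, trd (q * t) = 1 := by
  constructor
  · intro hq
    set J : Ideal ZTau := Ideal.span (Set.range fun i =>
      (⟨trd (q * dualVec i), mem_icosians_iff_trd.1 q.2 i⟩ : ZTau)) with hJ
    obtain ⟨g, hg⟩ := (IsPrincipalIdealRing.principal J).principal
    have hmem : ∀ i, (⟨trd (q * dualVec i), mem_icosians_iff_trd.1 q.2 i⟩ : ZTau) ∈ J :=
      fun i => Ideal.subset_span ⟨i, rfl⟩
    have hdvd : ∀ i, ∃ c : ZTau, trd (q * dualVec i) = g * c := fun i => by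
      have h := hmem i
      rw [hg] at h
      obtain ⟨c, hc⟩ := Ideal.mem_span_singleton.1 h
      exact ⟨c, congrArg Subtype.val hc⟩
    have hg0 : (g : Qtau) ≠ 0 := fun h0 => by
      apply hq.ne_zero
      rw [← sum_trd_smul (q : ℍ[Qtau])]
      refine Finset.sum_eq_zero fun i _ => ?_
      obtain ⟨c, hc⟩ := hdvd i
      rw [hc, h0, zero_mul]
      exact zero_smul Qtau (icosianVec i)
    -- By duality g⁻¹q is an icosian, g being a common divisor of all traces; primitivity makes g a
    -- unit.
    have hinv : (g : Qtau)⁻¹ ∈ ZTau := by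
      apply hq
      rw [mem_icosians_iff_trd]
      intro i
      obtain ⟨c, hc⟩ := hdvd i
      rw [smul_mul_assoc, trd_smul, hc, inv_mul_cancel_left₀ hg0]
      exact c.2
    have h1 : (1 : ZTau) ∈ J := by
      rw [hg]
      exact Ideal.mem_span_singleton.2 ⟨⟨_, hinv⟩, Subtype.ext (mul_inv_cancel₀ hg0).symm⟩
    rw [hJ, Ideal.mem_span_range_iff_exists_fun] at h1
    obtain ⟨c, hc⟩ := h1
    refine ⟨∑ i, c i • dualVec i,
      icosians.sum_mem fun i _ => icosians.smul_mem _ (dualVec_mem i), ?_⟩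
    have h2 := congrArg Subtype.val hc
    rw [Finset.mul_sum, trd_sum]
    simp only [zsmul_def, mul_smul_comm, trd_smul]
    simpa using h2
  · rintro ⟨t, ht, h⟩ c hc
    have := trd_mem_of_mem (mul_mem_icosians hc ht)
    rwa [smul_mul_assoc, trd_smul, h, mul_one] at this

/-! ### Norms of admissible icosians -/

theorem twistNorm_sq (q : icosians) :
    twistNorm q ^ 2 = realEmb (Quaternion.normSq (q : ℍ[Qtau]) *
      star (Quaternion.normSq (q : ℍ[Qtau]))) := by
  rw [twistNorm, norm_emb_sq, map_mul]
  congr 2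
  exact normSq_twistFun _

theorem twistNorm_nonneg (q : icosians) : 0 ≤ twistNorm q := norm_nonneg _

/-- The norm of a primitive admissible icosian is `d β²` with `d ∈ ℕ` and `β` coprime to `β'`. -/
theorem exists_nrd_eq {q : icosians} (hq : IsPrimitive q) (ha : IsAdmissible q) :
    ∃ (d : ℕ) (β : ZTau) (k : ℕ), 0 < d ∧ 0 < k ∧ nrd q = d * β ^ 2 ∧ IsCoprime β (conjZ β) ∧
      (β * conjZ β = k ∨ β * conjZ β = -k) ∧ twistNorm q = d * k := by
  obtain ⟨m, hm⟩ := ha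
  obtain ⟨a, b, hab⟩ := mem_ZTau_iff.1 (nrd q).2
  have hN : Quaternion.normSq (q : ℍ[Qtau]) = ⟨a, b⟩ := hab
  have hpos := trace_normSq_pos hq.ne_zero
  rw [hN] at hpos
  dsimp only at hpos
  have hpos' : 0 < 2 * a + b := by exact_mod_cast hpos
  -- |qq̃|² is the field norm of |q|², so admissibility says that this field norm is a square.
  have hmm : a ^ 2 + a * b - b ^ 2 = (m : ℤ) ^ 2 := by
    have h1 := twistNorm_sq q
    rw [hm, hN, ← map_natCast realEmb, ← map_pow] at h1
    have h2 := congrArg QuadraticAlgebra.re (realEmb_injective h1)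
    simp [sq] at h2
    have h3 : (m : ℤ) * m = a * (a + b) + -(b * b) := by exact_mod_cast h2
    linarith
  have hd : 0 < Int.gcd a b := Int.gcd_pos_iff.2 (by
    by_contra! h
    omega)
  obtain ⟨a', b', hcop, ha', hb'⟩ := Int.exists_gcd_one hd
  generalize Int.gcd a b = d at *
  have hdz : (0 : ℤ) < d := by exact_mod_cast hd
  obtain ⟨k, hk⟩ : (d : ℤ) ∣ m := by
    rw [← Int.pow_dvd_pow_iff two_ne_zero, ← hmm]
    exact ⟨a' ^ 2 + a' * b' - b' ^ 2, by rw [ha', hb']; ring⟩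
  have hk0 : a' ^ 2 + a' * b' - b' ^ 2 = k ^ 2 := by
    have : (d : ℤ) ^ 2 ≠ 0 := by positivity
    apply mul_left_cancel₀ this
    have : (d : ℤ) ^ 2 * k ^ 2 = m ^ 2 := by rw [hk]; ring
    rw [this, ← hmm, ha', hb']; ring
  have hcop' : IsCoprime a' b' := Int.isCoprime_iff_gcd_eq_one.2 hcop
  obtain ⟨x, y, hx, hy⟩ := exists_sq_of_coprime hcop' hk0 (by nlinarith)
  have hm0 : m ≠ 0 := by
    rintro rfl
    have h1 := twistNorm_sq q
    rw [hm, Nat.cast_zero, zero_pow two_ne_zero, eq_comm, map_eq_zero_iff _ realEmb_injective,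
      mul_eq_zero, star_eq_zero, or_self] at h1
    exact hq.normSq_ne_zero h1
  obtain ⟨n, rfl⟩ : ∃ n : ℕ, k = n := Int.eq_ofNat_of_zero_le (by
    by_contra! h
    have : (m : ℤ) < 0 := by rw [hk]; exact mul_neg_of_pos_of_neg hdz h
    omega)
  have hmdn : m = d * n := by exact_mod_cast hk
  have hn0 : 0 < n := Nat.pos_of_ne_zero fun h => hm0 (by rw [hmdn, h, mul_zero])
  set β : ZTau := ⟨⟨x, y⟩, mem_ZTau_iff.2 ⟨x, y, rfl⟩⟩ with hβ
  have hββ : β * conjZ β = ((x ^ 2 + x * y - y ^ 2 : ℤ) : ZTau) := by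
    apply Subtype.ext
    push_cast
    ext <;> simp [hβ, sq] <;> ring
  have hsub : (β - conjZ β) ^ 2 = ((5 * y ^ 2 : ℤ) : ZTau) := by
    have h5 : ((5 : ZTau) : Qtau) = ⟨5, 0⟩ := rfl
    apply Subtype.ext
    push_cast
    ext <;> simp [hβ, h5, sq] <;> ring
  refine ⟨d, β, n, hd, hn0, ?_, ?_, ?_, ?_⟩
  · apply Subtype.ext
    rw [hab, ha', hb', hx, hy]
    push_cast
    ext <;> simp [hβ, sq] <;> ring
  · obtain ⟨u, v, huv⟩ := isCoprime_conj_of_coprime (hx ▸ hy ▸ hcop')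
    -- Obtained from u·ββ' + v(β - β')² = 1 by collecting the multiples of β and of β'.
    refine ⟨u * conjZ β + v * (β - 2 * conjZ β), v * conjZ β, ?_⟩
    have h1 : ((u * (x ^ 2 + x * y - y ^ 2) + v * (5 * y ^ 2) : ℤ) : ZTau) = 1 := by
      rw [huv, Int.cast_one]
    rw [Int.cast_add, Int.cast_mul u, Int.cast_mul v, ← hββ, ← hsub] at h1
    linear_combination h1
  · have : (x ^ 2 + x * y - y ^ 2) ^ 2 = (n : ℤ) ^ 2 := by rw [← hk0, hx, hy]; ring
    rw [hββ]
    rcases sq_eq_sq_iff_eq_or_eq_neg.1 this with h | h <;> rw [h] <;> simp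
  · rw [hm, hmdn, Nat.cast_mul]

/-! ### Indices of ideals of `ℤ[τ]` -/

/-- The index of the principal ideal `aℤ[τ]`. -/
def idealIndex (a : ZTau) : ℕ := (Submodule.toAddSubgroup (Ideal.span {a})).index

theorem idealIndex_eq_card (a : ZTau) : idealIndex a = Nat.card (ZTau ⧸ Ideal.span {a}) := rfl

theorem idealIndex_dvd {a b : ZTau} (h : a ∣ b) : idealIndex a ∣ idealIndex b :=
  AddSubgroup.index_dvd_of_le (Submodule.toAddSubgroup_mono (Ideal.span_singleton_le_span_singleton.2 h))

theorem idealIndex_one : idealIndex 1 = 1 := by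
  rw [idealIndex, AddSubgroup.index_eq_one, Ideal.span_singleton_one]
  rfl

/-- Multiplication by a carries the pair ℤ[τ] ⊇ (b) to (a) ⊇ (ab). -/
theorem idealIndex_mul {a : ZTau} (ha : a ≠ 0) (b : ZTau) :
    idealIndex (a * b) = idealIndex a * idealIndex b := by
  have hinj : Function.Injective (AddMonoidHom.mulLeft a) := mul_right_injective₀ ha
  have h1 : Submodule.toAddSubgroup (Ideal.span {a}) = AddSubgroup.map (AddMonoidHom.mulLeft a) ⊤ := by
    ext x
    simp [Ideal.mem_span_singleton, dvd_def, eq_comm]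
  have h2 : Submodule.toAddSubgroup (Ideal.span {a * b}) =
      AddSubgroup.map (AddMonoidHom.mulLeft a) (Submodule.toAddSubgroup (Ideal.span {b})) := by
    ext x
    simp only [Submodule.mem_toAddSubgroup, Ideal.mem_span_singleton, AddSubgroup.mem_map, dvd_def]
    constructor
    · rintro ⟨c, rfl⟩
      exact ⟨b * c, ⟨c, rfl⟩, (mul_assoc a b c).symm⟩
    · rintro ⟨_, ⟨c, rfl⟩, rfl⟩
      exact ⟨c, (mul_assoc a b c).symm⟩
  have hle : Submodule.toAddSubgroup (Ideal.span {a * b}) ≤ Submodule.toAddSubgroup (Ideal.span {a}) :=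
    Submodule.toAddSubgroup_mono (Ideal.span_singleton_le_span_singleton.2 (dvd_mul_right a b))
  rw [idealIndex, ← AddSubgroup.relIndex_mul_index hle, mul_comm]
  congr 1
  rw [h1, h2, AddSubgroup.relIndex_map_map_of_injective _ _ hinj, AddSubgroup.relIndex_top_right]
  rfl

theorem idealIndex_prod {ι : Type*} (s : Finset ι) (a : ι → ZTau) (ha : ∀ i, a i ≠ 0) :
    idealIndex (∏ i ∈ s, a i) = ∏ i ∈ s, idealIndex (a i) := by
  classical
  induction s using Finset.induction_on with
  | empty => simp [idealIndex_one]
  | insert i s hi ih => rw [Finset.prod_insert hi, Finset.prod_insert hi, idealIndex_mul (ha i), ih]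

theorem idealIndex_natCast {n : ℕ} (hn : 0 < n) : idealIndex (n : ZTau) = n ^ 2 := by
  have : NeZero n := ⟨hn.ne'⟩
  choose f g hfg using fun c : ZTau => mem_ZTau_iff.1 c.2
  have huniq : ∀ (c : ZTau) (m k : ℤ), (c : Qtau) = ⟨m, k⟩ → f c = m ∧ g c = k := by
    intro c m k h
    rw [hfg c] at h
    have := QuadraticAlgebra.ext_iff.1 h
    dsimp only at this
    exact_mod_cast this
  let φ : ZTau →+ ZMod n × ZMod n :=
    { toFun := fun c => (f c, g c)
      map_zero' := by
        obtain ⟨h1, h2⟩ := huniq 0 0 0 (by ext <;> simp)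
        simp [h1, h2]
      map_add' := fun a b => by
        obtain ⟨h1, h2⟩ := huniq (a + b) (f a + f b) (g a + g b) (by
          push_cast
          nth_rw 1 [hfg a, hfg b]
          ext <;> simp)
        simp [h1, h2] }
  have hker : Submodule.toAddSubgroup (Ideal.span {(n : ZTau)}) = φ.ker := by
    ext c
    simp only [Submodule.mem_toAddSubgroup, Ideal.mem_span_singleton, AddMonoidHom.mem_ker]
    change _ ↔ ((f c : ZMod n), (g c : ZMod n)) = (0, 0)
    rw [Prod.mk.injEq, ZMod.intCast_zmod_eq_zero_iff_dvd, ZMod.intCast_zmod_eq_zero_iff_dvd]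
    constructor
    · rintro ⟨e, he⟩
      obtain ⟨h1, h2⟩ := huniq c (n * f e) (n * g e) (by
        rw [he]; push_cast; rw [hfg e]; ext <;> simp)
      exact ⟨⟨_, h1⟩, ⟨_, h2⟩⟩
    · rintro ⟨⟨x, hx⟩, ⟨y, hy⟩⟩
      refine ⟨⟨⟨x, y⟩, mem_ZTau_iff.2 ⟨x, y, rfl⟩⟩, Subtype.ext ?_⟩
      rw [hfg c, hx, hy]
      push_cast
      ext <;> simp
  have hsurj : Function.Surjective φ := by
    rintro ⟨x, y⟩
    obtain ⟨x, rfl⟩ := ZMod.intCast_surjective x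
    obtain ⟨y, rfl⟩ := ZMod.intCast_surjective y
    obtain ⟨h1, h2⟩ := huniq ⟨⟨x, y⟩, mem_ZTau_iff.2 ⟨x, y, rfl⟩⟩ x y rfl
    exact ⟨⟨⟨x, y⟩, mem_ZTau_iff.2 ⟨x, y, rfl⟩⟩, Prod.ext (congrArg Int.cast h1) (congrArg Int.cast h2)⟩
  rw [idealIndex, hker, AddSubgroup.index_ker, AddMonoidHom.range_eq_top.2 hsurj, AddSubgroup.card_top,
    Nat.card_prod, Nat.card_zmod, sq]

/-! ### One-sided ideals of the icosian ring -/

/-- The icosian ring as an additive subgroup. -/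
def icosianGroup : AddSubgroup ℍ[Qtau] := icosians.toAddSubgroup

theorem mem_icosianGroup {x : ℍ[Qtau]} : x ∈ icosianGroup ↔ x ∈ icosians := Iff.rfl

/-- The right ideal `p𝕀`. -/
def rightIdeal (p : ℍ[Qtau]) : AddSubgroup ℍ[Qtau] := icosianGroup.map (AddMonoidHom.mulLeft p)

theorem mem_rightIdeal {p z : ℍ[Qtau]} : z ∈ rightIdeal p ↔ ∃ x ∈ icosians, p * x = z := Iff.rfl

/-- The `ℤ[τ]`-module `p𝕀 + 𝕀r`. -/
def sumIdeal (p r : ℍ[Qtau]) : Submodule ZTau ℍ[Qtau] :=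
  icosians.map (LinearMap.mulLeft ZTau p) ⊔ icosians.map (LinearMap.mulRight ZTau r)

theorem mem_sumIdeal {p r z : ℍ[Qtau]} :
    z ∈ sumIdeal p r ↔ ∃ x ∈ icosians, ∃ y ∈ icosians, z = p * x + y * r := by
  simp [sumIdeal, Submodule.mem_sup, eq_comm]

theorem toAddSubgroup_sumIdeal (p r : ℍ[Qtau]) : (sumIdeal p r).toAddSubgroup =
    rightIdeal p ⊔ icosianGroup.map (AddMonoidHom.mulRight r) := by
  rw [sumIdeal, Submodule.sup_toAddSubgroup]
  rfl

theorem mem_rightIdeal_coe {n : ZTau} (x : icosians) :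
    (x : ℍ[Qtau]) ∈ rightIdeal ((n : Qtau) : ℍ[Qtau]) ↔ ∀ i, n ∣ icosianBasis.repr x i := by
  rw [mem_rightIdeal]
  constructor
  · rintro ⟨y, hy, hxy⟩ i
    have : x = n • (⟨y, hy⟩ : icosians) := Subtype.ext (by
      rw [Quaternion.coe_mul_eq_smul] at hxy
      exact hxy.symm)
    rw [this, map_smul]
    exact ⟨_, rfl⟩
  · intro h
    choose c hc using h
    refine ⟨(∑ i, c i • icosianBasis i : icosians), Subtype.prop _, ?_⟩
    rw [Quaternion.coe_mul_eq_smul]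
    have : x = n • ∑ i, c i • icosianBasis i := by
      apply icosianBasis.ext_elem
      intro i
      rw [hc i, map_smul, Finsupp.smul_apply, icosianBasis.repr_sum_self, smul_eq_mul]
    exact (congrArg Subtype.val this).symm

/-- Coordinates of icosians modulo `n`. -/
def coordMod (n : ZTau) : icosianGroup →+ (Fin 4 → ZTau ⧸ Ideal.span {n}) where
  toFun x i := Ideal.Quotient.mk (Ideal.span {n}) (icosianBasis.repr ⟨x, x.2⟩ i)
  map_zero' := by
    ext1 i
    change Ideal.Quotient.mk (Ideal.span {n}) (icosianBasis.repr 0 i) = 0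
    rw [map_zero, Finsupp.zero_apply, map_zero]
  map_add' x y := by
    ext1 i
    change Ideal.Quotient.mk (Ideal.span {n}) (icosianBasis.repr (⟨x, x.2⟩ + ⟨y, y.2⟩) i) =
      Ideal.Quotient.mk (Ideal.span {n}) (icosianBasis.repr ⟨x, x.2⟩ i) +
      Ideal.Quotient.mk (Ideal.span {n}) (icosianBasis.repr ⟨y, y.2⟩ i)
    rw [map_add, Finsupp.add_apply, map_add]

theorem coordMod_eq_zero_iff {n : ZTau} (x : icosians) :
    coordMod n ⟨x, x.2⟩ = 0 ↔ ∀ i, n ∣ icosianBasis.repr x i := by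
  rw [funext_iff]
  refine forall_congr' fun i => ?_
  change Ideal.Quotient.mk (Ideal.span {n}) (icosianBasis.repr x i) = 0 ↔ _
  rw [Ideal.Quotient.eq_zero_iff_mem, Ideal.mem_span_singleton]

theorem coordMod_surjective (n : ZTau) : Function.Surjective (coordMod n) := by
  intro y
  choose c hc using fun i => Ideal.Quotient.mk_surjective (y i)
  refine ⟨⟨(∑ i, c i • icosianBasis i : icosians), Subtype.prop _⟩, ?_⟩
  ext1 i
  change Ideal.Quotient.mk (Ideal.span {n}) (icosianBasis.repr (∑ i, c i • icosianBasis i) i) = y i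
  rw [icosianBasis.repr_sum_self, hc]

theorem relIndex_rightIdeal_coe (n : ZTau) :
    (rightIdeal ((n : Qtau) : ℍ[Qtau])).relIndex icosianGroup = idealIndex n ^ 4 := by
  have hker : (rightIdeal ((n : Qtau) : ℍ[Qtau])).addSubgroupOf icosianGroup =
      (coordMod n).ker := by
    ext ⟨x, hx⟩
    rw [AddSubgroup.mem_addSubgroupOf, AddMonoidHom.mem_ker]
    exact (mem_rightIdeal_coe ⟨x, hx⟩).trans (coordMod_eq_zero_iff ⟨x, hx⟩).symm
  rw [AddSubgroup.relIndex, hker, AddSubgroup.index_ker,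
    AddMonoidHom.range_eq_top.2 (coordMod_surjective n), AddSubgroup.card_top, Nat.card_fun,
    Nat.card_fin, idealIndex_eq_card]

/-! ### Sums of a right and a left ideal -/

theorem self_mul_star_smul (x : ℍ[Qtau]) : x * star x = ((Quaternion.normSq x : Qtau) : ℍ[Qtau]) :=
  Quaternion.self_mul_star x

theorem star_mul_quat (x y : ℍ[Qtau]) : star (x * y) = star y * star x := by
  apply Quaternion.ext <;> simp

/-- Icosians `q`, `r` whose reduced traces against `𝕀` represent `1`, with norms `d β₁²`, `d β₂²`
where `β₁`, `β₂` are coprime. -/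
structure NormPair (d β₁ β₂ : ZTau) (q r : ℍ[Qtau]) : Prop where
  left_mem : q ∈ icosians
  right_mem : r ∈ icosians
  left_trd : ∃ t ∈ icosians, trd (q * t) = 1
  right_trd : ∃ t ∈ icosians, trd (r * t) = 1
  left_norm : Quaternion.normSq q = d * (β₁ : Qtau) ^ 2
  right_norm : Quaternion.normSq r = d * (β₂ : Qtau) ^ 2
  coprime : IsCoprime β₁ β₂
  d_ne : d ≠ 0
  left_ne : β₁ ≠ 0
  right_ne : β₂ ≠ 0

theorem exists_trd_star {q : ℍ[Qtau]} (h : ∃ t ∈ icosians, trd (q * t) = 1) :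
    ∃ t ∈ icosians, trd (star q * t) = 1 := by
  obtain ⟨t, ht, h⟩ := h
  refine ⟨star t, star_mem_icosians ht, ?_⟩
  rw [← star_mul_quat, trd_star, trd_mul_comm, h]

namespace NormPair

variable {d β₁ β₂ : ZTau} {q r : ℍ[Qtau]}

theorem star_left (h : NormPair d β₁ β₂ q r) : NormPair d β₁ β₂ (star q) r :=
  { h with
    left_mem := star_mem_icosians h.left_mem
    left_trd := exists_trd_star h.left_trd
    left_norm := by rw [Quaternion.normSq_star, h.left_norm] }

theorem star_right (h : NormPair d β₁ β₂ q r) : NormPair d β₁ β₂ q (star r) :=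
  { h with
    right_mem := star_mem_icosians h.right_mem
    right_trd := exists_trd_star h.right_trd
    right_norm := by rw [Quaternion.normSq_star, h.right_norm] }

/-- The ideal sum `β₂q𝕀 + 𝕀β₁r`. -/
def sum (_ : NormPair d β₁ β₂ q r) : Submodule ZTau ℍ[Qtau] :=
  sumIdeal ((β₂ : Qtau) • q) ((β₁ : Qtau) • r)

theorem sum_le (h : NormPair d β₁ β₂ q r) : h.sum ≤ icosians := by
  intro z hz
  obtain ⟨x, hx, y, hy, rfl⟩ := mem_sumIdeal.1 hz
  exact icosians.add_mem (mul_mem_icosians (smul_mem_icosians β₂.2 h.left_mem) hx)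
    (mul_mem_icosians hy (smul_mem_icosians β₁.2 h.right_mem))

theorem coe_ne (h : NormPair d β₁ β₂ q r) :
    (d : Qtau) ≠ 0 ∧ (β₁ : Qtau) ≠ 0 ∧ (β₂ : Qtau) ≠ 0 :=
  ⟨fun e => h.d_ne (Subtype.ext e), fun e => h.left_ne (Subtype.ext e),
    fun e => h.right_ne (Subtype.ext e)⟩

theorem exists_of_mem_sum (h : NormPair d β₁ β₂ q r) {z : ℍ[Qtau]} (hz : z ∈ h.sum) :
    ∃ y ∈ icosians, star q * z * star r = (d * β₁ * β₂ : Qtau) • y := by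
  obtain ⟨x, hx, y, hy, rfl⟩ := mem_sumIdeal.1 hz
  refine ⟨(β₁ : Qtau) • (x * star r) + (β₂ : Qtau) • (star q * y), icosians.add_mem
    (smul_mem_icosians β₁.2 (mul_mem_icosians hx (star_mem_icosians h.right_mem)))
    (smul_mem_icosians β₂.2 (mul_mem_icosians (star_mem_icosians h.left_mem) hy)), ?_⟩
  have e1 : star q * ((β₂ : Qtau) • q * x) * star r = ((β₂ : Qtau) * (d * (β₁ : Qtau) ^ 2)) • (x * star r) := by
    rw [smul_mul_assoc, mul_smul_comm, smul_mul_assoc, ← mul_assoc, Quaternion.star_mul_self,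
      h.left_norm, Quaternion.coe_mul_eq_smul, smul_mul_assoc, smul_smul]
  have e2 : star q * (y * ((β₁ : Qtau) • r)) * star r = ((β₁ : Qtau) * (d * (β₂ : Qtau) ^ 2)) • (star q * y) := by
    rw [mul_smul_comm, mul_smul_comm, smul_mul_assoc, ← mul_assoc, mul_assoc, self_mul_star_smul,
      h.right_norm, Quaternion.mul_coe_eq_smul, smul_smul]
  rw [mul_add, add_mul, e1, e2, smul_add, smul_smul, smul_smul]
  congr 2 <;> ring

/-- `β₂q𝕀 + 𝕀β₁r` consists of the icosians `z` for which `q̄zr̄` is divisible by `d β₁β₂`. -/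
theorem mem_sum_of_exists (h : NormPair d β₁ β₂ q r) {z : ℍ[Qtau]} (hz : z ∈ icosians)
    (hy : ∃ y ∈ icosians, star q * z * star r = (d * β₁ * β₂ : Qtau) • y) : z ∈ h.sum := by
  obtain ⟨y, hy, e⟩ := hy
  obtain ⟨hd, h1, h2⟩ := h.coe_ne
  obtain ⟨t, ht, ht1⟩ := h.left_trd
  obtain ⟨s, hs, hs1⟩ := h.right_trd
  have e1 : (β₂ : Qtau) • (star q * z) = (β₁ : Qtau) • (y * r) := by
    have := congrArg (· * r) e
    simp only [mul_assoc (star q * z), Quaternion.star_mul_self, h.right_norm,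
      Quaternion.mul_coe_eq_smul, smul_mul_assoc] at this
    apply smul_right_injective _ (mul_ne_zero hd h2)
    simp only [smul_smul]
    convert this using 2 <;> ring
  have e2 : (β₁ : Qtau) • (z * star r) = (β₂ : Qtau) • (q * y) := by
    have := congrArg (q * ·) e
    simp only [← mul_assoc, self_mul_star_smul, h.left_norm,
      Quaternion.coe_mul_eq_smul, smul_mul_assoc, mul_smul_comm] at this
    apply smul_right_injective _ (mul_ne_zero hd h1)
    simp only [smul_smul]
    convert this using 2 <;> ring
  -- tr(qt) = 1 reads qt + t̄q̄ = 1, so β₂z = β₂q(tz) + t̄(β₂q̄z), and `e1` turns the last factor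
  -- into β₁yr. The mirror argument puts β₁z into the sum; coprimality of β₁, β₂ then gives z.
  have hA : β₂ • z ∈ h.sum := by
    refine mem_sumIdeal.2 ⟨t * z, mul_mem_icosians ht hz, star t * y,
      mul_mem_icosians (star_mem_icosians ht) hy, ?_⟩
    have h3 : q * t + star t * star q = 1 := by
      rw [← star_mul_quat, add_star_eq_trd, ht1, Quaternion.coe_one]
    calc (β₂ : Qtau) • z = (β₂ : Qtau) • ((q * t + star t * star q) * z) := by rw [h3, one_mul]
      _ = (β₂ : Qtau) • (q * t * z) + star t * ((β₂ : Qtau) • (star q * z)) := by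
        rw [add_mul, smul_add, mul_smul_comm, mul_assoc (star t)]
      _ = _ := by rw [e1, smul_mul_assoc, mul_smul_comm, mul_smul_comm, mul_assoc, mul_assoc]
  have hB : β₁ • z ∈ h.sum := by
    refine mem_sumIdeal.2 ⟨y * star s, mul_mem_icosians hy (star_mem_icosians hs), z * s,
      mul_mem_icosians hz hs, ?_⟩
    have h3 : s * r + star r * star s = 1 := by
      rw [← star_mul_quat, add_star_eq_trd, trd_mul_comm, hs1, Quaternion.coe_one]
    calc (β₁ : Qtau) • z = (β₁ : Qtau) • (z * (s * r + star r * star s)) := by rw [h3, mul_one]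
      _ = ((β₁ : Qtau) • (z * star r)) * star s + (β₁ : Qtau) • (z * s * r) := by
        rw [mul_add, smul_add, smul_mul_assoc, mul_assoc z, mul_assoc z, add_comm]
      _ = _ := by rw [e2, smul_mul_assoc, smul_mul_assoc, mul_smul_comm, mul_assoc q]
  obtain ⟨u, v, huv⟩ := h.coprime
  have : z = u • (β₁ • z) + v • (β₂ • z) := by
    have huv' : (u * β₁ + v * β₂ : Qtau) = 1 := congrArg Subtype.val huv
    calc z = (u * β₁ + v * β₂ : Qtau) • z := by rw [huv']; exact (one_smul Qtau z).symm
      _ = (u * β₁ : Qtau) • z + (v * β₂ : Qtau) • z := add_smul (R := Qtau) _ _ z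
      _ = _ := by rw [mul_smul, mul_smul]; rfl
  rw [this]
  exact h.sum.add_mem (h.sum.smul_mem u hB) (h.sum.smul_mem v hA)

theorem mem_sum_iff (h : NormPair d β₁ β₂ q r) {z : ℍ[Qtau]} : z ∈ h.sum ↔ z ∈ icosians ∧
    ∃ y ∈ icosians, star q * z * star r = (d * β₁ * β₂ : Qtau) • y :=
  ⟨fun hz => ⟨h.sum_le hz, h.exists_of_mem_sum hz⟩, fun hz => h.mem_sum_of_exists hz.1 hz.2⟩

/-- The index of `β₂q𝕀 + 𝕀β₁r` in `𝕀`. -/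
def index (h : NormPair d β₁ β₂ q r) : ℕ := h.sum.toAddSubgroup.relIndex icosianGroup

theorem smul_left_ne (h : NormPair d β₁ β₂ q r) : (β₂ : Qtau) • q ≠ 0 := by
  intro e
  have := congrArg Quaternion.normSq e
  rw [Quaternion.normSq_smul, h.left_norm, map_zero] at this
  obtain ⟨hd, h1, h2⟩ := h.coe_ne
  exact mul_ne_zero (pow_ne_zero _ h2) (mul_ne_zero hd (pow_ne_zero _ h1)) this

/-- `normSq` of `β₂q`. -/
theorem normSq_smul_left (h : NormPair d β₁ β₂ q r) :
    Quaternion.normSq ((β₂ : Qtau) • q) = ((d * β₁ ^ 2 * β₂ ^ 2 : ZTau) : Qtau) := by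
  rw [Quaternion.normSq_smul, h.left_norm]
  push_cast
  ring

/-- By the second isomorphism theorem, β₂q𝕀 has in the sum the index that {z ∈ 𝕀 : zβ₁r ∈ β₂q𝕀} has
in 𝕀. The condition on z means q̄zr ∈ dβ₁β₂𝕀, which is membership in the sum belonging to r̄. -/
theorem index_mul_index_star_right (h : NormPair d β₁ β₂ q r) :
    h.index * h.star_right.index = (rightIdeal ((β₂ : Qtau) • q)).relIndex icosianGroup := by
  have hle1 : rightIdeal ((β₂ : Qtau) • q) ≤ h.sum.toAddSubgroup := by
    rw [sum, toAddSubgroup_sumIdeal]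
    exact le_sup_left
  have hle2 : h.sum.toAddSubgroup ≤ icosianGroup := h.sum_le
  rw [← AddSubgroup.relIndex_mul_relIndex _ _ _ hle1 hle2, mul_comm]
  congr 1
  rw [sum, toAddSubgroup_sumIdeal, sup_comm, AddSubgroup.relIndex_sup_right,
    ← AddSubgroup.relIndex_comap, ← AddSubgroup.inf_relIndex_right, index]
  congr 1
  obtain ⟨hd, h1, h2⟩ := h.coe_ne
  ext z
  rw [AddSubgroup.mem_inf, AddSubgroup.mem_comap, mem_rightIdeal, Submodule.mem_toAddSubgroup,
    h.star_right.mem_sum_iff, star_star, and_comm, mem_icosianGroup]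
  refine and_congr_left fun hz => exists_congr fun y => and_congr_right fun hy => ?_
  change _ ↔ (β₂ : Qtau) • q * y = z * ((β₁ : Qtau) • r)
  rw [smul_mul_assoc, mul_smul_comm]
  constructor
  · intro e
    have := congrArg (q * ·) e
    simp only [← mul_assoc, self_mul_star_smul, h.left_norm,
      Quaternion.coe_mul_eq_smul, smul_mul_assoc, mul_smul_comm] at this
    apply smul_right_injective _ (mul_ne_zero hd h1)
    simp only [smul_smul]
    refine Eq.trans ?_ (this.symm.trans ?_) <;> congr 1 <;> ring
  · intro e
    have := congrArg (star q * ·) e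
    simp only [← mul_assoc, Quaternion.star_mul_self, h.left_norm,
      Quaternion.coe_mul_eq_smul, mul_smul_comm, smul_smul] at this
    apply smul_right_injective _ h1
    simp only [smul_smul]
    refine this.symm.trans ?_
    congr 1
    ring

/-- Left multiplication by β₂q carries 𝕀 ⊇ β₂q̄𝕀 to β₂q𝕀 ⊇ N𝕀 with N the norm of β₂q, and 𝕀 has rank
4 over ℤ[τ]. -/
theorem relIndex_mul_relIndex_star (h : NormPair d β₁ β₂ q r) :
    (rightIdeal ((β₂ : Qtau) • q)).relIndex icosianGroup *
      (rightIdeal ((β₂ : Qtau) • star q)).relIndex icosianGroup =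
      idealIndex (d * β₁ ^ 2 * β₂ ^ 2) ^ 4 := by
  have hinj : Function.Injective (AddMonoidHom.mulLeft ((β₂ : Qtau) • q)) := by
    intro x y hxy
    have := congrArg (star ((β₂ : Qtau) • q) * ·) hxy
    simp only [AddMonoidHom.coe_mulLeft, ← mul_assoc, Quaternion.star_mul_self,
      Quaternion.coe_mul_eq_smul] at this
    refine smul_right_injective _ (fun e => h.smul_left_ne (normSq_eq_zero_iff.1 e)) this
  have hle1 : (rightIdeal ((β₂ : Qtau) • star q)).map (AddMonoidHom.mulLeft ((β₂ : Qtau) • q)) ≤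
      rightIdeal ((β₂ : Qtau) • q) := by
    rintro _ ⟨_, ⟨x, hx, rfl⟩, rfl⟩
    exact ⟨_, mul_mem_icosians (smul_mem_icosians β₂.2 (star_mem_icosians h.left_mem)) hx, rfl⟩
  have hle2 : rightIdeal ((β₂ : Qtau) • q) ≤ icosianGroup := by
    rintro _ ⟨x, hx, rfl⟩
    exact mul_mem_icosians (smul_mem_icosians β₂.2 h.left_mem) hx
  rw [← relIndex_rightIdeal_coe, ← h.normSq_smul_left]
  have e : rightIdeal ((Quaternion.normSq ((β₂ : Qtau) • q) : Qtau) : ℍ[Qtau]) =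
      (rightIdeal ((β₂ : Qtau) • star q)).map (AddMonoidHom.mulLeft ((β₂ : Qtau) • q)) := by
    rw [rightIdeal, rightIdeal, AddSubgroup.map_map]
    congr 1
    ext1 x
    change _ * x = _ * (_ * x)
    rw [← self_mul_star_smul, Quaternion.star_smul, mul_assoc]
  rw [e, ← AddSubgroup.relIndex_mul_relIndex _ _ _ hle1 hle2, mul_comm]
  congr 1
  exact (AddSubgroup.relIndex_map_map_of_injective (rightIdeal ((β₂ : Qtau) • star q))
    icosianGroup hinj).symm

end NormPair

/-! ### The lower bound for the index of an ideal sum -/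

theorem star_mul_coe_mul (g : ℍ[Qtau]) (c : Qtau) :
    star g * (c : ℍ[Qtau]) * g = Quaternion.normSq g • (c : ℍ[Qtau]) := by
  rw [Quaternion.mul_coe_eq_smul, smul_mul_assoc, Quaternion.star_mul_self,
    ← Quaternion.coe_mul_eq_smul, ← Quaternion.coe_mul_eq_smul, ← Quaternion.coe_mul,
    ← Quaternion.coe_mul, mul_comm]

/-- The Casimir identity turns δḡ into Σ δ(ḡeᵢg)(tfᵢ), so N divides δḡ in 𝕀. Taking the trace
against s with tr(ḡs) = 1 gives N ∣ δ. -/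
theorem dvd_of_smul_conj_mem {g : ℍ[Qtau]}
    (hg1 : ∃ t ∈ icosians, trd (g * t) = 1) {δ N : ZTau}
    (h : ∀ x ∈ icosians, ∃ y ∈ icosians,
      (δ : Qtau) • (star g * x * g) = (N : Qtau) • y) : N ∣ δ := by
  obtain ⟨t, ht, ht1⟩ := hg1
  obtain ⟨s, hs, hs1⟩ := exists_trd_star ⟨t, ht, ht1⟩
  choose y hy hxy using fun i => h (icosianVec i) (icosianVec_mem i)
  have e1 : (δ : Qtau) • star g = (N : Qtau) • ∑ i, y i * (t * dualVec i) := by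
    calc (δ : Qtau) • star g
        = (δ : Qtau) • (star g * ∑ i, icosianVec i * (g * t) * dualVec i) := by
          rw [casimir, ht1, Quaternion.coe_one, mul_one]
      _ = ∑ i, ((δ : Qtau) • (star g * icosianVec i * g)) * (t * dualVec i) := by
          rw [Finset.mul_sum, Finset.smul_sum]
          refine Finset.sum_congr rfl fun i _ => ?_
          rw [smul_mul_assoc]
          simp only [mul_assoc]
      _ = _ := by
          rw [Finset.smul_sum]
          refine Finset.sum_congr rfl fun i _ => ?_
          rw [hxy, smul_mul_assoc]
  have hw : ∑ i, y i * (t * dualVec i) ∈ icosians :=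
    icosians.sum_mem fun i _ => mul_mem_icosians (hy i) (mul_mem_icosians ht (dualVec_mem i))
  refine ⟨⟨_, trd_mem_of_mem (mul_mem_icosians hw hs)⟩, Subtype.ext ?_⟩
  have := congrArg (fun x => trd (x * s)) e1
  simpa [smul_mul_assoc, trd_smul, hs1] using this

/-- The products of the two families span 𝕀: expand x in the first family and 1 in the second. -/
theorem dvd_of_smul_conj_family_mem {g : ℍ[Qtau]}
    (hg1 : ∃ t ∈ icosians, trd (g * t) = 1) {δ N : ZTau} {B C : Fin 4 → ℍ[Qtau]}
    (hB : ∀ x ∈ icosians, ∃ c : Fin 4 → ZTau, x = ∑ i, c i • B i)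
    (hC : ∀ x ∈ icosians, ∃ c : Fin 4 → ZTau, x = ∑ i, c i • C i)
    (h : ∀ i j, ∃ y ∈ icosians,
      (δ : Qtau) • (star g * (B i * C j) * g) = (N : Qtau) • y) : N ∣ δ := by
  refine dvd_of_smul_conj_mem hg1 fun x hx => ?_
  obtain ⟨b, hb⟩ := hB x hx
  obtain ⟨c, hc⟩ := hC 1 one_mem_icosians
  choose y hy hxy using h
  refine ⟨∑ i, ∑ j, (b i * c j : Qtau) • y i j, icosians.sum_mem fun i _ => icosians.sum_mem
    fun j _ => smul_mem_icosians (ZTau.mul_mem (b i).2 (c j).2) (hy i j), ?_⟩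
  have e : x = ∑ i, ∑ j, (b i * c j : Qtau) • (B i * C j) := by
    rw [← mul_one x, hb, hc, Finset.sum_mul_sum]
    refine Finset.sum_congr rfl fun i _ => Finset.sum_congr rfl fun j _ => ?_
    rw [zsmul_def, zsmul_def, smul_mul_assoc, mul_smul_comm, smul_smul]
  rw [e]
  simp only [Finset.mul_sum, Finset.sum_mul, Finset.smul_sum]
  refine Finset.sum_congr rfl fun i _ => Finset.sum_congr rfl fun j _ => ?_
  rw [mul_smul_comm, smul_mul_assoc, smul_comm, hxy, smul_comm]

/-- Smith normal form; the inclusion of nM in N guarantees full rank. -/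
theorem exists_basis_smul_mem {R M : Type*} [CommRing R] [IsDomain R] [IsPrincipalIdealRing R]
    [AddCommGroup M] [Module R M] (b : Module.Basis (Fin 4) R M) (N : Submodule R M) {n : R}
    (hn : n ≠ 0) (h : ∀ x, n • x ∈ N) :
    ∃ (B : Module.Basis (Fin 4) R M) (a : Fin 4 → R), (∀ i, a i ≠ 0) ∧ (∀ i, a i • B i ∈ N) ∧
      Nat.card (M ⧸ N) = ∏ i, Nat.card (R ⧸ Ideal.span {a i}) := by
  have hfin : Module.Finite R M := Module.Finite.of_basis b
  have hfree : Module.Free R M := Module.Free.of_basis b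
  have hrank : Module.finrank R N = Module.finrank R M := by
    refine le_antisymm N.finrank_le ?_
    refine ((LinearMap.lsmul R M n).codRestrict N h).finrank_le_finrank_of_injective ?_
    exact (LinearMap.lsmul_injective hn).codRestrict _
  refine ⟨Submodule.smithNormalFormTopBasis b hrank, Submodule.smithNormalFormCoeffs b hrank,
    Submodule.smithNormalFormCoeffs_ne_zero b hrank, fun i => ?_, ?_⟩
  · have := (Submodule.smithNormalFormBotBasis b hrank i).2
    rwa [Submodule.smithNormalFormBotBasis_def] at this
  · rw [Nat.card_congr (N.quotientEquivPiSpan b hrank).toEquiv, Nat.card_pi]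

namespace NormPair

variable {d β₁ β₂ : ZTau} {q r : ℍ[Qtau]}

theorem smul_mem_sum (h : NormPair d β₁ β₂ q r) {z : ℍ[Qtau]} (hz : z ∈ icosians) :
    (d * β₁ * β₂ : ZTau) • z ∈ h.sum := by
  refine h.mem_sum_of_exists (icosians.smul_mem _ hz) ⟨star q * z * star r,
    mul_mem_icosians (mul_mem_icosians (star_mem_icosians h.left_mem) hz)
      (star_mem_icosians h.right_mem), ?_⟩
  rw [zsmul_def, mul_smul_comm, smul_mul_assoc]
  push_cast
  rfl

theorem exists_smith (h : NormPair d β₁ β₂ q r) :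
    ∃ (B : Fin 4 → ℍ[Qtau]) (a : Fin 4 → ZTau), (∀ i, B i ∈ icosians) ∧
      (∀ x ∈ icosians, ∃ c : Fin 4 → ZTau, x = ∑ i, c i • B i) ∧
      (∀ i, a i • B i ∈ h.sum) ∧ h.index = idealIndex (∏ i, a i) := by
  let N : Submodule ZTau icosians := h.sum.comap icosians.subtype
  obtain ⟨B, a, ha, hB, hcard⟩ := exists_basis_smul_mem icosianBasis N
    (mul_ne_zero (mul_ne_zero h.d_ne h.left_ne) h.right_ne) fun x : icosians => h.smul_mem_sum x.2
  refine ⟨fun i => B i, a, fun i => Subtype.prop _, fun x hx => ⟨B.repr ⟨x, hx⟩, ?_⟩, hB, ?_⟩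
  · have := congrArg icosians.subtype (B.sum_repr ⟨x, hx⟩)
    rw [map_sum] at this
    exact this.symm
  · rw [idealIndex_prod _ _ ha]
    exact hcard

/-- (q̄zr̄)(rw̄q) equals dβ₂²·q̄zw̄q, and both factors are divisible by dβ₁β₂; cancel dβ₂². -/
theorem exists_conj_left (h : NormPair d β₁ β₂ q r) {z w : ℍ[Qtau]} (hz : z ∈ h.sum)
    (hw : w ∈ h.sum) :
    ∃ y ∈ icosians, star q * (z * star w) * q = ((d * β₁ ^ 2 : ZTau) : Qtau) • y := by
  obtain ⟨hd, h1, h2⟩ := h.coe_ne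
  obtain ⟨y, hy, e⟩ := h.exists_of_mem_sum hz
  obtain ⟨v, hv, f⟩ := h.exists_of_mem_sum hw
  refine ⟨y * star v, mul_mem_icosians hy (star_mem_icosians hv), ?_⟩
  have f' : r * (star w * q) = (d * β₁ * β₂ : Qtau) • star v := by
    rw [← Quaternion.star_smul, ← f, star_mul_quat, star_mul_quat, star_star, star_star]
  have e1 : (star q * z * star r) * (r * (star w * q)) =
      (d * β₂ ^ 2 : Qtau) • (star q * (z * star w) * q) := by
    rw [← h.right_norm, mul_assoc _ (star r), ← mul_assoc (star r), Quaternion.star_mul_self,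
      Quaternion.coe_mul_eq_smul, mul_smul_comm]
    simp only [mul_assoc]
  rw [e, f', smul_mul_assoc, mul_smul_comm, smul_smul] at e1
  apply smul_right_injective _ (mul_ne_zero hd (pow_ne_zero 2 h2))
  simp only [smul_smul]
  rw [← e1]
  congr 1
  push_cast
  ring

theorem exists_conj_right (h : NormPair d β₁ β₂ q r) {z w : ℍ[Qtau]} (hz : z ∈ h.sum)
    (hw : w ∈ h.sum) :
    ∃ y ∈ icosians, star (star r) * (star z * w) * star r = ((d * β₂ ^ 2 : ZTau) : Qtau) • y := by
  obtain ⟨hd, h1, h2⟩ := h.coe_ne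
  obtain ⟨y, hy, e⟩ := h.exists_of_mem_sum hz
  obtain ⟨v, hv, f⟩ := h.exists_of_mem_sum hw
  refine ⟨star y * v, mul_mem_icosians (star_mem_icosians hy) hv, ?_⟩
  have e' : r * star z * q = (d * β₁ * β₂ : Qtau) • star y := by
    rw [← Quaternion.star_smul, ← e, star_mul_quat, star_mul_quat, star_star, star_star, mul_assoc]
  have e1 : (r * star z * q) * (star q * w * star r) =
      (d * β₁ ^ 2 : Qtau) • (star (star r) * (star z * w) * star r) := by
    rw [star_star, ← h.left_norm, mul_assoc (star q), mul_assoc _ q, ← mul_assoc q,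
      self_mul_star_smul, Quaternion.coe_mul_eq_smul, mul_smul_comm]
    simp only [mul_assoc]
  rw [f, e', smul_mul_assoc, mul_smul_comm, smul_smul] at e1
  apply smul_right_injective _ (mul_ne_zero hd (pow_ne_zero 2 h1))
  simp only [smul_smul]
  rw [← e1]
  congr 1
  push_cast
  ring

/-- Off the diagonal, aᵢaⱼ already divides ∏ a. On the diagonal this would cost aᵢ², which need not
divide ∏ a; there divisibility by N is required without any factor. -/
theorem exists_conj_prod {S : ℍ[Qtau] → ℍ[Qtau] → ℍ[Qtau]} {N : ZTau}
    {a : Fin 4 → ZTau} {B : Fin 4 → ℍ[Qtau]}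
    (hS : ∀ c e x y, S (c • x) (e • y) = (c * e : ZTau) • S x y)
    (hne : ∀ i j, i ≠ j → ∃ y ∈ icosians, S (a i • B i) (a j • B j) = N • y)
    (hd : ∀ i, ∃ y ∈ icosians, S (B i) (B i) = N • y) (i j : Fin 4) :
    ∃ y ∈ icosians, (∏ i, a i) • S (B i) (B j) = N • y := by
  by_cases hij : i = j
  · subst hij
    obtain ⟨y, hy, e⟩ := hd i
    exact ⟨(∏ i, a i) • y, icosians.smul_mem _ hy, by rw [e, smul_comm]⟩
  · obtain ⟨y, hy, e⟩ := hne i j hij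
    obtain ⟨c, hc⟩ : a i * a j ∣ ∏ i, a i := by
      rw [← Finset.prod_pair hij]
      exact Finset.prod_dvd_prod_of_subset _ _ _ (Finset.subset_univ _)
    refine ⟨c • y, icosians.smul_mem _ hy, ?_⟩
    rw [hc, mul_comm, mul_smul, ← hS, e, smul_comm]

/-- With elementary divisors aᵢ, the elements (∏ a)·q̄BᵢB̄ⱼq lie in dβ₁²𝕀; for i = j because
q̄BᵢB̄ᵢq = |Bᵢ|²|q|². Thus dβ₁² divides ∏ a, by symmetry so does dβ₂², and coprimality combines
them. -/
theorem idealIndex_le_index (h : NormPair d β₁ β₂ q r) (hpos : h.index ≠ 0) :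
    idealIndex (d * β₁ ^ 2 * β₂ ^ 2) ≤ h.index := by
  obtain ⟨B, a, hB, hspan, ha, hidx⟩ := h.exists_smith
  have hspan' : ∀ x ∈ icosians, ∃ c : Fin 4 → ZTau, x = ∑ i, c i • star (B i) := by
    intro x hx
    obtain ⟨c, hc⟩ := hspan _ (star_mem_icosians hx)
    refine ⟨c, ?_⟩
    rw [← star_star x, hc, star_sum]
    exact Finset.sum_congr rfl fun i _ => Quaternion.star_smul _ _
  have hl := exists_conj_prod (S := fun x y => star q * (x * star y) * q) (N := d * β₁ ^ 2)
    (a := a) (B := B) (fun c e x y => by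
      simp only [zsmul_def, Quaternion.star_smul, mul_smul_comm, smul_mul_assoc, smul_smul]
      congr 1
      exact mul_comm _ _)
    (fun i j _ => h.exists_conj_left (ha i) (ha j))
    (fun i => ⟨(Quaternion.normSq (B i) : Qtau), coe_mem_icosians (normSq_mem (hB i)), by
      rw [self_mul_star_smul, star_mul_coe_mul, h.left_norm, zsmul_def]
      rfl⟩)
  have hr := exists_conj_prod (S := fun x y => star (star r) * (star x * y) * star r)
    (N := d * β₂ ^ 2) (a := a) (B := B) (fun c e x y => by
      simp only [zsmul_def, Quaternion.star_smul, mul_smul_comm, smul_mul_assoc, smul_smul]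
      congr 1
      exact mul_comm _ _)
    (fun i j _ => h.exists_conj_right (ha i) (ha j))
    (fun i => ⟨(Quaternion.normSq (B i) : Qtau), coe_mem_icosians (normSq_mem (hB i)), by
      rw [Quaternion.star_mul_self, star_mul_coe_mul, Quaternion.normSq_star, h.right_norm,
        zsmul_def]
      rfl⟩)
  have h1 : d * β₁ ^ 2 ∣ ∏ i, a i :=
    dvd_of_smul_conj_family_mem h.left_trd hspan hspan' hl
  have h2 : d * β₂ ^ 2 ∣ ∏ i, a i :=
    dvd_of_smul_conj_family_mem (exists_trd_star h.right_trd) hspan' hspan hr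
  rw [hidx]
  refine Nat.le_of_dvd (Nat.pos_of_ne_zero (hidx ▸ hpos)) (idealIndex_dvd ?_)
  obtain ⟨u, hu⟩ := h1
  obtain ⟨v, hv⟩ := h2
  have h3 : β₁ ^ 2 * u = β₂ ^ 2 * v := mul_left_cancel₀ h.d_ne (by
    rw [← mul_assoc, ← mul_assoc, ← hu, hv])
  obtain ⟨w, hw⟩ := (h.coprime.pow (m := 2) (n := 2)).symm.dvd_of_dvd_mul_left (⟨v, h3⟩ : β₂ ^ 2 ∣ _)
  exact ⟨w, by rw [hu, hw]; ring⟩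

/-- The indices for (q, r), (q, r̄), (q̄, r), (q̄, r̄) multiply to n⁴ and none is smaller than n. -/
theorem index_eq_idealIndex (h : NormPair d β₁ β₂ q r)
    (hpos : idealIndex (d * β₁ ^ 2 * β₂ ^ 2) ≠ 0) :
    h.index = idealIndex (d * β₁ ^ 2 * β₂ ^ 2) := by
  have e1 := h.index_mul_index_star_right
  have e2 := h.star_left.index_mul_index_star_right
  have e3 := h.relIndex_mul_relIndex_star
  rw [← e1, ← e2] at e3
  have hne : ∀ i, (![h.index, h.star_right.index, h.star_left.index,
      h.star_left.star_right.index] : Fin 4 → ℕ) i ≠ 0 := by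
    have := pow_ne_zero 4 hpos
    rw [← e3] at this
    simp only [mul_ne_zero_iff] at this
    intro i
    fin_cases i
    · exact this.1.1
    · exact this.1.2
    · exact this.2.1
    · exact this.2.2
  have l1 := h.idealIndex_le_index (hne 0)
  have l2 := h.star_right.idealIndex_le_index (hne 1)
  have l3 := h.star_left.idealIndex_le_index (hne 2)
  have l4 := h.star_left.star_right.idealIndex_le_index (hne 3)
  generalize idealIndex (d * β₁ ^ 2 * β₂ ^ 2) = n at *
  refine le_antisymm ?_ l1
  have hn : 0 < n ^ 3 := pow_pos (Nat.pos_of_ne_zero hpos) 3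
  refine le_of_mul_le_mul_right ?_ hn
  calc h.index * n ^ 3 = (h.index * n) * (n * n) := by ring
    _ ≤ (h.index * h.star_right.index) *
        (h.star_left.index * h.star_left.star_right.index) := by gcongr
    _ = n * n ^ 3 := by rw [e3]; ring

end NormPair

/-! ### The root lattice inside the icosian ring -/

/-- The icosians fixed by the twist map. -/
def fixedIcosians : AddSubgroup ℍ[Qtau] where
  carrier := {x | x ∈ icosians ∧ twistFun x = x}
  zero_mem' := ⟨icosians.zero_mem, by apply Quaternion.ext <;> simp [twistFun]⟩
  add_mem' ha hb := ⟨icosians.add_mem ha.1 hb.1, by rw [twistFun_add, ha.2, hb.2]⟩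
  neg_mem' ha := ⟨icosians.neg_mem ha.1, by rw [twistFun_neg, ha.2]⟩

/-- The element `-τe₂ + (2τ-1)e₃` of the root lattice. -/
def fixedVec : ℍ[Qtau] := -tau • e2 + (2 * tau - 1 : Qtau) • e3

theorem fixedVec_mem : fixedVec ∈ icosians :=
  icosians.add_mem (smul_mem_icosians (ZTau.neg_mem tau_mem) (icosianVec_mem 2))
    (smul_mem_icosians (ZTau.sub_mem (ZTau.mul_mem (ofNat_mem ZTau 2) tau_mem) ZTau.one_mem)
      (icosianVec_mem 3))

theorem e0_mem_fixedIcosians : e0 ∈ fixedIcosians :=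
  ⟨icosianVec_mem 0, by apply Quaternion.ext <;> simp [twistFun, e0]⟩

theorem e1_mem_fixedIcosians : e1 ∈ fixedIcosians :=
  ⟨icosianVec_mem 1, by apply Quaternion.ext <;> simp [twistFun, e1]⟩

theorem e2_mem_fixedIcosians : e2 ∈ fixedIcosians :=
  ⟨icosianVec_mem 2, by apply Quaternion.ext <;> simp [twistFun, e2, star_half]⟩

theorem fixedVec_mem_fixedIcosians : fixedVec ∈ fixedIcosians := by
  refine ⟨fixedVec_mem, ?_⟩
  have ht := tau_mul_tau
  apply Quaternion.ext <;>
    simp [twistFun, fixedVec, e2, e3, star_tau, half_eq] <;>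
    generalize tau = t at * <;> grind

theorem exists_int_of_mem_fixedIcosians {x : ℍ[Qtau]} (hx : x ∈ fixedIcosians) :
    ∃ a b m n : ℤ, x = a • e0 + b • e1 + m • e2 + n • fixedVec := by
  obtain ⟨hx, ht⟩ := hx
  obtain ⟨a, b, c, d, rfl⟩ := mem_icosians.1 hx
  obtain ⟨a0, a1, ha⟩ := mem_ZTau_iff.1 a.2
  obtain ⟨b0, b1, hb⟩ := mem_ZTau_iff.1 b.2
  obtain ⟨c0, c1, hc⟩ := mem_ZTau_iff.1 c.2
  obtain ⟨d0, d1, hd⟩ := mem_ZTau_iff.1 d.2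
  rw [comb_eq, ha, hb, hc, hd] at ht
  have h := QuaternionAlgebra.ext_iff.1 ht
  simp [twistFun, QuadraticAlgebra.ext_iff, half, tau, QuadraticAlgebra.re_one,
    QuadraticAlgebra.im_one] at h
  obtain ⟨⟨h1, h2⟩, ⟨h3, h4⟩, ⟨h5, h6⟩, h7, h8⟩ := h
  have k1 : (d1 : ℚ) = -2 * d0 := by linarith
  have k2 : (c1 : ℚ) = d0 := by linarith
  have k3 : (a1 : ℚ) = 0 := by linarith
  have k4 : (b1 : ℚ) = 0 := by linarith
  -- The fixed-point equations leave a and b rational, c = c0 + d0τ and d = -d0(2τ - 1); the d0-part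
  -- is -d0 times `fixedVec`.
  refine ⟨a0, b0, c0, -d0, ?_⟩
  rw [comb_eq, ha, hb, hc, hd, k1, k2, k3, k4]
  apply Quaternion.ext <;> simp [fixedVec, e0, e1, e2, e3] <;> ext <;>
    simp [half, tau, QuadraticAlgebra.re_one, QuadraticAlgebra.im_one, QuadraticAlgebra.re_ofNat,
      QuadraticAlgebra.im_ofNat] <;> ring

theorem rootLattice_eq : rootLattice = fixedIcosians.map embHom.toAddMonoidHom := by
  have hphi : realEmb tau = Real.goldenRatio := by
    simp [tau, realEmb]
  have h2 : realEmb 2 = 2 := by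
    have : (2 : Qtau) = 1 + 1 := by norm_num
    rw [this, map_add, map_one]; norm_num
  have hhalf : realEmb half = 1 / 2 := by rw [half_eq, map_div₀, map_one, h2]
  have g1 : emb e0 = quat 1 0 0 0 := by apply Quaternion.ext <;> simp [emb, e0]
  have g2 : emb (e2 - e0) = quat (-1 / 2) (1 / 2) (1 / 2) (1 / 2) := by
    apply Quaternion.ext <;> simp [emb, e0, e2, hhalf]; norm_num
  have g3 : emb (-e1) = quat 0 (-1) 0 0 := by apply Quaternion.ext <;> simp [emb, e1]
  have g4 : emb (-e0 + (e1 + e1) - e2 - fixedVec) =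
      quat 0 (1 / 2) ((Real.goldenRatio - 1) / 2) (-Real.goldenRatio / 2) := by
    have hg := Real.goldenRatio_sq
    apply Quaternion.ext <;> simp [emb, e0, e1, e2, e3, fixedVec, hhalf, hphi, h2] <;>
      generalize Real.goldenRatio = t at * <;> grind
  apply le_antisymm
  · rw [rootLattice, AddSubgroup.closure_le]
    rintro _ (rfl | rfl | rfl | rfl)
    · exact ⟨e0, e0_mem_fixedIcosians, g1⟩
    · exact ⟨_, sub_mem e2_mem_fixedIcosians e0_mem_fixedIcosians, g2⟩
    · exact ⟨_, neg_mem e1_mem_fixedIcosians, g3⟩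
    · exact ⟨_, sub_mem (sub_mem (add_mem (neg_mem e0_mem_fixedIcosians)
        (add_mem e1_mem_fixedIcosians e1_mem_fixedIcosians)) e2_mem_fixedIcosians) fixedVec_mem_fixedIcosians, g4⟩
  · have m1 : emb e0 ∈ rootLattice := by rw [g1]; exact AddSubgroup.subset_closure (by simp)
    have m2 : emb (e2 - e0) ∈ rootLattice := by rw [g2]; exact AddSubgroup.subset_closure (by simp)
    have m3 : emb (-e1) ∈ rootLattice := by rw [g3]; exact AddSubgroup.subset_closure (by simp)
    have m4 : emb (-e0 + (e1 + e1) - e2 - fixedVec) ∈ rootLattice := by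
      rw [g4]; exact AddSubgroup.subset_closure (by simp)
    have hle : AddSubgroup.closure {e0, e2 - e0, -e1, -e0 + (e1 + e1) - e2 - fixedVec} ≤
        rootLattice.comap embHom.toAddMonoidHom := by
      rw [AddSubgroup.closure_le]
      rintro _ (rfl | rfl | rfl | rfl)
      exacts [m1, m2, m3, m4]
    rw [AddSubgroup.map_le_iff_le_comap]
    refine le_trans ?_ hle
    intro x hx
    obtain ⟨a, b, m, n, rfl⟩ := exists_int_of_mem_fixedIcosians hx
    set S := AddSubgroup.closure {e0, e2 - e0, -e1, -e0 + (e1 + e1) - e2 - fixedVec}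
    have n0 : e0 ∈ S := AddSubgroup.subset_closure (by simp)
    have n1 : e1 ∈ S := by
      have : -e1 ∈ S := AddSubgroup.subset_closure (by simp)
      simpa using neg_mem this
    have n2 : e2 ∈ S := by
      have : e2 - e0 ∈ S := AddSubgroup.subset_closure (by simp)
      simpa using add_mem this n0
    have n3 : fixedVec ∈ S := by
      have h : -e0 + (e1 + e1) - e2 - fixedVec ∈ S := AddSubgroup.subset_closure (by simp)
      have h' := sub_mem (sub_mem (add_mem (neg_mem n0) (add_mem n1 n1)) n2) h
      simpa using h'
    exact add_mem (add_mem (add_mem (zsmul_mem n0 a) (zsmul_mem n1 b)) (zsmul_mem n2 m))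
      (zsmul_mem n3 n)

theorem add_twistFun_mem_fixedIcosians {x : ℍ[Qtau]} (hx : x ∈ icosians) :
    x + twistFun x ∈ fixedIcosians :=
  ⟨icosians.add_mem hx (twistFun_mem hx), by rw [twistFun_add, twistFun_twistFun, add_comm]⟩

/-- τ has trace τ + τ' = 1, so every fixed element is a twist trace. -/
theorem eq_tau_smul_add_twistFun {x : ℍ[Qtau]} (hx : twistFun x = x) :
    x = tau • x + twistFun (tau • x) := by
  have : tau + star tau = 1 := by rw [star_tau]; ring
  calc x = (tau + star tau) • x := by rw [this]; exact (one_smul Qtau x).symm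
    _ = tau • x + star tau • x := add_smul (R := Qtau) _ _ x
    _ = _ := by rw [twistFun_smul, hx]

theorem mem_rootLattice_iff {z : ℍ[ℝ]} :
    z ∈ rootLattice ↔ ∃ x ∈ icosians, twistFun x = x ∧ z = emb x := by
  rw [rootLattice_eq]
  constructor
  · rintro ⟨x, ⟨hx, ht⟩, rfl⟩
    exact ⟨x, hx, ht, rfl⟩
  · rintro ⟨x, hx, ht, rfl⟩
    exact ⟨x, ⟨hx, ht⟩, rfl⟩

theorem emb_mem_rootLattice_iff {x : ℍ[Qtau]} : emb x ∈ rootLattice ↔ x ∈ fixedIcosians := by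
  rw [mem_rootLattice_iff]
  constructor
  · rintro ⟨y, hy, ht, h⟩
    rw [emb_injective h]
    exact ⟨hy, ht⟩
  · intro h
    exact ⟨x, h.1, h.2, rfl⟩

theorem rootLattice_eq_fixed :
    (rootLattice : Set ℍ[ℝ]) = {z | ∃ x : icosians, x = twist x ∧ z = emb x} := by
  ext z
  rw [SetLike.mem_coe, mem_rootLattice_iff]
  constructor
  · rintro ⟨x, hx, ht, rfl⟩
    exact ⟨⟨x, hx⟩, Subtype.ext ht.symm, rfl⟩
  · rintro ⟨x, hx, rfl⟩
    exact ⟨x, x.2, (congrArg Subtype.val hx).symm, rfl⟩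

theorem rootLattice_eq_trace :
    (rootLattice : Set ℍ[ℝ]) = {z | ∃ x : icosians, z = emb (x + twist x)} := by
  ext z
  rw [SetLike.mem_coe, mem_rootLattice_iff]
  constructor
  · rintro ⟨x, hx, ht, rfl⟩
    exact ⟨⟨tau • x, smul_mem_icosians tau_mem hx⟩, congrArg emb (eq_tau_smul_add_twistFun ht)⟩
  · rintro ⟨x, rfl⟩
    have := add_twistFun_mem_fixedIcosians x.2
    exact ⟨_, this.1, this.2, rfl⟩

/-! ### Extension of scalars from `ℤ` to `ℤ[τ]` -/

/-- The quaternions fixed by the twist map. -/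
def twistFixed : AddSubgroup ℍ[Qtau] where
  carrier := {x | twistFun x = x}
  zero_mem' := by
    change twistFun 0 = 0
    apply Quaternion.ext <;> simp [twistFun]
  add_mem' ha hb := by
    change twistFun _ = _
    rw [twistFun_add, ha, hb]
  neg_mem' ha := by
    change twistFun _ = _
    rw [twistFun_neg, ha]

theorem fixedIcosians_le : fixedIcosians ≤ twistFixed := fun _ hx => hx.2

/-- The map `(x, y) ↦ x + τy`. -/
def addTau : twistFixed × twistFixed →+ ℍ[Qtau] where
  toFun x := x.1 + tau • (x.2 : ℍ[Qtau])
  map_zero' := by simp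
  map_add' x y := by
    change (x.1 + y.1 : ℍ[Qtau]) + tau • (x.2 + y.2 : ℍ[Qtau]) = _
    rw [smul_add]
    abel

/-- The twist sends x + τy to x + τ'y; the difference of the two determines y because τ ≠ τ'. -/
theorem add_tau_smul_injective {x y x' y' : ℍ[Qtau]} (hx : twistFun x = x) (hy : twistFun y = y)
    (hx' : twistFun x' = x') (hy' : twistFun y' = y') (h : x + tau • y = x' + tau • y') :
    x = x' ∧ y = y' := by
  have h1 := congrArg twistFun h
  rw [twistFun_add, twistFun_add, twistFun_smul, twistFun_smul, hx, hy, hx', hy'] at h1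
  have h2 : (tau - star tau) • y = (tau - star tau) • y' := by
    have e : ∀ z : ℍ[Qtau], (tau - star tau) • z = tau • z - star tau • z :=
      fun z => sub_smul (R := Qtau) _ _ z
    rw [e, e]
    have := congrArg₂ (· - ·) h h1
    simpa using this
  have h3 : tau - star tau ≠ 0 := by
    rw [star_tau]
    intro e
    have := congrArg QuadraticAlgebra.im e
    simp [tau, QuadraticAlgebra.im_one] at this
  have h4 : y = y' := smul_right_injective _ h3 h2
  subst h4
  exact ⟨add_right_cancel h, rfl⟩

theorem addTau_injective : Function.Injective addTau := by
  rintro ⟨⟨x, hx⟩, ⟨y, hy⟩⟩ ⟨⟨x', hx'⟩, ⟨y', hy'⟩⟩ h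
  obtain ⟨h1, h2⟩ := add_tau_smul_injective hx hy hx' hy' h
  exact Prod.ext (Subtype.ext h1) (Subtype.ext h2)

/-- The group `M + τM`, for `M` fixed by the twist map. -/
def tauExtend (M : AddSubgroup ℍ[Qtau]) : AddSubgroup ℍ[Qtau] :=
  ((M.addSubgroupOf twistFixed).prod (M.addSubgroupOf twistFixed)).map addTau

theorem mem_tauExtend {M : AddSubgroup ℍ[Qtau]} (hM : M ≤ twistFixed) {z : ℍ[Qtau]} :
    z ∈ tauExtend M ↔ ∃ x ∈ M, ∃ y ∈ M, z = x + tau • y := by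
  constructor
  · rintro ⟨⟨x, y⟩, ⟨hx, hy⟩, rfl⟩
    exact ⟨x, hx, y, hy, rfl⟩
  · rintro ⟨x, hx, y, hy, rfl⟩
    exact ⟨(⟨x, hM hx⟩, ⟨y, hM hy⟩), ⟨hx, hy⟩, rfl⟩

theorem relIndex_prod_self {G : Type*} [AddCommGroup G] (H K : AddSubgroup G) (h : H ≤ K) :
    (H.prod H).relIndex (K.prod K) = H.relIndex K ^ 2 := by
  let f : K × K →+ G × G := K.subtype.prodMap K.subtype
  have hf : Function.Injective f := by
    rintro ⟨x, y⟩ ⟨x', y'⟩ h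
    exact Prod.ext (Subtype.ext (congrArg Prod.fst h)) (Subtype.ext (congrArg Prod.snd h))
  have e1 : H.prod H = ((H.addSubgroupOf K).prod (H.addSubgroupOf K)).map f := by
    ext ⟨x, y⟩
    constructor
    · rintro ⟨hx, hy⟩
      exact ⟨(⟨x, h hx⟩, ⟨y, h hy⟩), ⟨hx, hy⟩, rfl⟩
    · rintro ⟨⟨a, b⟩, ⟨ha, hb⟩, e⟩
      rw [← e]
      exact ⟨ha, hb⟩
  have e2 : K.prod K = (⊤ : AddSubgroup (K × K)).map f := by
    ext ⟨x, y⟩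
    constructor
    · rintro ⟨hx, hy⟩
      exact ⟨(⟨x, hx⟩, ⟨y, hy⟩), trivial, rfl⟩
    · rintro ⟨⟨a, b⟩, -, e⟩
      rw [← e]
      exact ⟨a.2, b.2⟩
  rw [e1, e2, AddSubgroup.relIndex_map_map_of_injective _ _ hf, AddSubgroup.relIndex_top_right,
    AddSubgroup.index_prod, sq]
  rfl

theorem relIndex_tauExtend {M N : AddSubgroup ℍ[Qtau]} (hMN : M ≤ N) (hN : N ≤ twistFixed) :
    (tauExtend M).relIndex (tauExtend N) = M.relIndex N ^ 2 := by
  rw [tauExtend, tauExtend, AddSubgroup.relIndex_map_map_of_injective _ _ addTau_injective,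
    relIndex_prod_self (M.addSubgroupOf twistFixed) (N.addSubgroupOf twistFixed)
      (AddSubgroup.comap_mono hMN), AddSubgroup.relIndex_addSubgroupOf hN]

/-- The square root `2τ - 1` of `5`. -/
def sqrtFive : ZTau := 2 * ⟨tau, tau_mem⟩ - 1

theorem sqrtFive_mul_self : sqrtFive * sqrtFive = (5 : ℕ) := by
  apply Subtype.ext
  have ht := tau_mul_tau
  have : (2 * tau - 1) * (2 * tau - 1) = 5 := by linear_combination 4 * ht
  exact this

theorem idealIndex_sqrtFive : idealIndex sqrtFive = 5 := by
  have h0 : sqrtFive ≠ 0 := by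
    intro h
    have := sqrtFive_mul_self
    rw [h, mul_zero] at this
    exact Nat.cast_ne_zero.2 (by norm_num) this.symm
  have h := idealIndex_mul h0 sqrtFive
  rw [sqrtFive_mul_self, idealIndex_natCast (by norm_num)] at h
  nlinarith

/-- The last coordinate of icosians modulo `√5`. -/
def lastCoord : icosianGroup →+ ZTau ⧸ Ideal.span {sqrtFive} where
  toFun x := Ideal.Quotient.mk _ (icosianBasis.repr ⟨x, x.2⟩ 3)
  map_zero' := by
    change Ideal.Quotient.mk _ (icosianBasis.repr 0 3) = 0
    rw [map_zero, Finsupp.zero_apply, map_zero]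
  map_add' x y := by
    change Ideal.Quotient.mk _ (icosianBasis.repr (⟨x, x.2⟩ + ⟨y, y.2⟩) 3) = _
    rw [map_add, Finsupp.add_apply, map_add]

theorem tauExtend_fixedIcosians_le : tauExtend fixedIcosians ≤ icosianGroup := by
  intro z hz
  obtain ⟨x, hx, y, hy, rfl⟩ := (mem_tauExtend fixedIcosians_le).1 hz
  exact icosians.add_mem hx.1 (smul_mem_icosians tau_mem hy.1)

theorem smul_mem_tauExtend {x : ℍ[Qtau]} (hx : x ∈ fixedIcosians) (c : ZTau) :
    c • x ∈ tauExtend fixedIcosians := by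
  obtain ⟨m, n, h⟩ := mem_ZTau_iff.1 c.2
  refine (mem_tauExtend fixedIcosians_le).2 ⟨m • x, zsmul_mem hx m, n • x, zsmul_mem hx n, ?_⟩
  rw [zsmul_def, h]
  have : (⟨m, n⟩ : Qtau) = m + tau * n := by ext <;> simp [tau]
  rw [this]
  calc ((m : Qtau) + tau * n) • x = (m : Qtau) • x + (tau * n) • x := add_smul (R := Qtau) _ _ x
    _ = _ := by rw [mul_smul]; congr 1 <;> [skip; congr 1] <;> apply Quaternion.ext <;> simp

theorem repr_three_of_fixed {x : ℍ[Qtau]} (hx : x ∈ fixedIcosians) :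
    sqrtFive ∣ icosianBasis.repr ⟨x, hx.1⟩ 3 := by
  obtain ⟨a, b, m, n, rfl⟩ := exists_int_of_mem_fixedIcosians hx
  refine ⟨n, Subtype.ext ?_⟩
  change trd ((a • e0 + b • e1 + m • e2 + n • fixedVec) * dualVec 3) = (2 * tau - 1) * n
  simp [trd, fixedVec, dualVec, e0, e1, e2, e3, half_eq]
  ring

/-- ℤ[τ]L consists of the icosians whose last coordinate is divisible by √5. -/
theorem relIndex_tauExtend_fixedIcosians :
    (tauExtend fixedIcosians).relIndex icosianGroup = 5 := by
  have hker : (tauExtend fixedIcosians).addSubgroupOf icosianGroup = lastCoord.ker := by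
    ext ⟨z, hz⟩
    rw [AddSubgroup.mem_addSubgroupOf, AddMonoidHom.mem_ker]
    change z ∈ _ ↔ Ideal.Quotient.mk _ (icosianBasis.repr ⟨z, hz⟩ 3) = 0
    rw [Ideal.Quotient.eq_zero_iff_mem, Ideal.mem_span_singleton]
    constructor
    · intro h
      obtain ⟨x, hx, y, hy, rfl⟩ := (mem_tauExtend fixedIcosians_le).1 h
      have e : (⟨x + tau • y, hz⟩ : icosians) =
          ⟨x, hx.1⟩ + (⟨tau, tau_mem⟩ : ZTau) • ⟨y, hy.1⟩ := rfl
      rw [e, map_add, map_smul, Finsupp.add_apply, Finsupp.smul_apply]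
      exact dvd_add (repr_three_of_fixed hx) (Dvd.dvd.mul_left (repr_three_of_fixed hy) _)
    · rintro ⟨f, hf⟩
      -- `fixedVec` is -τe₂ + √5e₃, so f times it supplies the last coordinate and τf compensates in
      -- the third.
      have e : z = icosianBasis.repr ⟨z, hz⟩ 0 • e0 + icosianBasis.repr ⟨z, hz⟩ 1 • e1 +
          (icosianBasis.repr ⟨z, hz⟩ 2 + ⟨tau, tau_mem⟩ * f) • e2 + f • fixedVec := by
        have h1 := sum_trd_smul z
        rw [Fin.sum_univ_four] at h1
        have h2 : trd (z * dualVec 3) = (2 * tau - 1) * f := congrArg Subtype.val hf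
        rw [h2] at h1
        refine h1.symm.trans ?_
        have e2' : (icosianBasis.repr ⟨z, hz⟩ 2 + ⟨tau, tau_mem⟩ * f) • e2 =
            (trd (z * dualVec 2) + tau * f) • e2 := rfl
        have e0' : icosianBasis.repr ⟨z, hz⟩ 0 • e0 = trd (z * dualVec 0) • e0 := rfl
        have e1' : icosianBasis.repr ⟨z, hz⟩ 1 • e1 = trd (z * dualVec 1) • e1 := rfl
        rw [e0', e1', e2', zsmul_def]
        apply Quaternion.ext <;> simp [icosianVec, fixedVec] <;> ring
      rw [e]
      exact add_mem (add_mem (add_mem (smul_mem_tauExtend e0_mem_fixedIcosians _)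
        (smul_mem_tauExtend e1_mem_fixedIcosians _)) (smul_mem_tauExtend e2_mem_fixedIcosians _))
        (smul_mem_tauExtend fixedVec_mem_fixedIcosians _)
  have hsurj : Function.Surjective lastCoord := by
    intro y
    obtain ⟨c, rfl⟩ := Ideal.Quotient.mk_surjective y
    refine ⟨⟨(c • icosianBasis 3 : icosians), Subtype.prop _⟩, ?_⟩
    change Ideal.Quotient.mk _ (icosianBasis.repr (c • icosianBasis 3) 3) = _
    rw [map_smul, Finsupp.smul_apply, Module.Basis.repr_self, Finsupp.single_eq_same, smul_eq_mul,
      mul_one]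
  rw [AddSubgroup.relIndex, hker, AddSubgroup.index_ker, AddMonoidHom.range_eq_top.2 hsurj,
    AddSubgroup.card_top, ← idealIndex_eq_card, idealIndex_sqrtFive]

/-! ### The coincidence index -/

/-- The norm of `q` is `d β²` with `β`, `β'` coprime and `ββ' = ± k`. -/
structure NormData (q : icosians) (d : ℕ) (β : ZTau) (k : ℕ) : Prop where
  primitive : IsPrimitive q
  d_pos : 0 < d
  k_pos : 0 < k
  nrd_eq : nrd q = d * β ^ 2
  coprime : IsCoprime β (conjZ β)
  mul_conj : β * conjZ β = k ∨ β * conjZ β = -k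
  twistNorm_eq : twistNorm q = d * k

/-- The map `x ↦ q x q̃ / m`. -/
def rotHom (q : ℍ[Qtau]) (m : ℕ) : ℍ[Qtau] →+ ℍ[Qtau] where
  toFun x := (m : Qtau)⁻¹ • (q * x * twistFun q)
  map_zero' := by rw [mul_zero, zero_mul, smul_zero]
  map_add' x y := by rw [mul_add, add_mul, smul_add]

theorem rotHom_apply (q : ℍ[Qtau]) (m : ℕ) (x : ℍ[Qtau]) :
    rotHom q m x = (m : Qtau)⁻¹ • (q * x * twistFun q) := rfl

theorem trd_twistFun (x : ℍ[Qtau]) : trd (twistFun x) = star (trd x) := by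
  simp [trd, twistFun]

theorem twistFun_rotHom (q : ℍ[Qtau]) (m : ℕ) (x : ℍ[Qtau]) :
    twistFun (rotHom q m x) = rotHom q m (twistFun x) := by
  have : star (m : Qtau)⁻¹ = (m : Qtau)⁻¹ := by rw [star_inv₀, star_natCast]
  rw [rotHom_apply, rotHom_apply, twistFun_smul, this, twistFun_mul, twistFun_mul,
    twistFun_twistFun, mul_assoc]

theorem rotHom_smul (q : ℍ[Qtau]) (m : ℕ) (c : Qtau) (x : ℍ[Qtau]) :
    rotHom q m (c • x) = c • rotHom q m x := by
  rw [rotHom_apply, rotHom_apply, mul_smul_comm, smul_mul_assoc, smul_comm]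

theorem conjZ_natCast_mul_sq (d : ℕ) (β : ZTau) :
    conjZ (d * β ^ 2) = d * conjZ β ^ 2 := by
  rw [map_mul, map_pow, map_natCast]

namespace NormData

variable {q : icosians} {d : ℕ} {β : ZTau} {k : ℕ}

theorem nrd_twist_eq (h : NormData q d β k) : nrd (twist q) = d * conjZ β ^ 2 := by
  rw [← conjZ_natCast_mul_sq, ← h.nrd_eq]
  exact Subtype.ext (normSq_twistFun _)

theorem ne_zero (h : NormData q d β k) : β ≠ 0 := by
  rintro rfl
  have hk : (k : ZTau) ≠ 0 := Nat.cast_ne_zero.2 h.k_pos.ne'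
  rcases h.mul_conj with e | e
  · exact hk (by rw [← e, zero_mul])
  · exact hk (by rw [← neg_eq_zero, ← e, zero_mul])

theorem mul_conj_sq (h : NormData q d β k) : (β * conjZ β) ^ 2 = k ^ 2 := by
  rcases h.mul_conj with e | e <;> rw [e]
  exact neg_sq _

theorem normSq_eq (h : NormData q d β k) :
    Quaternion.normSq (q : ℍ[Qtau]) = ((d : ZTau) : Qtau) * (β : Qtau) ^ 2 := by
  have := congrArg Subtype.val h.nrd_eq
  rwa [ZTau.coe_mul, ZTau.coe_pow] at this

theorem normSq_twist_eq (h : NormData q d β k) :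
    Quaternion.normSq (twistFun q) = ((d : ZTau) : Qtau) * (conjZ β : Qtau) ^ 2 := by
  have := congrArg Subtype.val h.nrd_twist_eq
  rwa [ZTau.coe_mul, ZTau.coe_pow] at this

theorem exists_trd_twist (h : NormData q d β k) :
    ∃ t ∈ icosians, trd (twistFun q * t) = 1 := by
  obtain ⟨t, ht, e⟩ := isPrimitive_iff_exists_trd.1 h.primitive
  refine ⟨twistFun t, twistFun_mem ht, ?_⟩
  rw [← twistFun_mul, trd_twistFun, trd_mul_comm, e, star_one]

theorem normPair (h : NormData q d β k) : NormPair d β (conjZ β) q (twistFun q) where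
  left_mem := q.2
  right_mem := twistFun_mem q.2
  left_trd := isPrimitive_iff_exists_trd.1 h.primitive
  right_trd := h.exists_trd_twist
  left_norm := h.normSq_eq
  right_norm := h.normSq_twist_eq
  coprime := h.coprime
  d_ne := Nat.cast_ne_zero.2 h.d_pos.ne'
  left_ne := h.ne_zero
  right_ne := by
    intro e
    apply h.ne_zero
    rw [← conjZ_conjZ β, e, map_zero]

theorem level_eq (h : NormData q d β k) :
    (d : ZTau) * β ^ 2 * conjZ β ^ 2 = ((d * k ^ 2 : ℕ) : ZTau) := by
  push_cast
  rw [← h.mul_conj_sq]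
  ring

theorem norm_mul_norm (h : NormData q d β k) :
    Quaternion.normSq (q : ℍ[Qtau]) * Quaternion.normSq (twistFun q) = ((d * k : ℕ) : Qtau) ^ 2 := by
  rw [h.normPair.left_norm, h.normPair.right_norm]
  have := congrArg Subtype.val h.mul_conj_sq
  push_cast at this ⊢
  linear_combination (d : Qtau) ^ 2 * this

theorem natCast_ne_zero (h : NormData q d β k) : ((d * k : ℕ) : Qtau) ≠ 0 :=
  Nat.cast_ne_zero.2 (Nat.mul_pos h.d_pos h.k_pos).ne'

theorem star_mul_rotHom_mul (h : NormData q d β k) (x : ℍ[Qtau]) :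
    star (q : ℍ[Qtau]) * rotHom q (d * k) x * star (twistFun q) = ((d * k : ℕ) : Qtau) • x := by
  have : star (q : ℍ[Qtau]) * (q * x * twistFun q) * star (twistFun q) =
      (Quaternion.normSq (q : ℍ[Qtau]) * Quaternion.normSq (twistFun q)) • x := by
    rw [mul_assoc (q : ℍ[Qtau]), ← mul_assoc (star (q : ℍ[Qtau])), Quaternion.star_mul_self,
      mul_assoc, mul_assoc x, self_mul_star_smul, Quaternion.mul_coe_eq_smul,
      Quaternion.coe_mul_eq_smul, smul_smul]
  rw [rotHom_apply, mul_smul_comm, smul_mul_assoc, this, smul_smul, h.norm_mul_norm, sq,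
    inv_mul_cancel_left₀ h.natCast_ne_zero]

theorem rotHom_star_mul_mul (h : NormData q d β k) (z : ℍ[Qtau]) :
    rotHom q (d * k) (star (q : ℍ[Qtau]) * z * star (twistFun q)) = ((d * k : ℕ) : Qtau) • z := by
  have : q * (star (q : ℍ[Qtau]) * z * star (twistFun q)) * twistFun q =
      (Quaternion.normSq (q : ℍ[Qtau]) * Quaternion.normSq (twistFun q)) • z := by
    rw [mul_assoc (star (q : ℍ[Qtau])), ← mul_assoc (q : ℍ[Qtau]), self_mul_star_smul,
      mul_assoc, mul_assoc z, Quaternion.star_mul_self, Quaternion.mul_coe_eq_smul,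
      Quaternion.coe_mul_eq_smul, smul_smul]
  rw [rotHom_apply, this, smul_smul, h.norm_mul_norm, sq,
    inv_mul_cancel_left₀ h.natCast_ne_zero]

theorem rotHom_injective (h : NormData q d β k) : Function.Injective (rotHom q (d * k)) := by
  intro x y hxy
  have := congrArg (fun z => star (q : ℍ[Qtau]) * z * star (twistFun q)) hxy
  simp only [h.star_mul_rotHom_mul] at this
  exact smul_right_injective _ h.natCast_ne_zero this

theorem exists_smul_iff (h : NormData q d β k) {w : ℍ[Qtau]} :
    (∃ y ∈ icosians, w = (((d : ZTau) : Qtau) * β * (conjZ β : ZTau)) • y) ↔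
      ∃ y ∈ icosians, w = ((d * k : ℕ) : Qtau) • y := by
  have hd : ((d : ZTau) : Qtau) = (d : Qtau) := rfl
  have hk : ((k : ZTau) : Qtau) = (k : Qtau) := rfl
  rcases h.mul_conj with e | e
  · have e' := congrArg Subtype.val e
    have : ((d : ZTau) : Qtau) * β * (conjZ β : ZTau) = ((d * k : ℕ) : Qtau) := by
      push_cast at e' ⊢
      rw [mul_assoc, e']
    rw [this]
  · have e' := congrArg Subtype.val e
    have : ((d : ZTau) : Qtau) * β * (conjZ β : ZTau) = -((d * k : ℕ) : Qtau) := by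
      push_cast at e' ⊢
      rw [mul_assoc, e', mul_neg]
    rw [this]
    constructor <;> rintro ⟨y, hy, rfl⟩ <;> refine ⟨-y, icosians.neg_mem hy, ?_⟩ <;>
      rw [smul_neg]
    · exact neg_smul (R := Qtau) _ y
    · rw [← smul_neg]
      exact (neg_smul_neg (R := Qtau) _ y).symm

/-- The preimage of z under x ↦ qxq̃/m is q̄z(q̃)‾/m, and m = dk agrees with dββ' up to sign; this
is the divisibility criterion for the ideal sum. -/
theorem sum_eq (h : NormData q d β k) : h.normPair.sum.toAddSubgroup =
    icosianGroup ⊓ icosianGroup.map (rotHom q (d * k)) := by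
  ext z
  rw [Submodule.mem_toAddSubgroup, h.normPair.mem_sum_iff, AddSubgroup.mem_inf, h.exists_smul_iff]
  refine and_congr_right fun hz => ⟨?_, ?_⟩
  · rintro ⟨y, hy, e⟩
    refine ⟨y, hy, ?_⟩
    have := h.rotHom_star_mul_mul z
    rw [e, rotHom_smul] at this
    exact smul_right_injective _ h.natCast_ne_zero this
  · rintro ⟨y, hy, rfl⟩
    exact ⟨y, hy, h.star_mul_rotHom_mul y⟩

/-- The rotation is injective and commutes with the twist, so the preimage of a fixed element is
fixed. -/
theorem inf_map_eq (h : NormData q d β k) :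
    fixedIcosians ⊓ fixedIcosians.map (rotHom q (d * k)) =
      fixedIcosians ⊓ h.normPair.sum.toAddSubgroup := by
  rw [h.sum_eq]
  ext z
  simp only [AddSubgroup.mem_inf]
  refine and_congr_right fun hz => ⟨?_, ?_⟩
  · rintro ⟨x, hx, rfl⟩
    exact ⟨hz.1, x, hx.1, rfl⟩
  · rintro ⟨-, x, hx, rfl⟩
    refine ⟨x, ⟨hx, h.rotHom_injective ?_⟩, rfl⟩
    rw [← twistFun_rotHom]
    exact hz.2

theorem tauExtend_inf_map :
    tauExtend (fixedIcosians ⊓ fixedIcosians.map (rotHom q (d * k))) =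
      tauExtend fixedIcosians ⊓ (tauExtend fixedIcosians).map (rotHom q (d * k)) := by
  have hle : fixedIcosians ⊓ fixedIcosians.map (rotHom q (d * k)) ≤ twistFixed :=
    inf_le_left.trans fixedIcosians_le
  ext z
  rw [mem_tauExtend hle, AddSubgroup.mem_inf, mem_tauExtend fixedIcosians_le]
  constructor
  · rintro ⟨x, ⟨hx, x', hx', ex⟩, y, ⟨hy, y', hy', ey⟩, rfl⟩
    refine ⟨⟨x, hx, y, hy, rfl⟩, x' + tau • y',
      (mem_tauExtend fixedIcosians_le).2 ⟨x', hx', y', hy', rfl⟩, ?_⟩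
    rw [map_add, rotHom_smul, ex, ey]
  · rintro ⟨⟨x, hx, y, hy, rfl⟩, w, hw, e⟩
    obtain ⟨x', hx', y', hy', rfl⟩ := (mem_tauExtend fixedIcosians_le).1 hw
    rw [map_add, rotHom_smul] at e
    obtain ⟨ex, ey⟩ := add_tau_smul_injective (by rw [twistFun_rotHom, hx'.2])
      (by rw [twistFun_rotHom, hy'.2]) hx.2 hy.2 e
    exact ⟨x, ⟨hx, x', hx', ex⟩, y, ⟨hy, y', hy', ey⟩, rfl⟩

end NormData

theorem relIndex_dvd_of_le_right {G : Type*} [AddCommGroup G] (H : AddSubgroup G)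
    {K L : AddSubgroup G} (hKL : K ≤ L) (hHL : H ≤ L) : H.relIndex K ∣ H.relIndex L := by
  rw [← AddSubgroup.relIndex_mul_relIndex H (K ⊔ H) L le_sup_right (sup_le hKL hHL),
    AddSubgroup.relIndex_sup_right]
  exact dvd_mul_right _ _

/-- c = 1 and c = 25 would make 5 the square of a rational number. -/
theorem eq_of_five_mul_sq {i n c : ℕ} (hn : 0 < n) (hc : c ∣ 25) (h : 5 * i ^ 2 = n ^ 2 * c) :
    i = n := by
  have h5 : ∀ a b : ℕ, 0 < b → a ^ 2 ≠ 5 * b ^ 2 := by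
    intro a b hb e
    have hsq : IsSquare ((5 : ℕ) : ℚ) := ⟨a / b, by
      have hb' : (b : ℚ) ≠ 0 := Nat.cast_ne_zero.2 hb.ne'
      field_simp
      exact_mod_cast e.symm.trans (by ring)⟩
    rw [Rat.isSquare_natCast_iff] at hsq
    exact (by decide : Nat.Prime 5).prime.not_isSquare hsq
  have hc' : c ∈ Nat.divisors 25 := Nat.mem_divisors.2 ⟨hc, by norm_num⟩
  have : Nat.divisors 25 = {1, 5, 25} := by decide
  rw [this] at hc'
  simp only [Finset.mem_insert, Finset.mem_singleton] at hc'
  rcases hc' with rfl | rfl | rfl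
  · have hi : 0 < i := Nat.pos_of_ne_zero (by
      rintro rfl
      have := pow_pos hn 2
      omega)
    exact absurd (by omega) (h5 n i hi)
  · exact Nat.pow_left_injective two_ne_zero (by dsimp only; omega)
  · exact absurd (by omega) (h5 i n hn)

namespace NormData

variable {q : icosians} {d : ℕ} {β : ZTau} {k : ℕ}

/-- Let i be the index sought and E = ℤ[τ]L. Through E, the group E ∩ RE has index 5i² in 𝕀; through
𝕀 ∩ R𝕀 it has index (dk²)²c. Here c divides 5·5, one factor for each replacement of 𝕀 by E. -/
theorem relIndex_inf_map (h : NormData q d β k) :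
    (fixedIcosians ⊓ fixedIcosians.map (rotHom q (d * k))).relIndex fixedIcosians = d * k ^ 2 := by
  set M := fixedIcosians ⊓ fixedIcosians.map (rotHom q (d * k)) with hM
  set E := tauExtend fixedIcosians with hE
  have hn : 0 < d * k ^ 2 := Nat.mul_pos h.d_pos (pow_pos h.k_pos 2)
  have h1 : (tauExtend M).relIndex E = M.relIndex fixedIcosians ^ 2 :=
    relIndex_tauExtend inf_le_left fixedIcosians_le
  have h2 : h.normPair.sum.toAddSubgroup.relIndex icosianGroup = (d * k ^ 2) ^ 2 := by
    have := h.normPair.index_eq_idealIndex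
    rw [h.level_eq, idealIndex_natCast hn] at this
    exact this (by positivity)
  have hEI : E ≤ icosianGroup := tauExtend_fixedIcosians_le
  have h3 : tauExtend M = E ⊓ E.map (rotHom q (d * k)) := tauExtend_inf_map
  have hEJ : tauExtend M ≤ h.normPair.sum.toAddSubgroup := by
    rw [h3, h.sum_eq]
    exact inf_le_inf hEI (AddSubgroup.map_mono hEI)
  have hME : tauExtend M ≤ E := h3 ▸ inf_le_left
  have e1 := AddSubgroup.relIndex_mul_relIndex _ _ _ hME hEI
  have e2 := AddSubgroup.relIndex_mul_relIndex _ _ _ hEJ (inf_le_left.trans' h.sum_eq.le)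
  rw [relIndex_tauExtend_fixedIcosians, h1, ← e2, h2] at e1
  refine eq_of_five_mul_sq hn (c := (tauExtend M).relIndex h.normPair.sum.toAddSubgroup) ?_
    (by rw [mul_comm, e1, mul_comm])
  have l1 : E ⊓ E.map (rotHom q (d * k)) ≤ E ⊓ icosianGroup.map (rotHom q (d * k)) :=
    inf_le_inf_left _ (AddSubgroup.map_mono hEI)
  have l2 : E ⊓ icosianGroup.map (rotHom q (d * k)) ≤
      icosianGroup ⊓ icosianGroup.map (rotHom q (d * k)) := inf_le_inf_right _ hEI
  rw [h3, h.sum_eq, ← AddSubgroup.relIndex_mul_relIndex _ _ _ l1 l2]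
  have d1 : (E ⊓ E.map (rotHom q (d * k))).relIndex (E ⊓ icosianGroup.map (rotHom q (d * k))) ∣
      5 := by
    have e : E ⊓ E.map (rotHom q (d * k)) =
        E.map (rotHom q (d * k)) ⊓ (E ⊓ icosianGroup.map (rotHom q (d * k))) := by
      rw [inf_left_comm, inf_eq_left.2 (AddSubgroup.map_mono hEI)]
    rw [e, AddSubgroup.inf_relIndex_right]
    refine (relIndex_dvd_of_le_right _ inf_le_right (AddSubgroup.map_mono hEI)).trans
      (dvd_of_eq ?_)
    rw [AddSubgroup.relIndex_map_map_of_injective _ _ h.rotHom_injective]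
    exact relIndex_tauExtend_fixedIcosians
  have d2 : (E ⊓ icosianGroup.map (rotHom q (d * k))).relIndex
      (icosianGroup ⊓ icosianGroup.map (rotHom q (d * k))) ∣ 5 := by
    have e : E ⊓ icosianGroup.map (rotHom q (d * k)) =
        E ⊓ (icosianGroup ⊓ icosianGroup.map (rotHom q (d * k))) := by
      rw [← inf_assoc, inf_eq_left.2 hEI]
    rw [e, AddSubgroup.inf_relIndex_right]
    exact (relIndex_dvd_of_le_right _ inf_le_left hEI).trans
      (dvd_of_eq relIndex_tauExtend_fixedIcosians)
  exact mul_dvd_mul d1 d2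

end NormData

/-! ### Coincidence site lattices of the root lattice -/

theorem exists_normData {q : icosians} (hq : IsPrimitive q) (ha : IsAdmissible q) :
    ∃ d β k, NormData q d β k := by
  obtain ⟨d, β, k, h1, h2, h3, h4, h5, h6⟩ := exists_nrd_eq hq ha
  exact ⟨d, β, k, hq, h1, h2, h3, h4, h5, h6⟩

namespace NormData

variable {q : icosians} {d : ℕ} {β : ZTau} {k : ℕ}

theorem rot_emb (h : NormData q d β k) (x : ℍ[Qtau]) :
    rot q (emb x) = emb (rotHom q (d * k) x) := by
  change (twistNorm q)⁻¹ • (emb q * emb x * emb (twistFun q)) = _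
  rw [rotHom_apply, emb_smul, emb_mul, emb_mul, h.twistNorm_eq, map_inv₀, map_natCast, Nat.cast_mul]

theorem coincidenceLattice_eq (h : NormData q d β k) :
    coincidenceLattice rootLattice (rot q) =
      (fixedIcosians ⊓ fixedIcosians.map (rotHom q (d * k))).map embHom.toAddMonoidHom := by
  have hinj : Function.Injective embHom.toAddMonoidHom := emb_injective
  rw [coincidenceLattice, rootLattice_eq, AddSubgroup.map_inf _ _ _ hinj, AddSubgroup.map_map,
    AddSubgroup.map_map]
  congr 2
  ext1 x
  exact h.rot_emb x

theorem coincidenceIndex_eq (h : NormData q d β k) :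
    coincidenceIndex rootLattice (rot q) = d * k ^ 2 := by
  rw [coincidenceIndex, h.coincidenceLattice_eq, ← h.relIndex_inf_map]
  rw [rootLattice_eq]
  exact AddSubgroup.relIndex_map_map_of_injective _ _ emb_injective

theorem isLCM_coincidenceIndex (h : NormData q d β k) :
    IsLCM (nrd q) (nrd (twist q)) (coincidenceIndex rootLattice (rot q) : ZTau) := by
  rw [h.coincidenceIndex_eq, ← h.level_eq, h.nrd_eq, h.nrd_twist_eq]
  refine ⟨⟨dvd_mul_right _ _, ⟨β ^ 2, by ring⟩⟩, ?_⟩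
  rintro _ ⟨u, rfl⟩ ⟨v, hv⟩
  have h3 : β ^ 2 * u = conjZ β ^ 2 * v := mul_left_cancel₀ h.normPair.d_ne (by
    rw [← mul_assoc, ← mul_assoc, hv])
  obtain ⟨w, rfl⟩ := (h.coprime.pow (m := 2) (n := 2)).symm.dvd_of_dvd_mul_left ⟨v, h3⟩
  exact ⟨w, by ring⟩

theorem associated_of_isGCD (h : NormData q d β k) {g : ZTau}
    (hg : IsGCD (nrd q) (nrd (twist q)) g) : Associated g d := by
  rw [h.nrd_eq, h.nrd_twist_eq] at hg
  refine associated_of_dvd_dvd ?_ (hg.2 _ (dvd_mul_right _ _) (dvd_mul_right _ _))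
  obtain ⟨u, v, huv⟩ := h.coprime.pow (m := 2) (n := 2)
  have : (d : ZTau) = u * (d * β ^ 2) + v * (d * conjZ β ^ 2) := by
    linear_combination (-(d : ZTau)) * huv
  rw [this]
  exact dvd_add (hg.1.1.mul_left _) (hg.1.2.mul_left _)

theorem associated_mul (h : NormData q d β k) {g : ZTau}
    (hg : IsGCD (nrd q) (nrd (twist q)) g) :
    Associated ((coincidenceIndex rootLattice (rot q) : ZTau) * g) (nrd q * nrd (twist q)) := by
  have := (h.associated_of_isGCD hg).mul_left (coincidenceIndex rootLattice (rot q) : ZTau)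
  refine this.trans (Associated.of_eq ?_)
  rw [h.coincidenceIndex_eq, ← h.level_eq, h.nrd_eq, h.nrd_twist_eq]
  ring

theorem exists_extensionFactor (h : NormData q d β k) :
    ∃ α g : ZTau, IsGCD (nrd q) (nrd (twist q)) g ∧ α ^ 2 * g = nrd (twist q) ∧
      star (α : Qtau) ^ 2 * g = nrd q := by
  refine ⟨conjZ β, d, ?_, ?_, ?_⟩
  · rw [h.nrd_eq, h.nrd_twist_eq]
    refine ⟨⟨dvd_mul_right _ _, dvd_mul_right _ _⟩, fun c h1 h2 => ?_⟩
    obtain ⟨u, v, huv⟩ := h.coprime.pow (m := 2) (n := 2)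
    have : (d : ZTau) = u * (d * β ^ 2) + v * (d * conjZ β ^ 2) := by
      linear_combination (-(d : ZTau)) * huv
    rw [this]
    exact dvd_add (h1.mul_left _) (h2.mul_left _)
  · rw [h.nrd_twist_eq, mul_comm]
  · rw [coe_conjZ, star_star, mul_comm]
    exact h.normSq_eq.symm

/-- Any gcd is d up to a unit, so α² and β'² are associated; unique factorization allows taking
roots. Every value of α_q can thus be replaced by β'. -/
theorem exists_unit_of_isExtensionFactor (h : NormData q d β k) {α : ZTau}
    (hα : IsExtensionFactor q α) : ∃ v : ZTauˣ, α = v * conjZ β := by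
  obtain ⟨g, hg, e⟩ := hα
  obtain ⟨u, hu⟩ := (h.associated_of_isGCD hg).symm
  rw [h.nrd_twist_eq, ← hu] at e
  have e1 : α ^ 2 * u = conjZ β ^ 2 := mul_left_cancel₀ h.normPair.d_ne (by rw [← e]; ring)
  have h1 : α ∣ conjZ β := by
    rw [← UniqueFactorizationMonoid.pow_dvd_pow_iff_dvd two_ne_zero]
    exact ⟨u, e1.symm⟩
  have h2 : conjZ β ∣ α := by
    rw [← UniqueFactorizationMonoid.pow_dvd_pow_iff_dvd two_ne_zero]
    exact ⟨(u⁻¹ : ZTauˣ), by rw [← e1, mul_assoc, Units.mul_inv, mul_one]⟩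
  obtain ⟨v, hv⟩ := associated_of_dvd_dvd h2 h1
  exact ⟨v, by rw [← hv, mul_comm]⟩

end NormData

theorem abs_norm_unit (v : ZTauˣ) : |QuadraticAlgebra.norm ((v : ZTau) : Qtau)| = 1 := by
  obtain ⟨a, ha⟩ := exists_natAbs_norm (v : ZTau).2
  obtain ⟨b, hb⟩ := exists_natAbs_norm ((v⁻¹ : ZTauˣ) : ZTau).2
  have h1 : ((v : ZTau) : Qtau) * ((v⁻¹ : ZTauˣ) : ZTau) = 1 :=
    congrArg Subtype.val (Units.mul_inv v)
  have h2 := congrArg (fun x => |QuadraticAlgebra.norm x|) h1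
  simp only [map_mul, abs_mul, ha, hb, map_one, abs_one] at h2
  have h3 : a * b = 1 := by exact_mod_cast h2
  rw [ha, Nat.eq_one_of_mul_eq_one_right h3, Nat.cast_one]

theorem abs_realEmb_mul_star (x : Qtau) :
    |realEmb (x * star x)| = (|QuadraticAlgebra.norm x| : ℚ) := by
  rw [← QuadraticAlgebra.algebraMap_norm_eq_mul_star, AlgHom.commutes]
  simp

namespace NormData

variable {q : icosians} {d : ℕ} {β : ZTau} {k : ℕ}

theorem coincidenceIndex_eq_twistNorm_mul (h : NormData q d β k) {α : ZTau}
    (hα : IsExtensionFactor q α) : (coincidenceIndex rootLattice (rot q) : ℝ) =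
      twistNorm q * |realEmb (α * star (α : Qtau))| := by
  obtain ⟨v, rfl⟩ := h.exists_unit_of_isExtensionFactor hα
  have e : (((v * conjZ β : ZTau) : Qtau)) * star ((v * conjZ β : ZTau) : Qtau) =
      ((v : ZTau) * star ((v : ZTau) : Qtau)) * (β * star (β : Qtau)) := by
    push_cast
    rw [coe_conjZ, star_mul', star_star]
    ring
  have e2 : |realEmb (β * star (β : Qtau))| = k := by
    rcases h.mul_conj with e | e <;> have e' := congrArg Subtype.val e <;>
      push_cast at e' <;> rw [coe_conjZ] at e' <;> rw [e'] <;> simp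
  rw [e, map_mul, abs_mul, e2, abs_realEmb_mul_star, abs_norm_unit, h.coincidenceIndex_eq,
    h.twistNorm_eq]
  push_cast
  ring

theorem mem_sum_iff_of_isExtensionFactor (h : NormData q d β k) {α : ZTau}
    (hα : IsExtensionFactor q α) {z : ℍ[Qtau]} : z ∈ h.normPair.sum ↔
      ∃ x ∈ icosians, ∃ y ∈ icosians,
        z = (α : Qtau) • (q : ℍ[Qtau]) * x + y * twistFun ((α : Qtau) • q) := by
  obtain ⟨v, rfl⟩ := h.exists_unit_of_isExtensionFactor hα
  rw [NormPair.sum, mem_sumIdeal]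
  have hv : ((v : ZTau) : Qtau) * ((v⁻¹ : ZTauˣ) : ZTau) = 1 :=
    congrArg Subtype.val (Units.mul_inv v)
  have hv' : star ((v : ZTau) : Qtau) * star (((v⁻¹ : ZTauˣ) : ZTau) : Qtau) = 1 := by
    rw [← star_mul', hv, star_one]
  have key : ∀ x y : ℍ[Qtau], ((v * conjZ β : ZTau) : Qtau) • (q : ℍ[Qtau]) * x +
      y * twistFun (((v * conjZ β : ZTau) : Qtau) • q) =
      (conjZ β : Qtau) • (q : ℍ[Qtau]) * (((v : ZTau) : Qtau) • x) +
      (star ((v : ZTau) : Qtau) • y) * ((β : Qtau) • twistFun q) := by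
    intro x y
    rw [twistFun_smul, ZTau.coe_mul, star_mul', coe_conjZ, star_star]
    simp only [smul_mul_assoc, mul_smul_comm, smul_smul]
    rw [mul_comm (β : Qtau)]
  constructor
  · rintro ⟨x, hx, y, hy, rfl⟩
    refine ⟨(((v⁻¹ : ZTauˣ) : ZTau) : Qtau) • x, smul_mem_icosians (Subtype.prop _) hx,
      star (((v⁻¹ : ZTauˣ) : ZTau) : Qtau) • y, smul_mem_icosians (star_mem (Subtype.prop _)) hy, ?_⟩
    rw [key, smul_smul, smul_smul, hv, hv']
    congr 2
    · exact (one_smul Qtau x).symm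
    · exact (one_smul Qtau y).symm
  · rintro ⟨x, hx, y, hy, rfl⟩
    exact ⟨_, smul_mem_icosians (Subtype.prop _) hx, _,
      smul_mem_icosians (star_mem (Subtype.prop _)) hy, key x y⟩

theorem mem_coincidenceLattice_iff (h : NormData q d β k) {z : ℍ[ℝ]} :
    z ∈ coincidenceLattice rootLattice (rot q) ↔
      ∃ x ∈ fixedIcosians, x ∈ h.normPair.sum ∧ z = emb x := by
  rw [h.coincidenceLattice_eq, h.inf_map_eq]
  constructor
  · rintro ⟨x, ⟨h1, h2⟩, rfl⟩
    exact ⟨x, h1, h2, rfl⟩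
  · rintro ⟨x, h1, h2, rfl⟩
    exact ⟨x, ⟨h1, h2⟩, rfl⟩

theorem coe_coincidenceLattice_eq_inter (h : NormData q d β k) {α : ZTau}
    (hα : IsExtensionFactor q α) : (coincidenceLattice rootLattice (rot q) : Set ℍ[ℝ]) =
      {z | ∃ x y : icosians, z = emb ((α • q : icosians) * x + y * twist (α • q))} ∩
        rootLattice := by
  ext z
  rw [SetLike.mem_coe, h.mem_coincidenceLattice_iff]
  constructor
  · rintro ⟨w, hw, hs, rfl⟩
    obtain ⟨x, hx, y, hy, rfl⟩ := (h.mem_sum_iff_of_isExtensionFactor hα).1 hs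
    exact ⟨⟨⟨x, hx⟩, ⟨y, hy⟩, rfl⟩, emb_mem_rootLattice_iff.2 hw⟩
  · rintro ⟨⟨x, y, rfl⟩, hz⟩
    exact ⟨_, emb_mem_rootLattice_iff.1 hz, (h.mem_sum_iff_of_isExtensionFactor hα).2
      ⟨x, x.2, y, y.2, rfl⟩, rfl⟩

theorem coe_coincidenceLattice_eq_trace (h : NormData q d β k) {α : ZTau}
    (hα : IsExtensionFactor q α) : (coincidenceLattice rootLattice (rot q) : Set ℍ[ℝ]) =
      {z | ∃ x : icosians, z = emb ((α • q : icosians) * x + twist x * twist (α • q))} := by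
  ext z
  rw [SetLike.mem_coe, h.mem_coincidenceLattice_iff]
  constructor
  · rintro ⟨w, hw, hs, rfl⟩
    obtain ⟨x, hx, y, hy, e⟩ := (h.mem_sum_iff_of_isExtensionFactor hα).1 hs
    -- With p = αq and w = px + yp̃ fixed, expanding w = τw + (τw)~ gives pX + X̃p̃ for X = τx +
    -- τ'ỹ.
    refine ⟨⟨tau • x + star tau • twistFun y, icosians.add_mem (smul_mem_icosians tau_mem hx)
      (smul_mem_icosians (star_mem tau_mem) (twistFun_mem hy))⟩, congrArg emb ?_⟩
    change w = (α : Qtau) • (q : ℍ[Qtau]) * (tau • x + star tau • twistFun y) +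
      twistFun (tau • x + star tau • twistFun y) * twistFun ((α : Qtau) • q)
    rw [eq_tau_smul_add_twistFun hw.2, e]
    generalize (α : Qtau) • (q : ℍ[Qtau]) = p
    simp only [twistFun_smul, twistFun_add, twistFun_mul, twistFun_twistFun, smul_add, mul_add,
      add_mul, mul_smul_comm, smul_mul_assoc, star_star]
    abel
  · rintro ⟨x, rfl⟩
    refine ⟨_, ?_, (h.mem_sum_iff_of_isExtensionFactor hα).2
      ⟨x, x.2, twistFun x, twistFun_mem x.2, rfl⟩, rfl⟩
    rw [← twistFun_mul]
    exact add_twistFun_mem_fixedIcosians (mul_mem_icosians (α • q).2 x.2)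

end NormData

theorem coincidenceLattice_neg (Γ : AddSubgroup ℍ[ℝ]) (R : ℍ[ℝ] →ₗ[ℝ] ℍ[ℝ]) :
    coincidenceLattice Γ (-R) = coincidenceLattice Γ R := by
  rw [coincidenceLattice, coincidenceLattice]
  congr 1
  ext z
  constructor
  · rintro ⟨x, hx, rfl⟩
    exact ⟨-x, neg_mem hx, by simp⟩
  · rintro ⟨x, hx, rfl⟩
    exact ⟨-x, neg_mem hx, by simp⟩

theorem twistNorm_smul (α : ZTau) (q : icosians) :
    twistNorm (α • q) = |realEmb (α * star (α : Qtau))| * twistNorm q := by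
  have : ((α • q : icosians) : ℍ[Qtau]) * twist (α • q) =
      (α * star (α : Qtau)) • ((q : ℍ[Qtau]) * twist q) := by
    change (α : Qtau) • (q : ℍ[Qtau]) * twistFun ((α : Qtau) • q) = _ • ((q : ℍ[Qtau]) * twistFun q)
    rw [twistFun_smul, smul_mul_assoc, mul_smul_comm, smul_smul]
  rw [twistNorm, this, emb_smul, norm_smul, Real.norm_eq_abs]
  rfl

theorem rot_smul_apply (α : ZTau) (q : icosians) (x : ℍ[ℝ]) : rot (α • q) x =
    (|realEmb (α * star (α : Qtau))|⁻¹ * realEmb (α * star (α : Qtau))) • rot q x := by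
  change (twistNorm (α • q))⁻¹ • (emb ((α : Qtau) • (q : ℍ[Qtau])) * x *
    emb (twistFun ((α : Qtau) • q))) = _ • (twistNorm q)⁻¹ • (emb q * x * emb (twistFun q))
  rw [twistNorm_smul, twistFun_smul, emb_smul, emb_smul, map_mul]
  simp only [smul_mul_assoc, mul_smul_comm, smul_smul]
  congr 1
  rw [mul_inv]
  ring

/-- Scaling by α multiplies the sandwich by αα' and its normalization by |αα'|, so only a sign
survives, and L ∩ RL does not see it. -/
theorem rot_smul (α : ZTau) (hα : α ≠ 0) (q : icosians) :
    rot (α • q) = rot q ∨ rot (α • q) = -rot q := by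
  have h0 : realEmb (α * star (α : Qtau)) ≠ 0 := by
    have : (α : Qtau) ≠ 0 := fun e => hα (Subtype.ext e)
    rw [Ne, map_eq_zero_iff _ realEmb_injective]
    exact mul_ne_zero this (star_ne_zero.2 this)
  rcases abs_choice (realEmb (α * star (α : Qtau))) with e | e
  · left
    ext1 x
    rw [rot_smul_apply, e, inv_mul_cancel₀ h0, one_smul]
  · right
    ext1 x
    rw [rot_smul_apply, e, inv_neg, neg_mul, inv_mul_cancel₀ h0, neg_smul, one_smul]
    rfl

theorem NormData.coincidenceLattice_smul {q : icosians} {d : ℕ} {β : ZTau} {k : ℕ}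
    (h : NormData q d β k) {α : ZTau} (hα : IsExtensionFactor q α) :
    coincidenceLattice rootLattice (rot q) = coincidenceLattice rootLattice (rot (α • q)) := by
  obtain ⟨v, e⟩ := h.exists_unit_of_isExtensionFactor hα
  have : α ≠ 0 := by
    rw [e]
    exact mul_ne_zero v.ne_zero h.normPair.right_ne
  rcases rot_smul α this q with e | e <;> rw [e]
  rw [coincidenceLattice_neg]

/-! ### Determinants -/

/-- The basis `1, i, j, k` of Hamilton's quaternions. -/
def quatBasis : Module.Basis (Fin 4) ℝ ℍ[ℝ] :=
  .ofEquivFun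
    { toFun := fun x => ![x.re, x.imI, x.imJ, x.imK]
      invFun := fun f => quat (f 0) (f 1) (f 2) (f 3)
      map_add' := fun x y => by ext i; fin_cases i <;> simp
      map_smul' := fun c x => by ext i; fin_cases i <;> simp
      left_inv := fun x => rfl
      right_inv := fun f => by ext i; fin_cases i <;> rfl }

theorem quatBasis_repr (x : ℍ[ℝ]) : ⇑(quatBasis.repr x) = ![x.re, x.imI, x.imJ, x.imK] := by
  ext i
  rw [← Module.Basis.equivFun_apply, quatBasis, Module.Basis.equivFun_ofEquivFun]
  rfl

theorem quatBasis_apply (i : Fin 4) : quatBasis i =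
    ![quat 1 0 0 0, quat 0 1 0 0, quat 0 0 1 0, quat 0 0 0 1] i := by
  have : quatBasis i = quat ((Pi.single i 1 : Fin 4 → ℝ) 0) ((Pi.single i 1 : Fin 4 → ℝ) 1)
      ((Pi.single i 1 : Fin 4 → ℝ) 2) ((Pi.single i 1 : Fin 4 → ℝ) 3) := by
    rw [quatBasis, Module.Basis.coe_ofEquivFun]
    rfl
  rw [this]
  fin_cases i <;> apply Quaternion.ext <;> simp

theorem det_mulLeft (A : ℍ[ℝ]) : LinearMap.det (LinearMap.mulLeft ℝ A) = Quaternion.normSq A ^ 2 := by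
  have : LinearMap.toMatrix quatBasis quatBasis (LinearMap.mulLeft ℝ A) =
      !![A.re, -A.imI, -A.imJ, -A.imK; A.imI, A.re, -A.imK, A.imJ; A.imJ, A.imK, A.re, -A.imI;
        A.imK, -A.imJ, A.imI, A.re] := by
    ext i j
    rw [LinearMap.toMatrix_apply, quatBasis_repr, quatBasis_apply]
    fin_cases j <;> fin_cases i <;> simp
  refine (LinearMap.det_toMatrix quatBasis _).symm.trans ?_
  rw [this, Matrix.det_succ_row_zero]
  simp [Fin.sum_univ_succ, Matrix.det_fin_three, Fin.succAbove, Quaternion.normSq_def']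
  ring

theorem det_mulRight (A : ℍ[ℝ]) : LinearMap.det (LinearMap.mulRight ℝ A) = Quaternion.normSq A ^ 2 := by
  have : LinearMap.toMatrix quatBasis quatBasis (LinearMap.mulRight ℝ A) =
      !![A.re, -A.imI, -A.imJ, -A.imK; A.imI, A.re, A.imK, -A.imJ; A.imJ, -A.imK, A.re, A.imI;
        A.imK, A.imJ, -A.imI, A.re] := by
    ext i j
    rw [LinearMap.toMatrix_apply, quatBasis_repr, quatBasis_apply]
    fin_cases j <;> fin_cases i <;> simp
  refine (LinearMap.det_toMatrix quatBasis _).symm.trans ?_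
  rw [this, Matrix.det_succ_row_zero]
  simp [Fin.sum_univ_succ, Matrix.det_fin_three, Fin.succAbove, Quaternion.normSq_def']
  ring

/-- Quaternion conjugation as a linear map. -/
def conjLin : ℍ[ℝ] →ₗ[ℝ] ℍ[ℝ] where
  toFun x := star x
  map_add' := star_add
  map_smul' := Quaternion.star_smul

theorem det_conjLin : LinearMap.det conjLin = -1 := by
  have : LinearMap.toMatrix quatBasis quatBasis conjLin =
      !![1, 0, 0, 0; 0, -1, 0, 0; 0, 0, -1, 0; 0, 0, 0, -1] := by
    ext i j
    rw [LinearMap.toMatrix_apply, quatBasis_repr, quatBasis_apply]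
    fin_cases j <;> fin_cases i <;> simp [conjLin]
  refine (LinearMap.det_toMatrix quatBasis _).symm.trans ?_
  rw [this, Matrix.det_succ_row_zero]
  simp [Fin.sum_univ_succ, Matrix.det_fin_three, Fin.succAbove]

/-- The linear map `x ↦ r • a x b`. -/
def sandwich (r : ℝ) (a b : ℍ[ℝ]) : ℍ[ℝ] →ₗ[ℝ] ℍ[ℝ] :=
  r • (LinearMap.mulLeft ℝ a ∘ₗ LinearMap.mulRight ℝ b)

theorem sandwich_apply (r : ℝ) (a b x : ℍ[ℝ]) : sandwich r a b x = r • (a * x * b) := by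
  rw [mul_assoc]
  rfl

theorem det_sandwich (r : ℝ) (a b : ℍ[ℝ]) :
    LinearMap.det (sandwich r a b) = r ^ 4 * (Quaternion.normSq a ^ 2 * Quaternion.normSq b ^ 2) := by
  have h4 : Module.finrank ℝ ℍ[ℝ] = 4 := Quaternion.finrank_eq_four
  refine (LinearMap.det_smul _ _).trans ?_
  rw [h4]
  congr 1
  refine (LinearMap.det_comp _ _).trans ?_
  rw [det_mulLeft, det_mulRight]


/-! ### Products of reflections -/

theorem star_sub_quat (x y : ℍ[Qtau]) : star (x - y) = star x - star y := by
  apply Quaternion.ext <;> simp <;> ring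

/-- Isometries of the form `x ↦ c a x ã` or `x ↦ c a x̄ ã` with rational `c`. -/
def IsTwistIsometry (T : ℍ[Qtau] → ℍ[Qtau]) : Prop :=
  (∀ x, Quaternion.normSq (T x) = Quaternion.normSq x) ∧ ∃ (c : Qtau) (a : ℍ[Qtau]), star c = c ∧
    ((∀ x, T x = c • (a * x * twistFun a)) ∨ ∀ x, T x = c • (a * star x * twistFun a))

theorem isTwistIsometry_id : IsTwistIsometry id :=
  ⟨fun _ => rfl, 1, 1, star_one _, Or.inl fun x => by
    have : twistFun 1 = 1 := by apply Quaternion.ext <;> simp [twistFun]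
    rw [this, one_mul, mul_one]
    exact (one_smul Qtau x).symm⟩

namespace IsTwistIsometry

variable {T : ℍ[Qtau] → ℍ[Qtau]}

theorem map_sub (hT : IsTwistIsometry T) (x y : ℍ[Qtau]) : T (x - y) = T x - T y := by
  obtain ⟨-, c, a, -, h | h⟩ := hT
  · simp only [h, mul_sub, sub_mul, smul_sub]
  · simp only [h, star_sub_quat, mul_sub, sub_mul, smul_sub]

theorem twistFun_apply (hT : IsTwistIsometry T) {x : ℍ[Qtau]} (hx : twistFun x = x) :
    twistFun (T x) = T x := by
  obtain ⟨-, c, a, hc, h | h⟩ := hT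
  · rw [h, twistFun_smul, hc, twistFun_mul, twistFun_mul, twistFun_twistFun, hx, mul_assoc]
  · rw [h, twistFun_smul, hc, twistFun_mul, twistFun_mul, twistFun_twistFun, twistFun_star, hx,
      mul_assoc]

/-- The composition with the reflection in `v`. -/
theorem comp_reflection (hT : IsTwistIsometry T) {v : ℍ[Qtau]} (hv : twistFun v = v)
    (hv0 : v ≠ 0) :
    IsTwistIsometry fun x => (-(Quaternion.normSq v)⁻¹) • (v * star (T x) * v) := by
  obtain ⟨h0, c, a, hc, h⟩ := hT
  have hn : Quaternion.normSq v ≠ 0 := fun e => hv0 (normSq_eq_zero_iff.1 e)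
  have hns : star (Quaternion.normSq v) = Quaternion.normSq v := by rw [← normSq_twistFun, hv]
  -- The new left factor v·(ã)‾ has twist āv. The conjugation in the reflection interchanges the two
  -- forms of a twist isometry.
  refine ⟨fun x => ?_, -(Quaternion.normSq v)⁻¹ * c, v * star (twistFun a), ?_, ?_⟩
  · rw [Quaternion.normSq_smul, map_mul, map_mul, Quaternion.normSq_star, h0]
    field_simp
  · rw [star_mul', star_neg, star_inv₀, hns, hc]
  · have ht : twistFun (v * star (twistFun a)) = star a * v := by
      rw [twistFun_mul, twistFun_star, twistFun_twistFun, hv]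
    rw [ht]
    refine h.symm.imp (fun h x => ?_) (fun h x => ?_) <;>
    · dsimp only
      rw [h, Quaternion.star_smul, star_mul_quat, star_mul_quat, mul_smul_comm, smul_mul_assoc,
        smul_smul]
      simp only [star_star, mul_assoc]

end IsTwistIsometry

theorem normSq_sub_eq (x y : ℍ[Qtau]) : Quaternion.normSq (x - y) =
    Quaternion.normSq x + Quaternion.normSq y - trd (x * star y) := by
  simp [Quaternion.normSq_def', trd]
  ring

theorem reflection_eq {v : ℍ[Qtau]} (hv : v ≠ 0) (x : ℍ[Qtau]) :
    (-(Quaternion.normSq v)⁻¹) • (v * star x * v) =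
      x - (trd (x * star v) / Quaternion.normSq v) • v := by
  have hn : Quaternion.normSq v ≠ 0 := fun e => hv (normSq_eq_zero_iff.1 e)
  have h1 : x * star v + v * star x = (trd (x * star v) : ℍ[Qtau]) := by
    rw [← add_star_eq_trd, star_mul_quat, star_star]
  have h2 : v * star x = (trd (x * star v) : ℍ[Qtau]) - x * star v := by
    rw [← h1]; abel
  rw [h2, sub_mul, Quaternion.coe_mul_eq_smul, mul_assoc, Quaternion.star_mul_self,
    Quaternion.mul_coe_eq_smul]
  generalize trd (x * star v) = t
  generalize Quaternion.normSq v = N at *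
  apply Quaternion.ext <;> simp <;> field_simp <;> ring

/-- The reflection in `u - w` maps `u` to `w` if `|u| = |w|`. -/
theorem reflection_sub_left {u w : ℍ[Qtau]} (h : Quaternion.normSq u = Quaternion.normSq w)
    (hne : u - w ≠ 0) :
    (-(Quaternion.normSq (u - w))⁻¹) • ((u - w) * star u * (u - w)) = w := by
  have hn : Quaternion.normSq (u - w) ≠ 0 := fun e => hne (normSq_eq_zero_iff.1 e)
  have ht : trd (u * star (u - w)) = Quaternion.normSq (u - w) := by
    have e1 := normSq_sub_eq u (u - w)
    rw [sub_sub_cancel] at e1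
    linear_combination h + e1
  rw [reflection_eq hne, ht, div_self hn]
  exact (congrArg (u - ·) (one_smul Qtau (u - w))).trans (sub_sub_cancel u w)

/-- The reflection in `u - w` fixes the vectors that have the same distance to `u` and `w`. -/
theorem reflection_sub_fixed {u w x : ℍ[Qtau]} (h : Quaternion.normSq u = Quaternion.normSq w)
    (hx : Quaternion.normSq (x - u) = Quaternion.normSq (x - w)) (hne : u - w ≠ 0) :
    (-(Quaternion.normSq (u - w))⁻¹) • ((u - w) * star x * (u - w)) = x := by
  have ht : trd (x * star (u - w)) = 0 := by
    have e : x * star (u - w) = x * star u + -(x * star w) := by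
      rw [star_sub_quat, mul_sub, sub_eq_add_neg]
    rw [normSq_sub_eq, normSq_sub_eq] at hx
    rw [e, trd_add, trd_neg]
    linear_combination h - hx
  rw [reflection_eq hne, ht, zero_div]
  exact (congrArg (x - ·) (zero_smul Qtau (u - w))).trans (sub_zero x)

/-- The Cartan–Dieudonné argument: the vectors are moved into place one at a time. The reflection in
T(cⱼ) - bⱼ corrects the j-th vector and fixes the earlier ones, being equidistant from T(cⱼ) and bⱼ.
-/
theorem exists_isTwistIsometry {n : ℕ} (b c : Fin n → ℍ[Qtau]) (hb : ∀ i, twistFun (b i) = b i)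
    (hc : ∀ i, twistFun (c i) = c i)
    (h1 : ∀ i, Quaternion.normSq (c i) = Quaternion.normSq (b i))
    (h2 : ∀ i j, Quaternion.normSq (c i - c j) = Quaternion.normSq (b i - b j)) :
    ∃ T, IsTwistIsometry T ∧ ∀ i, T (c i) = b i := by
  have key : ∀ k ≤ n, ∃ T, IsTwistIsometry T ∧ ∀ i : Fin n, i.val < k → T (c i) = b i := by
    intro k
    induction k with
    | zero => exact fun _ => ⟨id, isTwistIsometry_id, fun i hi => absurd hi (Nat.not_lt_zero _)⟩
    | succ k ih =>
      intro hk
      obtain ⟨T, hT, hTi⟩ := ih (by omega)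
      set j : Fin n := ⟨k, hk⟩ with hj
      by_cases hne : T (c j) - b j = 0
      · refine ⟨T, hT, fun i hi => ?_⟩
        rcases Nat.lt_succ_iff_lt_or_eq.1 hi with h | h
        · exact hTi i h
        · obtain rfl : i = j := Fin.ext h
          exact sub_eq_zero.1 hne
      · have hv : twistFun (T (c j) - b j) = T (c j) - b j := by
          rw [twistFun_sub, hT.twistFun_apply (hc j), hb]
        have hu : Quaternion.normSq (T (c j)) = Quaternion.normSq (b j) := by rw [hT.1, h1]
        refine ⟨_, hT.comp_reflection hv hne, fun i hi => ?_⟩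
        rcases Nat.lt_succ_iff_lt_or_eq.1 hi with h | h
        · rw [hTi i h]
          refine reflection_sub_fixed hu ?_ hne
          rw [← hTi i h, ← hT.map_sub, hT.1, h2, hTi i h]
        · obtain rfl : i = j := Fin.ext h
          exact reflection_sub_left hu hne
  obtain ⟨T, hT, h⟩ := key n le_rfl
  exact ⟨T, hT, fun i => h i i.2⟩

/-! ### Coincidence rotations -/

theorem twistNorm_eq_mul (q : icosians) : twistNorm q = ‖emb q‖ * ‖emb (twist q)‖ := by
  rw [twistNorm, emb_mul, norm_mul]

theorem rot_eq_sandwich (q : icosians) :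
    rot q = sandwich (twistNorm q)⁻¹ (emb q) (emb (twist q)) := by
  ext1 x
  rw [sandwich_apply]
  rfl

theorem twistNorm_ne_zero {q : icosians} (hq : (q : ℍ[Qtau]) ≠ 0) : twistNorm q ≠ 0 := by
  intro h
  have h1 := twistNorm_sq q
  rw [h, zero_pow two_ne_zero, eq_comm, map_eq_zero_iff _ realEmb_injective,
    mul_eq_zero, star_eq_zero, or_self] at h1
  exact hq (normSq_eq_zero_iff.1 h1)

theorem norm_rot {q : icosians} (hq : (q : ℍ[Qtau]) ≠ 0) (x : ℍ[ℝ]) : ‖rot q x‖ = ‖x‖ := by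
  have h := twistNorm_ne_zero hq
  rw [rot_eq_sandwich, sandwich_apply, norm_smul, norm_mul, norm_mul, norm_inv, Real.norm_eq_abs,
    abs_of_nonneg (twistNorm_nonneg q)]
  field_simp
  rw [twistNorm_eq_mul]
  ring

theorem det_rot {q : icosians} (hq : (q : ℍ[Qtau]) ≠ 0) : LinearMap.det (rot q) = 1 := by
  have h := twistNorm_ne_zero hq
  rw [rot_eq_sandwich, det_sandwich, Quaternion.normSq_eq_norm_mul_self,
    Quaternion.normSq_eq_norm_mul_self]
  have : (‖emb q‖ * ‖emb q‖) ^ 2 * (‖emb (twist q)‖ * ‖emb (twist q)‖) ^ 2 = twistNorm q ^ 4 := by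
    rw [twistNorm_eq_mul]
    ring
  rw [this, ← mul_pow, inv_mul_cancel₀ h, one_pow]

theorem NormData.isCoincidenceRotation {q : icosians} {d : ℕ} {β : ZTau} {k : ℕ}
    (h : NormData q d β k) : IsCoincidenceRotation rootLattice (rot q) := by
  refine ⟨⟨norm_rot h.primitive.ne_zero, ⟨?_⟩⟩, det_rot h.primitive.ne_zero⟩
  change coincidenceIndex rootLattice (rot q) ≠ 0
  rw [h.coincidenceIndex_eq]
  exact (Nat.mul_pos h.d_pos (pow_pos h.k_pos 2)).ne'

theorem exists_natCast_mul_mem (t : Qtau) : ∃ N : ℕ, 0 < N ∧ (N : Qtau) * t ∈ ZTau := by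
  refine ⟨t.re.den * t.im.den, Nat.mul_pos t.re.den_pos t.im.den_pos, mem_ZTau_iff.2
    ⟨t.re.num * t.im.den, t.im.num * t.re.den, ?_⟩⟩
  have h1 := Rat.mul_den_eq_num t.re
  have h2 := Rat.mul_den_eq_num t.im
  ext
  · simp
    rw [← h1]; ring
  · simp
    rw [← h2]; ring

theorem exists_natCast_smul_mem (a : ℍ[Qtau]) : ∃ N : ℕ, 0 < N ∧ (N : Qtau) • a ∈ icosians := by
  choose N hN hmem using fun i => exists_natCast_mul_mem (trd (a * dualVec i))
  refine ⟨∏ i, N i, Finset.prod_pos fun i _ => hN i, mem_icosians_of_trd fun i => ?_⟩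
  obtain ⟨m, hm⟩ := Finset.dvd_prod_of_mem N (Finset.mem_univ i)
  rw [smul_mul_assoc, trd_smul, hm, Nat.cast_mul, mul_comm (N i : Qtau), mul_assoc]
  exact ZTau.mul_mem (natCast_mem ZTau m) (hmem i)

/-- Every nonzero quaternion over `ℚ(τ)` is a multiple of a primitive icosian. -/
theorem exists_smul_isPrimitive {a : ℍ[Qtau]} (ha : a ≠ 0) :
    ∃ (c : Qtau) (q : icosians), IsPrimitive q ∧ a = c • (q : ℍ[Qtau]) := by
  obtain ⟨N, hN, hmem⟩ := exists_natCast_smul_mem a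
  have hN0 : (N : Qtau) ≠ 0 := Nat.cast_ne_zero.2 hN.ne'
  obtain ⟨p, hp, rfl⟩ : ∃ p ∈ icosians, a = (N : Qtau)⁻¹ • p :=
    ⟨_, hmem, by rw [smul_smul, inv_mul_cancel₀ hN0]; exact (one_smul Qtau a).symm⟩
  have hp0 : p ≠ 0 := by
    rintro rfl
    exact ha (smul_zero _)
  set J : Ideal ZTau := Ideal.span (Set.range fun i =>
    (⟨trd (p * dualVec i), mem_icosians_iff_trd.1 hp i⟩ : ZTau)) with hJ
  obtain ⟨g, hg⟩ := (IsPrincipalIdealRing.principal J).principal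
  have hdvd : ∀ i, ∃ c : ZTau, trd (p * dualVec i) = g * c := fun i => by
    have h : (⟨trd (p * dualVec i), mem_icosians_iff_trd.1 hp i⟩ : ZTau) ∈ J :=
      Ideal.subset_span ⟨i, rfl⟩
    rw [hg] at h
    obtain ⟨c, hc⟩ := Ideal.mem_span_singleton.1 h
    exact ⟨c, congrArg Subtype.val hc⟩
  have hg0 : (g : Qtau) ≠ 0 := fun h0 => by
    apply hp0
    rw [← sum_trd_smul p]
    refine Finset.sum_eq_zero fun i _ => ?_
    obtain ⟨c, hc⟩ := hdvd i
    rw [hc, h0, zero_mul]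
    exact zero_smul Qtau (icosianVec i)
  have hq : (g : Qtau)⁻¹ • p ∈ icosians := by
    refine mem_icosians_of_trd fun i => ?_
    obtain ⟨c, hc⟩ := hdvd i
    rw [smul_mul_assoc, trd_smul, hc, inv_mul_cancel_left₀ hg0]
    exact c.2
  refine ⟨(N : Qtau)⁻¹ * g, ⟨_, hq⟩, ?_, by rw [smul_smul, mul_assoc, mul_inv_cancel₀ hg0, mul_one]⟩
  have h1 : g ∈ J := by
    rw [hg]
    exact Ideal.mem_span_singleton_self g
  rw [hJ, Ideal.mem_span_range_iff_exists_fun] at h1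
  obtain ⟨c, hc⟩ := h1
  refine isPrimitive_iff_exists_trd.2 ⟨∑ i, c i • dualVec i,
    icosians.sum_mem fun i _ => icosians.smul_mem _ (dualVec_mem i), ?_⟩
  have h2 : trd (p * ∑ i, c i • dualVec i) = g := by
    rw [Finset.mul_sum, trd_sum]
    simp only [zsmul_def, mul_smul_comm, trd_smul]
    simpa using congrArg Subtype.val hc
  rw [smul_mul_assoc, trd_smul, h2, inv_mul_cancel₀ hg0]

/-- L spans ℝ⁴: dividing by √5 recovers e₃ from `fixedVec`, and the icosians contain 1, i, j, k. -/
theorem linearMap_ext_of_fixed {f g : ℍ[ℝ] →ₗ[ℝ] ℍ[ℝ]}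
    (h : ∀ x ∈ fixedIcosians, f (emb x) = g (emb x)) : f = g := by
  have hsmul : ∀ (c : Qtau) x, f (emb x) = g (emb x) → f (emb (c • x)) = g (emb (c • x)) :=
    fun c x hx => by rw [emb_smul, map_smul, map_smul, hx]
  have hadd : ∀ x y, f (emb x) = g (emb x) → f (emb y) = g (emb y) →
      f (emb (x + y)) = g (emb (x + y)) :=
    fun x y hx hy => by rw [emb_add, map_add, map_add, hx, hy]
  have h0 := h _ e0_mem_fixedIcosians
  have h1 := h _ e1_mem_fixedIcosians
  have h2 := h _ e2_mem_fixedIcosians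
  have h3 : f (emb e3) = g (emb e3) := by
    have hne : (2 * tau - 1 : Qtau) ≠ 0 := by
      intro e
      have := sqrtFive_mul_self
      have h5 : ((5 : ℕ) : ZTau) ≠ 0 := Nat.cast_ne_zero.2 (by norm_num)
      apply h5
      rw [← this, show sqrtFive = 0 from Subtype.ext e, mul_zero]
    have e : e3 = (2 * tau - 1 : Qtau)⁻¹ • (fixedVec + tau • e2) := by
      have : fixedVec + tau • e2 = (2 * tau - 1 : Qtau) • e3 := by
        apply Quaternion.ext <;> simp [fixedVec]
      rw [this, smul_smul, inv_mul_cancel₀ hne]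
      exact (one_smul Qtau e3).symm
    rw [e]
    exact hsmul _ _ (hadd _ _ (h _ fixedVec_mem_fixedIcosians) (hsmul _ _ h2))
  have hI : ∀ x ∈ icosians, f (emb x) = g (emb x) := by
    intro x hx
    obtain ⟨a, b, c, d, rfl⟩ := mem_icosians.1 hx
    exact hadd _ _ (hadd _ _ (hadd _ _ (hsmul _ _ h0) (hsmul _ _ h1)) (hsmul _ _ h2)) (hsmul _ _ h3)
  refine quatBasis.ext fun i => ?_
  rw [quatBasis_apply]
  have hj : quat 0 0 1 0 ∈ icosians := by
    convert icosians.neg_mem (dualVec_mem 2) using 1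
    apply Quaternion.ext <;> simp [dualVec]
  have hk : quat 0 0 0 1 ∈ icosians := by
    convert icosians.sub_mem hj (dualVec_mem 3) using 1
    apply Quaternion.ext <;> simp [dualVec]
  have em : ∀ a b c d : Qtau,
      emb (quat a b c d) = quat (realEmb a) (realEmb b) (realEmb c) (realEmb d) :=
    fun _ _ _ _ => rfl
  fin_cases i
  · simpa [em, e0] using h0
  · simpa [em, e1] using h1
  · simpa [em] using hI _ hj
  · simpa [em] using hI _ hk

/-- A coincidence isometry of the root lattice is given by a twist isometry. -/
theorem exists_isTwistIsometry_of_isCoincidenceIsometry {R : ℍ[ℝ] →ₗ[ℝ] ℍ[ℝ]}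
    (hR : IsCoincidenceIsometry rootLattice R) :
    ∃ T, IsTwistIsometry T ∧ ∀ f : ℍ[ℝ] →ₗ[ℝ] ℍ[ℝ], (∀ x, f (emb x) = emb (T x)) → R = f := by
  obtain ⟨hiso, ⟨hfin⟩⟩ := hR
  set n := (coincidenceLattice rootLattice R).relIndex rootLattice with hn
  have hn0 : (n : Qtau) ≠ 0 := Nat.cast_ne_zero.2 hfin
  -- The index n annihilates L/(L ∩ RL), so nL ⊆ RL. Dividing by n gives twist-fixed vectors over
  -- ℚ(τ) that R maps to a basis of L.
  have hex : ∀ x ∈ fixedIcosians, ∃ y ∈ fixedIcosians, R (emb y) = n • emb x := by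
    intro x hx
    have h1 := AddSubgroup.nsmul_index_mem
      ((coincidenceLattice rootLattice R).addSubgroupOf rootLattice)
      ⟨emb x, emb_mem_rootLattice_iff.2 hx⟩
    rw [AddSubgroup.mem_addSubgroupOf] at h1
    obtain ⟨y, hy, e⟩ := h1.2
    obtain ⟨z, hz, ht, rfl⟩ := mem_rootLattice_iff.1 hy
    exact ⟨z, ⟨hz, ht⟩, e⟩
  let b : Fin 4 → ℍ[Qtau] := ![e0, e1, e2, fixedVec]
  have hb : ∀ i, b i ∈ fixedIcosians := by
    intro i
    fin_cases i
    exacts [e0_mem_fixedIcosians, e1_mem_fixedIcosians, e2_mem_fixedIcosians,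
      fixedVec_mem_fixedIcosians]
  choose y hy hRy using fun i => hex (b i) (hb i)
  have hc : ∀ i, R (emb ((n : Qtau)⁻¹ • y i)) = emb (b i) := by
    intro i
    rw [emb_smul, map_smul, hRy, map_inv₀, map_natCast, ← Nat.cast_smul_eq_nsmul ℝ, smul_smul,
      inv_mul_cancel₀ (Nat.cast_ne_zero.2 hfin), one_smul]
  have hnorm : ∀ x z : ℍ[Qtau], R (emb x) = emb z → Quaternion.normSq x = Quaternion.normSq z := by
    intro x z h
    apply realEmb_injective
    rw [← norm_emb_sq, ← norm_emb_sq, ← h, hiso]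
  obtain ⟨T, hT, hTb⟩ := exists_isTwistIsometry b (fun i => (n : Qtau)⁻¹ • y i)
    (fun i => (hb i).2)
    (fun i => by rw [twistFun_smul, star_inv₀, star_natCast, (hy i).2])
    (fun i => hnorm _ _ (hc i))
    (fun i j => hnorm _ _ (by rw [emb_sub, map_sub, hc, hc, emb_sub]))
  refine ⟨T, hT, fun f hf => ?_⟩
  have hinj : Function.Injective R := by
    rw [← LinearMap.ker_eq_bot, LinearMap.ker_eq_bot']
    intro x hx
    rw [← norm_eq_zero, ← hiso, hx, norm_zero]
  let e := LinearEquiv.ofInjectiveEndo R hinj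
  have he : ∀ x, e x = R x := fun x => rfl
  have hid : f ∘ₗ (e.symm : ℍ[ℝ] →ₗ[ℝ] ℍ[ℝ]) = LinearMap.id := by
    have hbi : ∀ i, f (e.symm (emb (b i))) = emb (b i) := by
      intro i
      rw [← hc i, ← he, e.symm_apply_apply, hf, hTb, he, hc]
    refine linearMap_ext_of_fixed fun x hx => ?_
    obtain ⟨k0, k1, k2, k3, rfl⟩ := exists_int_of_mem_fixedIcosians hx
    have hz : ∀ (k : ℤ) (x : ℍ[Qtau]), emb (k • x) = k • emb x := fun k x =>
      map_zsmul embHom k x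
    have g0 := hbi 0
    have g1 := hbi 1
    have g2 := hbi 2
    have g3 := hbi 3
    change f (e.symm (emb e0)) = emb e0 at g0
    change f (e.symm (emb e1)) = emb e1 at g1
    change f (e.symm (emb e2)) = emb e2 at g2
    change f (e.symm (emb fixedVec)) = emb fixedVec at g3
    change f (e.symm _) = _
    simp only [emb_add, hz, map_add, map_zsmul, g0, g1, g2, g3]
    rfl
  ext1 x
  have := LinearMap.congr_fun hid (R x)
  rw [LinearMap.comp_apply, ← he] at this
  change f (e.symm (e x)) = e x at this
  rw [e.symm_apply_apply] at this
  rw [this, he]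

theorem det_sandwich_comp_conjLin (r : ℝ) (a b : ℍ[ℝ]) :
    LinearMap.det (sandwich r a b ∘ₗ conjLin) =
      -(r ^ 4 * (Quaternion.normSq a ^ 2 * Quaternion.normSq b ^ 2)) := by
  refine (LinearMap.det_comp _ _).trans ?_
  rw [det_conjLin, det_sandwich, mul_neg_one]

theorem sandwich_comp_conjLin_apply (r : ℝ) (a b x : ℍ[ℝ]) :
    (sandwich r a b ∘ₗ conjLin) x = r • (a * star x * b) :=
  sandwich_apply r a b (star x)

theorem exists_sandwich_of_isCoincidenceRotation {R : ℍ[ℝ] →ₗ[ℝ] ℍ[ℝ]}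
    (hR : IsCoincidenceRotation rootLattice R) :
    ∃ (c : Qtau) (a : ℍ[Qtau]), star c = c ∧
      R = sandwich (realEmb c) (emb a) (emb (twistFun a)) := by
  obtain ⟨T, ⟨-, c, a, hc, h⟩, hf⟩ := exists_isTwistIsometry_of_isCoincidenceIsometry hR.1
  rcases h with h | h
  · exact ⟨c, a, hc, hf _ fun x => by rw [sandwich_apply, h, emb_smul, emb_mul, emb_mul]⟩
  · exfalso
    have h1 := hf (sandwich (realEmb c) (emb a) (emb (twistFun a)) ∘ₗ conjLin) fun x => by
      rw [h, emb_smul, emb_mul, emb_mul, emb_star, ← sandwich_comp_conjLin_apply]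
    have h2 := hR.2
    rw [h1] at h2
    have h3 := (det_sandwich_comp_conjLin _ _ _).symm.trans h2
    have h4 : 0 ≤ realEmb c ^ 4 * (Quaternion.normSq (emb a) ^ 2 *
        Quaternion.normSq (emb (twistFun a)) ^ 2) := by positivity
    linarith

theorem isPrimitive_tau_smul {q : icosians} (hq : IsPrimitive q) :
    IsPrimitive ((⟨tau, tau_mem⟩ : ZTau) • q) := by
  intro c hc
  have h1 : (c * tau) • (q : ℍ[Qtau]) ∈ icosians := by
    rw [mul_smul]
    exact hc
  have h2 : c = c * tau * (tau - 1) := by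
    have := tau_mul_tau
    linear_combination (-c) * this
  rw [h2]
  exact ZTau.mul_mem (hq _ h1) (ZTau.sub_mem tau_mem ZTau.one_mem)

theorem tau_mul_star_tau : tau * star tau = -1 := by
  have := tau_mul_tau
  rw [star_tau]
  linear_combination -this

theorem twistNorm_tau_smul (q : icosians) :
    twistNorm ((⟨tau, tau_mem⟩ : ZTau) • q) = twistNorm q := by
  rw [twistNorm_smul]
  dsimp only
  rw [tau_mul_star_tau, map_neg, map_one, abs_neg, abs_one, one_mul]

/-- ττ' = -1: a unit of negative norm absorbs the sign while preserving primitivity and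
admissibility. -/
theorem rot_tau_smul (q : icosians) : rot ((⟨tau, tau_mem⟩ : ZTau) • q) = -rot q := by
  ext1 x
  rw [rot_smul_apply]
  dsimp only
  rw [tau_mul_star_tau, map_neg, map_one, abs_neg, abs_one, inv_one, one_mul, neg_smul, one_smul]
  rfl

theorem star_eq_self_iff {c : Qtau} (hc : star c = c) : ∃ r : ℚ, realEmb c = r := by
  have h := congrArg QuadraticAlgebra.im hc
  rw [QuadraticAlgebra.im_star] at h
  have h0 : c.im = 0 := by linarith
  refine ⟨c.re, Eq.trans (congrArg realEmb ?_) (realEmb.commutes c.re)⟩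
  ext
  · rfl
  · exact h0

/-- The square of |qq̃| is an integer, and a rational square root of an integer is an integer. -/
theorem isAdmissible_of_rat {q : icosians} {r : ℚ} (h : twistNorm q = r) : IsAdmissible q := by
  obtain ⟨k, hk⟩ := exists_natAbs_norm (normSq_mem q.2)
  have h1 := congrArg abs (twistNorm_sq q)
  rw [abs_realEmb_mul_star, hk, abs_of_nonneg (sq_nonneg _), h] at h1
  have h2 : r * r = (k : ℚ) := by
    rw [← sq]
    exact_mod_cast h1
  obtain ⟨j, hj⟩ := Rat.isSquare_natCast_iff.1 ⟨r, h2.symm⟩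
  refine ⟨j, ?_⟩
  rw [← abs_of_nonneg (twistNorm_nonneg q), ← abs_of_nonneg (Nat.cast_nonneg (α := ℝ) j),
    ← sq_eq_sq_iff_abs_eq_abs, h, h1, hj]
  push_cast
  ring

theorem exists_rot_of_isCoincidenceRotation {R : ℍ[ℝ] →ₗ[ℝ] ℍ[ℝ]}
    (hR : IsCoincidenceRotation rootLattice R) :
    ∃ q : icosians, IsPrimitive q ∧ IsAdmissible q ∧ R = rot q := by
  obtain ⟨c, a, hc, rfl⟩ := exists_sandwich_of_isCoincidenceRotation hR
  have hdet := hR.2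
  rw [det_sandwich] at hdet
  have ha : a ≠ 0 := by
    rintro rfl
    rw [emb_zero, map_zero] at hdet
    norm_num at hdet
  obtain ⟨e, q, hq, rfl⟩ := exists_smul_isPrimitive ha
  obtain ⟨r, hr⟩ := star_eq_self_iff (c := c * (e * star e)) (by
    rw [star_mul', star_mul', star_star, hc, mul_comm (star e)])
  have hform : sandwich (realEmb c) (emb (e • (q : ℍ[Qtau]))) (emb (twistFun (e • (q : ℍ[Qtau])))) =
      sandwich r (emb q) (emb (twist q)) := by
    ext1 x
    rw [sandwich_apply, sandwich_apply, twistFun_smul, emb_smul, emb_smul, ← hr, map_mul, map_mul]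
    simp only [smul_mul_assoc, mul_smul_comm, smul_smul]
    congr 1
    ring
  rw [hform] at hR ⊢
  have hm := twistNorm_ne_zero hq.ne_zero
  -- Applying the isometry to 1 shows |r|·|qq̃| = 1.
  have h1 := hR.1.1 1
  rw [sandwich_apply, mul_one, norm_smul, norm_mul, ← twistNorm_eq_mul, Real.norm_eq_abs,
    norm_one] at h1
  have hadm : IsAdmissible q := by
    refine isAdmissible_of_rat (r := |r|⁻¹) ?_
    rw [eq_comm, Rat.cast_inv, Rat.cast_abs]
    exact inv_eq_of_mul_eq_one_right h1
  rcases abs_choice (r : ℝ) with h | h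
  · refine ⟨q, hq, hadm, ?_⟩
    rw [rot_eq_sandwich, inv_eq_of_mul_eq_one_left h1, h]
  · refine ⟨_, isPrimitive_tau_smul hq, ?_, ?_⟩
    · rw [IsAdmissible, twistNorm_tau_smul]
      exact hadm
    · rw [rot_tau_smul, rot_eq_sandwich, inv_eq_of_mul_eq_one_left h1, h]
      ext1 x
      change _ = -(sandwich _ _ _ x)
      rw [sandwich_apply, sandwich_apply, neg_smul, neg_neg]

/-! ### The coincidence spectrum -/

theorem normSq_e0 : Quaternion.normSq e0 = 1 := by simp [Quaternion.normSq_def', e0]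

theorem normSq_e1 : Quaternion.normSq e1 = 1 := by simp [Quaternion.normSq_def', e1]

theorem normSq_e2 : Quaternion.normSq e2 = 1 := by
  have h := half_add_half
  rw [Quaternion.normSq_def']
  simp only [e2, quat_re, quat_imI, quat_imJ, quat_imK]
  linear_combination (half + half + 1) * h

theorem normSq_e3 : Quaternion.normSq e3 = 1 := by
  have h := half_add_half
  have ht := tau_mul_tau
  rw [Quaternion.normSq_def']
  simp only [e3, quat_re, quat_imI, quat_imJ, quat_imK]
  linear_combination (2 * half ^ 2) * ht + (half + half + 1) * h

/-! ### Primitive icosians of prescribed norm -/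

theorem normSq_one_add_smul (c : Qtau) (h : ℍ[Qtau]) : Quaternion.normSq (1 + c • h) =
    1 + c * trd h + c ^ 2 * Quaternion.normSq h := by
  simp [Quaternion.normSq_def', trd]
  ring

/-- Some norm-one f avoids Y. If f ∈ X, take norm-one h with fh ∉ X such that 1 + ch also has norm
one for a unit c. Then fh works if it avoids Y; otherwise f(1 + ch) = f + c·fh avoids both. -/
theorem exists_unit_notMem {X Y : Submodule ZTau ℍ[Qtau]} (hX : ¬ icosians ≤ X)
    (hY : ¬ icosians ≤ Y) : ∃ u ∈ icosians, Quaternion.normSq u = 1 ∧ u ∉ X ∧ u ∉ Y := by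
  obtain ⟨f, hf, hf1, hfY⟩ : ∃ f ∈ icosians, Quaternion.normSq f = 1 ∧ f ∉ Y := by
    by_contra! h
    refine hY (Submodule.span_le.2 ?_)
    rintro _ (rfl | rfl | rfl | rfl)
    exacts [h _ (icosianVec_mem 0) normSq_e0, h _ (icosianVec_mem 1) normSq_e1,
      h _ (icosianVec_mem 2) normSq_e2, h _ (icosianVec_mem 3) normSq_e3]
  by_cases hfX : f ∈ X
  swap
  · exact ⟨f, hf, hf1, hfX, hfY⟩
  have e0_eq : e0 = 1 := by apply Quaternion.ext <;> simp [e0]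
  obtain ⟨h, c, hh, hh1, hu, hn, hhX⟩ : ∃ (h : ℍ[Qtau]) (c : ZTauˣ), h ∈ icosians ∧
      Quaternion.normSq h = 1 ∧ Quaternion.normSq (1 + ((c : ZTau) : Qtau) • h) = 1 ∧
      1 + ((c : ZTau) : Qtau) • h ∈ icosians ∧ f * h ∉ X := by
    have hmem : ∀ (c : ZTauˣ) h, h ∈ icosians → 1 + ((c : ZTau) : Qtau) • h ∈ icosians :=
      fun c h hh => icosians.add_mem one_mem_icosians (smul_mem_icosians (Subtype.prop _) hh)
    by_contra! hall
    have ht : (⟨tau, tau_mem⟩ : ZTau) * (⟨tau, tau_mem⟩ - 1) = 1 :=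
      Subtype.ext (by
        have := tau_mul_tau
        change tau * (tau - 1) = 1
        linear_combination this)
    let T : ZTauˣ := ⟨_, _, (mul_comm _ _).trans ht, ht⟩
    have hm1 : (((-1 : ZTauˣ) : ZTau) : Qtau) = -1 := rfl
    -- |1 + ch|² = 1 for |h| = 1 when c = -tr h, which must be a unit. As tr e₁ = 0, the vector e₀ +
    -- e₁ - e₂ replaces e₁; with e₀, e₂, e₃ it still spans 𝕀.
    have k2 : f * e2 ∈ X := hall e2 (-1) (icosianVec_mem 2) normSq_e2 (by
      rw [normSq_one_add_smul, normSq_e2, hm1]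
      have : trd e2 = 1 := by simp [trd, e2, half_eq]
      rw [this]; ring) (hmem _ _ (icosianVec_mem 2))
    have hTc : ((T : ZTau) : Qtau) = tau - 1 := rfl
    have k3 : f * e3 ∈ X := hall e3 T (icosianVec_mem 3) normSq_e3 (by
      rw [normSq_one_add_smul, normSq_e3, hTc]
      have : trd e3 = 1 - tau := by simp [trd, e3, half_eq]
      rw [this]; ring) (hmem _ _ (icosianVec_mem 3))
    have hmem' : e0 + e1 - e2 ∈ icosians := icosians.sub_mem
      (icosians.add_mem (icosianVec_mem 0) (icosianVec_mem 1)) (icosianVec_mem 2)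
    have h1' : Quaternion.normSq (e0 + e1 - e2) = 1 := by
      have h := half_add_half
      rw [Quaternion.normSq_def']
      simp [e0, e1, e2]
      linear_combination (half + half - 1) * h
    have k1 : f * (e0 + e1 - e2) ∈ X := hall _ (-1) hmem' h1' (by
      rw [normSq_one_add_smul, h1', hm1]
      have : trd (e0 + e1 - e2) = 1 := by simp [trd, e0, e1, e2, half_eq]; ring
      rw [this]; ring) (hmem _ _ hmem')
    have k0 : f * e0 ∈ X := by rwa [e0_eq, mul_one]
    have k1' : f * e1 ∈ X := by
      have e : f * e1 = f * (e0 + e1 - e2) + f * e2 - f * e0 := by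
        rw [← mul_add, ← mul_sub]
        congr 1
        abel
      rw [e]
      exact X.sub_mem (X.add_mem k1 k2) k0
    apply hX
    intro x hx
    have hx' : star f * x ∈ icosians := mul_mem_icosians (star_mem_icosians hf) hx
    have e : x = f * (star f * x) := by
      rw [← mul_assoc, self_mul_star_smul, hf1, Quaternion.coe_one, one_mul]
    obtain ⟨a, b, c, d, hd⟩ := mem_icosians.1 hx'
    rw [e, hd, mul_add, mul_add, mul_add]
    simp only [zsmul_def, mul_smul_comm]
    exact X.add_mem (X.add_mem (X.add_mem (X.smul_mem a k0) (X.smul_mem b k1')) (X.smul_mem c k2))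
      (X.smul_mem d k3)
  by_cases hgY : f * h ∈ Y
  swap
  · exact ⟨f * h, mul_mem_icosians hf hh, by rw [map_mul, hf1, hh1, one_mul], hhX, hgY⟩
  have e : f * (1 + ((c : ZTau) : Qtau) • h) = f + (c : ZTau) • (f * h) := by
    rw [mul_add, mul_one, mul_smul_comm]
    rfl
  refine ⟨_, mul_mem_icosians hf hn, by rw [map_mul, hf1, hu, one_mul], fun h' => hhX ?_,
    fun h' => hfY ?_⟩
  · rw [e] at h'
    have h2 := X.smul_mem ((c⁻¹ : ZTauˣ) : ZTau) ((X.add_mem_iff_right hfX).1 h')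
    rwa [smul_smul, Units.inv_mul, one_smul] at h2
  · rw [e] at h'
    exact (Y.add_mem_iff_left (Y.smul_mem _ hgY)).1 h'

/-- A prime π above p has norm ±pⁱ with i ≥ 1, so p ∣ ππ', and every prime above p is associated to
π or π'. -/
theorem exists_pair_of_prime {p : ℕ} (hp : p.Prime) : ∃ π₁ π₂ : ZTau, ¬IsUnit π₁ ∧ ¬IsUnit π₂ ∧
    ∀ ρ : ZTau, Prime ρ → ρ ∣ p → π₁ ∣ ρ ∨ π₂ ∣ ρ := by
  have hconj : ∀ {c : ZTau}, IsUnit (conjZ c) → IsUnit c := fun {c} h => by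
    have := h.map conjZ
    rwa [conjZ_conjZ] at this
  have hinv : ∀ {a b : ZTau}, Prime a → ¬IsUnit b → b ∣ a → a ∣ b := by
    rintro a b ha hb ⟨c, hc⟩
    rcases ha.irreducible.isUnit_or_isUnit hc with h | h
    · exact absurd h hb
    · obtain ⟨u, rfl⟩ := h
      exact ⟨(u⁻¹ : ZTauˣ), by rw [hc, mul_assoc, Units.mul_inv, mul_one]⟩
  by_cases hex : ∃ π : ZTau, Prime π ∧ π ∣ p
  swap
  · push Not at hex
    exact ⟨0, 0, not_isUnit_zero, not_isUnit_zero, fun ρ h1 h2 => absurd h2 (hex ρ h1)⟩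
  obtain ⟨π, hπ, e, he⟩ := hex
  refine ⟨π, conjZ π, hπ.not_isUnit, fun h => hπ.not_isUnit (hconj h), fun ρ hρ hρp => ?_⟩
  have hdvd : (p : ZTau) ∣ π * conjZ π := by
    obtain ⟨a, ha⟩ := exists_natAbs_norm π.2
    obtain ⟨b, hb⟩ := exists_natAbs_norm e.2
    have h1 := congrArg (fun c : ZTau => |QuadraticAlgebra.norm (c : Qtau)|) he
    simp only [ZTau.coe_mul, map_mul, abs_mul, ha, hb] at h1
    have h2 : QuadraticAlgebra.norm (((p : ZTau) : Qtau)) = (p : ℚ) ^ 2 := by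
      have : ((p : ZTau) : Qtau) = (p : Qtau) := rfl
      rw [this, norm_eq]
      simp
    rw [h2, abs_of_nonneg (by positivity)] at h1
    have h3 : p ^ 2 = a * b := by exact_mod_cast h1
    have h4 : π * conjZ π = a ∨ π * conjZ π = -a := by
      have h5 := QuadraticAlgebra.algebraMap_norm_eq_mul_star (π : Qtau)
      rcases abs_choice (QuadraticAlgebra.norm (π : Qtau)) with h | h
      · left
        apply Subtype.ext
        rw [ZTau.coe_mul, coe_conjZ, ← h5, ← h, ha, map_natCast]
        rfl
      · right
        apply Subtype.ext
        have h6 : QuadraticAlgebra.norm (π : Qtau) = -a := by rw [← ha, h, neg_neg]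
        rw [ZTau.coe_mul, coe_conjZ, ← h5, h6, map_neg, map_natCast]
        rfl
    obtain ⟨i, hi, rfl⟩ := (Nat.dvd_prime_pow hp).1 (Dvd.intro b h3.symm)
    have hi0 : i ≠ 0 := by
      rintro rfl
      apply hπ.not_isUnit
      rw [pow_zero, Nat.cast_one] at h4
      rcases h4 with h | h
      · exact IsUnit.of_mul_eq_one _ h
      · exact IsUnit.of_mul_eq_one (-conjZ π) (by rw [mul_neg, h, neg_neg])
    have h7 : (p : ZTau) ∣ ((p ^ i : ℕ) : ZTau) := Nat.cast_dvd_cast (dvd_pow_self p hi0)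
    rcases h4 with h | h <;> rw [h]
    · exact h7
    · exact (dvd_neg).2 h7
  rcases hρ.dvd_or_dvd (hρp.trans hdvd) with h | h
  · left
    exact hinv hπ hρ.not_isUnit h
  · right
    have h1 : conjZ ρ ∣ π := by
      have := map_dvd conjZ h
      rwa [conjZ_conjZ] at this
    have h2 := hinv hπ (fun h => hρ.not_isUnit (hconj h)) h1
    have := map_dvd conjZ h2
    rwa [conjZ_conjZ] at this

/-- For odd p, Lagrange's four-square theorem supplies r. Its traces represent 2x for every
coordinate x, and also p; not all coordinates are divisible by p, so 1 is represented. -/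
theorem exists_trd_of_prime {p : ℕ} (hp : p.Prime) : ∃ r ∈ icosians,
    Quaternion.normSq r = (p : Qtau) ∧ ∃ t ∈ icosians, trd (r * t) = 1 := by
  have hj : quat 0 0 1 0 ∈ icosians := by
    convert icosians.neg_mem (dualVec_mem 2) using 1
    apply Quaternion.ext <;> simp [dualVec]
  have hk : quat 0 0 0 1 ∈ icosians := by
    convert icosians.sub_mem hj (dualVec_mem 3) using 1
    apply Quaternion.ext <;> simp [dualVec]
  rcases hp.eq_two_or_odd' with rfl | hodd
  · refine ⟨e0 + e1, icosians.add_mem (icosianVec_mem 0) (icosianVec_mem 1), ?_, dualVec 0,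
      dualVec_mem 0, ?_⟩
    · simp [Quaternion.normSq_def', e0, e1]; norm_num
    · simp [trd, dualVec, e0, e1, half_eq]
  obtain ⟨a, b, c, d, hsum⟩ := Nat.sum_four_squares p
  have hz : ∀ (m : ℤ) {x : ℍ[Qtau]}, x ∈ icosians → m • x ∈ icosians :=
    fun m x hx => icosians.toAddSubgroup.zsmul_mem hx m
  have hr : (a : ℤ) • e0 + (b : ℤ) • e1 + (c : ℤ) • quat 0 0 1 0 + (d : ℤ) • quat 0 0 0 1 ∈
      icosians := icosians.add_mem (icosians.add_mem (icosians.add_mem (hz _ (icosianVec_mem 0))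
        (hz _ (icosianVec_mem 1))) (hz _ hj)) (hz _ hk)
  have hr' : (a : ℤ) • e0 + (b : ℤ) • e1 + (c : ℤ) • quat 0 0 1 0 + (d : ℤ) • quat 0 0 0 1 =
      (quat a b c d : ℍ[Qtau]) := by
    apply Quaternion.ext <;> simp [e0, e1]
  rw [hr'] at hr
  have hcast : (a : Qtau) ^ 2 + (b : Qtau) ^ 2 + (c : Qtau) ^ 2 + (d : Qtau) ^ 2 = p := by
    exact_mod_cast hsum
  refine ⟨_, hr, by simpa [Quaternion.normSq_def'] using hcast, ?_⟩
  have key : ∀ x : ℕ, ¬p ∣ x → (∃ t ∈ icosians, trd (quat (a : Qtau) b c d * t) = 2 * x) →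
      ∃ t ∈ icosians, trd (quat (a : Qtau) b c d * t) = 1 := by
    rintro x hx ⟨t, ht, htx⟩
    have hcop : IsCoprime ((2 * x : ℕ) : ℤ) p := by
      rw [Nat.isCoprime_iff_coprime]
      exact Nat.Coprime.mul_left (Nat.coprime_two_left.2 hodd)
        ((Nat.Prime.coprime_iff_not_dvd hp).2 hx).symm
    obtain ⟨u, v, huv⟩ := hcop
    refine ⟨u • t + v • (((a + b + c + d : ℕ) : ℤ) • star e2 + (-(b + c + d) : ℤ) • e0 +
      (c + d : ℤ) • e1 + (d : ℤ) • quat 0 0 1 0), icosians.add_mem (hz _ ht) (hz _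
        (icosians.add_mem (icosians.add_mem (icosians.add_mem
          (hz _ (star_mem_icosians (icosianVec_mem 2))) (hz _ (icosianVec_mem 0)))
          (hz _ (icosianVec_mem 1))) (hz _ hj))), ?_⟩
    -- ē₂ contributes (a + b + c + d)², and the other terms remove twice the mixed products, leaving
    -- a² + b² + c² + d² = p.
    have e1' : trd (quat (a : Qtau) b c d * (((a + b + c + d : ℕ) : ℤ) • star e2 +
        (-(b + c + d) : ℤ) • e0 + (c + d : ℤ) • e1 + (d : ℤ) • quat 0 0 1 0)) = p := by
      rw [← hcast]
      simp [trd, e0, e1, e2, half_eq]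
      ring
    have hzt : ∀ (m : ℤ) (y : ℍ[Qtau]), trd (quat (a : Qtau) b c d * (m • y)) =
        m * trd (quat (a : Qtau) b c d * y) := by
      intro m y
      simp [trd]
      ring
    rw [mul_add, trd_add, hzt, hzt, htx, e1']
    exact_mod_cast huv
  by_cases ha : p ∣ a
  swap
  · exact key a ha ⟨e0, icosianVec_mem 0, by simp [trd, e0]⟩
  by_cases hb : p ∣ b
  swap
  · exact key b hb ⟨-e1, icosians.neg_mem (icosianVec_mem 1), by simp [trd, e1]⟩
  by_cases hc : p ∣ c
  swap
  · exact key c hc ⟨-quat 0 0 1 0, icosians.neg_mem hj, by simp [trd]⟩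
  by_cases hd : p ∣ d
  swap
  · exact key d hd ⟨-quat 0 0 0 1, icosians.neg_mem hk, by simp [trd]⟩
  exfalso
  have h2 : p ^ 2 ∣ p := by
    nth_rw 2 [← hsum]
    exact dvd_add (dvd_add (dvd_add (pow_dvd_pow_of_dvd ha 2) (pow_dvd_pow_of_dvd hb 2))
      (pow_dvd_pow_of_dvd hc 2)) (pow_dvd_pow_of_dvd hd 2)
  have := Nat.le_of_dvd hp.pos h2
  nlinarith [hp.two_le]

/-- The `ℤ[τ]`-module of quaternions `u` such that `q u r` is divisible by `π`. -/
def divisorModule (q r : ℍ[Qtau]) (π : ZTau) : Submodule ZTau ℍ[Qtau] where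
  carrier := {u | ∃ y ∈ icosians, q * u * r = π • y}
  zero_mem' := ⟨0, icosians.zero_mem, by rw [mul_zero, zero_mul]; exact (smul_zero π).symm⟩
  add_mem' := by
    rintro u v ⟨y, hy, hu⟩ ⟨z, hz, hv⟩
    exact ⟨y + z, icosians.add_mem hy hz, by rw [mul_add, add_mul, hu, hv, smul_add]⟩
  smul_mem' := by
    rintro c u ⟨y, hy, hu⟩
    exact ⟨c • y, icosians.smul_mem c hy, by
      rw [smul_comm, ← hu, zsmul_def, zsmul_def, mul_smul_comm, smul_mul_assoc]⟩

/-- If q𝕀r ⊆ π𝕀, the Casimir identity applied to rt gives q ∈ π𝕀, which contradicts tr(qs) = 1. -/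
theorem not_le_divisorModule {q r : ℍ[Qtau]} (hq : ∃ s ∈ icosians, trd (q * s) = 1)
    (hr : ∃ t ∈ icosians, trd (r * t) = 1) {π : ZTau} (hπ : ¬IsUnit π) :
    ¬icosians ≤ divisorModule q r π := by
  intro h
  obtain ⟨s, hs, hs1⟩ := hq
  obtain ⟨t, ht, ht1⟩ := hr
  choose y hy hxy using fun i => h (icosianVec_mem i)
  have e1 : q = (π : Qtau) • ∑ i, y i * (t * dualVec i) := by
    calc q = q * ∑ i, icosianVec i * (r * t) * dualVec i := by
          rw [casimir, ht1, Quaternion.coe_one, mul_one]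
      _ = ∑ i, (q * icosianVec i * r) * (t * dualVec i) := by
          rw [Finset.mul_sum]
          simp only [mul_assoc]
      _ = _ := by
          rw [Finset.smul_sum]
          refine Finset.sum_congr rfl fun i _ => ?_
          rw [hxy, zsmul_def, smul_mul_assoc]
  have hw : ∑ i, y i * (t * dualVec i) ∈ icosians :=
    icosians.sum_mem fun i _ => mul_mem_icosians (hy i) (mul_mem_icosians ht (dualVec_mem i))
  have h2 := hs1
  rw [e1, smul_mul_assoc, trd_smul] at h2
  exact hπ (IsUnit.of_mul_eq_one ⟨_, trd_mem_of_mem (mul_mem_icosians hw hs)⟩ (Subtype.ext h2))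

/-- A nonzero icosian is primitive if it is not divisible by any prime of `ℤ[τ]`. -/
theorem isPrimitive_of_forall_prime {q : icosians} (h0 : (q : ℍ[Qtau]) ≠ 0)
    (h : ∀ ρ : ZTau, Prime ρ → ¬∃ y ∈ icosians, (q : ℍ[Qtau]) = ρ • y) : IsPrimitive q := by
  obtain ⟨c, p, hp, e⟩ := exists_smul_isPrimitive h0
  have hc : c ∈ ZTau := hp c (e ▸ q.2)
  have hc0 : (⟨c, hc⟩ : ZTau) ≠ 0 := by
    intro hc0
    have : c = 0 := congrArg Subtype.val hc0
    rw [this] at e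
    exact h0 (e.trans (zero_smul Qtau (p : ℍ[Qtau])))
  by_cases hu : IsUnit (⟨c, hc⟩ : ZTau)
  · obtain ⟨u, hu⟩ := hu
    have hcu : ((u⁻¹ : ZTauˣ) : ZTau) * c = (1 : Qtau) := by
      have := congrArg Subtype.val (Units.inv_mul u)
      rw [ZTau.coe_mul, hu] at this
      exact this
    intro x hx
    rw [e, smul_smul] at hx
    have h1 := hp _ hx
    have h2 : x = ((u⁻¹ : ZTauˣ) : ZTau) * (x * c) := by
      rw [mul_left_comm, hcu, mul_one]
    rw [h2]
    exact ZTau.mul_mem (Subtype.prop _) h1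
  · exfalso
    obtain ⟨ρ, hρ, m, hm⟩ := WfDvdMonoid.exists_irreducible_factor hu hc0
    refine h ρ hρ.prime ⟨m • (p : ℍ[Qtau]), icosians.smul_mem m p.2, ?_⟩
    have hm' : c = ρ * m := congrArg Subtype.val hm
    rw [e, hm', zsmul_def, zsmul_def, smul_smul]

/-- A prime dividing qur divides qur·r̄ū = pq, hence p because q is primitive. So only the two
primes above p matter, and u is chosen to avoid both. -/
theorem exists_isPrimitive_mul_prime {q : icosians} (hq : IsPrimitive q) {p : ℕ} (hp : p.Prime) :
    ∃ q' : icosians, IsPrimitive q' ∧ Quaternion.normSq (q' : ℍ[Qtau]) =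
      p * Quaternion.normSq (q : ℍ[Qtau]) := by
  obtain ⟨r, hr, hrn, hr1⟩ := exists_trd_of_prime hp
  have hq1 := isPrimitive_iff_exists_trd.1 hq
  obtain ⟨π₁, π₂, h1, h2, hpair⟩ := exists_pair_of_prime hp
  obtain ⟨u, hu, hun, hu1, hu2⟩ := exists_unit_notMem (not_le_divisorModule hq1 hr1 h1)
    (not_le_divisorModule hq1 hr1 h2)
  have hn : Quaternion.normSq ((q : ℍ[Qtau]) * u * r) =
      p * Quaternion.normSq (q : ℍ[Qtau]) := by
    rw [map_mul, map_mul, hun, hrn, mul_one, mul_comm]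
  have hmem : (q : ℍ[Qtau]) * u * r ∈ icosians := mul_mem_icosians (mul_mem_icosians q.2 hu) hr
  have hne : (q : ℍ[Qtau]) * u * r ≠ 0 := by
    intro h
    rw [h, map_zero] at hn
    exact mul_ne_zero (Nat.cast_ne_zero.2 hp.pos.ne') hq.normSq_ne_zero hn.symm
  refine ⟨⟨_, hmem⟩, isPrimitive_of_forall_prime hne fun ρ hρ => ?_, hn⟩
  rintro ⟨y, hy, e⟩
  obtain ⟨s, hs, hs1⟩ := hq1
  have hρp : ρ ∣ p := by
    refine ⟨⟨_, trd_mem_of_mem (mul_mem_icosians (mul_mem_icosians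
      (mul_mem_icosians hy (star_mem_icosians hr)) (star_mem_icosians hu)) hs)⟩, Subtype.ext ?_⟩
    have h3 : (q : ℍ[Qtau]) * u * r * star r * star u = (p : Qtau) • (q : ℍ[Qtau]) := by
      rw [mul_assoc _ r, self_mul_star_smul, hrn, Quaternion.mul_coe_eq_smul, smul_mul_assoc,
        mul_assoc, self_mul_star_smul, hun, Quaternion.coe_one, mul_one]
    dsimp only at e
    rw [e] at h3
    have h4 := congrArg (fun x => trd (x * s)) h3
    simp only [zsmul_def, smul_mul_assoc, trd_smul, hs1, mul_one] at h4
    exact h4.symm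
  rcases hpair ρ hρ hρp with ⟨c, rfl⟩ | ⟨c, rfl⟩
  · exact hu1 ⟨c • y, icosians.smul_mem c hy, by rw [smul_smul]; exact e⟩
  · exact hu2 ⟨c • y, icosians.smul_mem c hy, by rw [smul_smul]; exact e⟩

/-- Every positive integer is the norm of a primitive icosian. -/
theorem exists_isPrimitive_normSq_eq (n : ℕ) (hn : 0 < n) :
    ∃ q : icosians, IsPrimitive q ∧ Quaternion.normSq (q : ℍ[Qtau]) = n := by
  induction n using induction_on_primes with
  | zero => exact absurd hn (lt_irrefl _)
  | one =>
    refine ⟨⟨1, one_mem_icosians⟩, isPrimitive_iff_exists_trd.2 ⟨e2, icosianVec_mem 2, ?_⟩, ?_⟩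
    · simp [trd, e2, half_eq]
    · simp
  | prime_mul p a hp ih =>
    obtain ⟨q, hq, hqn⟩ := ih (Nat.pos_of_mul_pos_left hn)
    obtain ⟨q', hq', hqn'⟩ := exists_isPrimitive_mul_prime hq hp
    exact ⟨q', hq', by rw [hqn', hqn, Nat.cast_mul]⟩

theorem exists_normData_coincidenceIndex_eq (n : ℕ) (hn : 0 < n) :
    ∃ q : icosians, IsCoincidenceRotation rootLattice (rot q) ∧
      coincidenceIndex rootLattice (rot q) = n := by
  obtain ⟨q, hq, hqn⟩ := exists_isPrimitive_normSq_eq n hn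
  have hadm : IsAdmissible q := by
    refine ⟨n, ?_⟩
    have h := twistNorm_sq q
    rw [hqn, star_natCast, map_mul, map_natCast, ← sq] at h
    exact (pow_left_inj₀ (twistNorm_nonneg q) (Nat.cast_nonneg n) two_ne_zero).1 h
  obtain ⟨d, β, k, h⟩ := exists_normData hq hadm
  refine ⟨q, h.isCoincidenceRotation, ?_⟩
  have e1 : nrd q = (n : ZTau) := Subtype.ext hqn
  have e2 : nrd (twist q) = (n : ZTau) := Subtype.ext (by
    have := normSq_twistFun (q : ℍ[Qtau])
    rw [hqn, star_natCast] at this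
    exact this)
  have hlcm := h.isLCM_coincidenceIndex
  rw [e1, e2] at hlcm
  have hpos : 0 < coincidenceIndex rootLattice (rot q) := by
    rw [h.coincidenceIndex_eq]
    exact Nat.mul_pos h.d_pos (pow_pos h.k_pos 2)
  -- Σ and n are associated in ℤ[τ]; comparing ideal indices, Σ² = n².
  have d1 := idealIndex_dvd hlcm.1.1
  have d2 := idealIndex_dvd (hlcm.2 _ dvd_rfl dvd_rfl)
  rw [idealIndex_natCast hn, idealIndex_natCast hpos] at d1 d2
  exact Nat.pow_left_injective two_ne_zero (Nat.dvd_antisymm d2 d1)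

theorem spectrum_eq : coincidenceSpectrum rootLattice = {n | 0 < n} ∧
    rotationSpectrum rootLattice = {n | 0 < n} := by
  constructor
  · ext n
    constructor
    · rintro ⟨R, hR, rfl⟩
      exact Nat.pos_of_ne_zero hR.2.relIndex_ne_zero
    · intro hn
      obtain ⟨q, h1, h2⟩ := exists_normData_coincidenceIndex_eq n hn
      exact ⟨_, h1.1, h2⟩
  · ext n
    constructor
    · rintro ⟨R, hR, rfl⟩
      exact Nat.pos_of_ne_zero hR.1.2.relIndex_ne_zero
    · intro hn
      obtain ⟨q, h1, h2⟩ := exists_normData_coincidenceIndex_eq n hn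
      exact ⟨_, h1, h2⟩

end A4
end

/-! ### Assembly of the theorem -/

open A4 in
theorem mainTheorem5 :
    -- `L = {x ∈ 𝕀 | x = x̃} = {x + x̃ | x ∈ 𝕀}`
    ((rootLattice : Set ℍ[ℝ]) = {z | ∃ x : icosians, x = twist x ∧ z = emb x} ∧
      (rootLattice : Set ℍ[ℝ]) = {z | ∃ x : icosians, z = emb (x + twist x)}) ∧
    -- the coincidence rotations are exactly the `R(q)`, `q` primitive admissible
    {R | IsCoincidenceRotation rootLattice R} =
      {R | ∃ q : icosians, IsPrimitive q ∧ IsAdmissible q ∧ R = rot q} ∧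
    -- the coincidence index
    (∀ q : icosians, IsPrimitive q → IsAdmissible q →
      IsLCM (nrd q) (nrd (twist q)) (coincidenceIndex rootLattice (rot q) : ZTau) ∧
      (∀ g : ZTau, IsGCD (nrd q) (nrd (twist q)) g →
        Associated ((coincidenceIndex rootLattice (rot q) : ZTau) * g)
          (nrd q * nrd (twist q))) ∧
      (∀ α : ZTau, IsExtensionFactor q α →
        (coincidenceIndex rootLattice (rot q) : ℝ) =
          twistNorm q * |realEmb (α * star (α : Qtau))|)) ∧
    -- the coincidence spectrum
    (coincidenceSpectrum rootLattice = {n | 0 < n} ∧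
      rotationSpectrum rootLattice = {n | 0 < n}) ∧
    -- the factors `α_q` exist, and `α_q̃ = α_q'`
    (∀ q : icosians, IsPrimitive q → IsAdmissible q →
      ∃ α g : ZTau, IsGCD (nrd q) (nrd (twist q)) g ∧ α ^ 2 * g = nrd (twist q) ∧
        star (α : Qtau) ^ 2 * g = nrd q) ∧
    -- the coincidence site lattices
    (∀ q : icosians, IsPrimitive q → IsAdmissible q →
      ∀ α : ZTau, IsExtensionFactor q α →
        coincidenceLattice rootLattice (rot q) = coincidenceLattice rootLattice (rot (α • q)) ∧
        (coincidenceLattice rootLattice (rot q) : Set ℍ[ℝ]) =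
          {z | ∃ x : icosians, z = emb ((α • q : icosians) * x + twist x * twist (α • q))} ∧
        (coincidenceLattice rootLattice (rot q) : Set ℍ[ℝ]) =
          {z | ∃ x y : icosians,
            z = emb ((α • q : icosians) * x + y * twist (α • q))} ∩ rootLattice) := by
  refine ⟨⟨rootLattice_eq_fixed, rootLattice_eq_trace⟩, ?_, fun q hq ha => ?_, spectrum_eq,
    fun q hq ha => ?_, fun q hq ha α hα => ?_⟩
  · ext R
    constructor
    · exact fun hR => exists_rot_of_isCoincidenceRotation hR
    · rintro ⟨q, hq, ha, rfl⟩
      obtain ⟨d, β, k, h⟩ := exists_normData hq ha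
      exact h.isCoincidenceRotation
  · obtain ⟨d, β, k, h⟩ := exists_normData hq ha
    exact ⟨h.isLCM_coincidenceIndex, fun g hg => h.associated_mul hg,
      fun α hα => h.coincidenceIndex_eq_twistNorm_mul hα⟩
  · obtain ⟨d, β, k, h⟩ := exists_normData hq ha
    exact h.exists_extensionFactor
  · obtain ⟨d, β, k, h⟩ := exists_normData hq ha
    exact ⟨h.coincidenceLattice_smul hα, h.coe_coincidenceLattice_eq_trace hα,
      h.coe_coincidenceLattice_eq_inter hα⟩
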